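/- Let $f_1=\begin{pmatrix}0&1\\-1&0\end{pmatrix}$, $f_2=\begin{pmatrix}0&1\\1&0\end{pmatrix}$, $f_3=\begin{pmatrix}1&0\\0&-1\end{pmatrix}$ be the standard basis of $\mathfrak{sl}(2,\mathbb R)$, let $G=\mathbb R\times \mathrm{SL}(2,\mathbb R)$, and let $f_0$ be the generator of the Lie algebra of the factor $\mathbb R$. Let $g$ be the left-invariant metric on $G$ for which $f_0,f_1,f_2,f_3$ are orthogonal with $\langle f_0,f_0\rangle=\langle f_1,f_1\rangle=-1$ and $\langle f_2,f_2\rangle=\langle f_3,f_3\rangle=+1$, and let $J,\tilde J$ be the left-invariant endomorphisms of $TG$ with $$Jf_0=f_1,\ Jf_1=-f_0,\ Jf_2=f_3,\ Jf_3=-f_2,\qquad \tilde Jf_0=f_2,\ \tilde Jf_2=f_0,\ \tilde Jf_1=-f_3,\ \tilde Jf_3=-f_1 .$$ Give $\mathrm{SL}(2,\mathbb R)$ the left-invariant Lorentzian metric for which $f_1,f_2,f_3$ are orthogonal with squares $-1,1,1$ (one eighth of the Killing form). Let $\mathbb H^2(0,2)$ be the upper half-plane with the metric $(dx^2+dy^2)/(4y^2)$,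 and let $\mathbb H^2(1,1)$ be the cylinder $S^1\times\mathbb R$ with the Lorentzian metric induced by the two-fold covering $(u,s)\mapsto\frac12(\cosh(s)\,u^2,\sinh s)\in\mathbb C\times\mathbb R=\mathbb R^3$ of the pseudo-sphere $-x^2-y^2+z^2=-\frac14$ in $(\mathbb R^3,-dx^2-dy^2+dz^2)$. On $\mathbb R\times\mathbb H^2(0,2)$ and $\mathbb R\times\mathbb H^2(1,1)$ take the product metric with $-dt^2$ on $\mathbb R$. A smooth map $\pi:(M,g_M)\to(N,g_N)$ of pseudo-Riemannian manifolds is a pseudo-Riemannian submersion if $\pi_*$ is everywhere surjective, $g_M$ is nondegenerate on $\mathcal V=\ker\pi_*$, and $\pi_*$ is an isometry from $\mathcal H=\mathcal V^\perp$ at each point to the tangent space of $N$. It is anti-invariant Hermitian for $J$ if $J^2=-\mathrm{id}$, $J$ is integrable, $g_M(JX,JY)=g_M(X,Y)$ and $J\mathcal V\subset\mathcal H$; it is anti-invariant para-Hermitian for $\tilde J$ if $g_M$ has neutral signature, $\tilde J^2=\mathrm{id}$, $g_M(\tilde JX,\tilde JY)=-g_M(X,Y)$ and $\tilde J\mathcal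 V\subset\mathcal H$; it is anti-invariant para-quaternion for $J_1,J_2,J_3$ if $J_1$ is Hermitian and $J_2,J_3$ are para-Hermitian as above, $J_1J_2=-J_2J_1=J_3$, $J_2J_3=-J_3J_2=-J_1$, $J_3J_1=-J_1J_3=J_2$, and $J_i\mathcal V\subset\mathcal H$ for $i=1,2,3$. Then $G$ and $\mathrm{SL}(2,\mathbb R)$ are Lie groups, $g$ is a bi-invariant pseudo-Riemannian metric of neutral signature, the metric on $\mathrm{SL}(2,\mathbb R)$ is bi-invariant, and $\mathbb H^2(0,2)$ and $\mathbb H^2(1,1)$ have constant sectional curvature $-4$. For each of $\mathfrak h=\mathrm{Span}\{f_0\}$, $\mathrm{Span}\{f_1\}$, $\mathrm{Span}\{f_2\}$, $\mathrm{Span}\{f_0,f_2\}$ there is a closed connected subgroup of $G$ with Lie algebra $\mathfrak h$. If $H$ is a closed connected subgroup of $G$ with Lie algebra $\mathfrak h$ and $\pi:G\to G/H$ is the natural projection, then, after an identification of $G/H$ with the base named: 1. If $\mathfrak h=\mathrm{Span}\{f_0\}$, then $\pi$ is an anti-invariant Hermitian (for $J$), an anti-invariant para-Hermitian (for $\tilde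 J$) and an anti-invariant para-quaternion (for $J,\tilde J,J\tilde J$) pseudo-Riemannian submersion from $G$ to $\mathrm{SL}(2,\mathbb R)$. 2. If $\mathfrak h=\mathrm{Span}\{f_1\}$, the same holds with base $\mathbb R\times\mathbb H^2(0,2)$. 3. If $\mathfrak h=\mathrm{Span}\{f_2\}$, the same holds with base $\mathbb R\times\mathbb H^2(1,1)$. 4. If $\mathfrak h=\mathrm{Span}\{f_0,f_2\}$, then $\pi$ is an anti-invariant Hermitian (for $J$) pseudo-Riemannian submersion from $G$ to $\mathbb H^2(1,1)$. -/

import Mathlib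

open scoped Manifold ContDiff UpperHalfPlane

namespace AntiInvariant

noncomputable section

section General

variable {E : Type*} [NormedAddCommGroup E] [NormedSpace ℝ E]
  {H : Type*} [TopologicalSpace H] (I : ModelWithCorners ℝ E H)
  {M : Type*} [TopologicalSpace M] [ChartedSpace H M]
  {E' : Type*} [NormedAddCommGroup E'] [NormedSpace ℝ E']
  {H' : Type*} [TopologicalSpace H'] (I' : ModelWithCorners ℝ E' H')
  {N : Type*} [TopologicalSpace N] [ChartedSpace H' N]

/-- A (not necessarily smooth) vector field on `M`. -/
abbrev VField (M : Type*) [TopologicalSpace M] [ChartedSpace H M] : Type _ :=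
  (x : M) → TangentSpace I x

/-- A (not necessarily smooth) field of bilinear forms on the tangent spaces of `M`. -/
abbrev FormField (M : Type*) [TopologicalSpace M] [ChartedSpace H M] : Type _ :=
  (x : M) → LinearMap.BilinForm ℝ (TangentSpace I x)

/-- A (not necessarily smooth) field of endomorphisms of the tangent spaces of `M`. -/
abbrev EndField (M : Type*) [TopologicalSpace M] [ChartedSpace H M] : Type _ :=
  (x : M) → (TangentSpace I x →ₗ[ℝ] TangentSpace I x)

/-- `X` is a smooth section of the tangent bundle. -/
def SmoothField [IsManifold I 1 M] (X : VField I M) : Prop :=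
  ContMDiff I I.tangent ∞ (fun x => (⟨x, X x⟩ : TangentBundle I M))

/-- `g` is a pseudo-Riemannian metric: symmetric, nondegenerate and smooth. -/
structure IsPseudoRiemannianMetric [IsManifold I 1 M] (g : FormField I M) : Prop where
  symm : ∀ (x : M) (u v : TangentSpace I x), g x u v = g x v u
  nondegenerate : ∀ x : M, (g x).Nondegenerate
  smooth : ∀ X Y : VField I M, SmoothField I X → SmoothField I Y →
    ContMDiff I 𝓘(ℝ, ℝ) ∞ (fun x => g x (X x) (Y x))

/-- `g` has neutral signature `(ℓ, ℓ)` at every point. -/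
def IsNeutral (g : FormField I M) : Prop :=
  ∀ x : M, ∃ P Q : Submodule ℝ (TangentSpace I x), IsCompl P Q ∧
    Module.finrank ℝ P = Module.finrank ℝ Q ∧
    (∀ u ∈ P, u ≠ 0 → 0 < g x u u) ∧ (∀ u ∈ Q, u ≠ 0 → g x u u < 0)

/-- The endomorphism field `J` is smooth. -/
def SmoothEnd [IsManifold I 1 M] (J : EndField I M) : Prop :=
  ∀ X : VField I M, SmoothField I X → SmoothField I (fun x => J x (X x))

/-- The pair `(X, Y)` stands for the complex vector field `X + √-1 Y`; it is a smooth section of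
`T^{1,0}` when `J (X + √-1 Y) = √-1 (X + √-1 Y)`, that is `J X = -Y` and `J Y = X`. -/
def IsSectionOneZero [IsManifold I 1 M] (J : EndField I M) (X Y : VField I M) : Prop :=
  SmoothField I X ∧ SmoothField I Y ∧ (∀ x, J x (X x) = -(Y x)) ∧ (∀ x, J x (Y x) = X x)

/-- `T^{1,0}` is closed under the complexified bracket
`[X + √-1 Y, X' + √-1 Y'] = ([X, X'] - [Y, Y']) + √-1 ([X, Y'] + [Y, X'])`. -/
def IsIntegrable [IsManifold I 1 M] (J : EndField I M) : Prop :=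
  ∀ X Y X' Y' : VField I M, IsSectionOneZero I J X Y → IsSectionOneZero I J X' Y' →
    IsSectionOneZero I J
      (fun x => VectorField.mlieBracket I X X' x - VectorField.mlieBracket I Y Y' x)
      (fun x => VectorField.mlieBracket I X Y' x + VectorField.mlieBracket I Y X' x)

/-- `(M, g, J)` is a (pseudo-)Hermitian manifold: `J` is an integrable almost complex structure
and `g (J u) (J v) = g u v`. -/
structure IsHermitian [IsManifold I 1 M] (g : FormField I M) (J : EndField I M) : Prop where
  metric : IsPseudoRiemannianMetric I g
  smooth : SmoothEnd I J
  sq : ∀ x u, J x (J x u) = -u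
  compat : ∀ x u v, g x (J x u) (J x v) = g x u v
  integrable : IsIntegrable I J

/-- `(M, g, J)` is a para-Hermitian manifold: `g` is neutral, `J² = id` and
`g (J u) (J v) = - g u v`. -/
structure IsParaHermitian [IsManifold I 1 M] (g : FormField I M) (J : EndField I M) : Prop where
  metric : IsPseudoRiemannianMetric I g
  neutral : IsNeutral I g
  smooth : SmoothEnd I J
  sq : ∀ x u, J x (J x u) = u
  compat : ∀ x u v, g x (J x u) (J x v) = -(g x u v)

/-- `(M, g, J₁, J₂, J₃)` is a para-quaternion manifold: `J₁` is Hermitian, `J₂` and `J₃` are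
para-Hermitian, and the products of different `Jᵢ` are those of the para-quaternions. -/
structure IsParaQuaternion [IsManifold I 1 M] (g : FormField I M) (J₁ J₂ J₃ : EndField I M) :
    Prop where
  herm : IsHermitian I g J₁
  para₂ : IsParaHermitian I g J₂
  para₃ : IsParaHermitian I g J₃
  mul₁₂ : ∀ x u, J₁ x (J₂ x u) = J₃ x u
  mul₂₁ : ∀ x u, J₂ x (J₁ x u) = -(J₃ x u)
  mul₂₃ : ∀ x u, J₂ x (J₃ x u) = -(J₁ x u)
  mul₃₂ : ∀ x u, J₃ x (J₂ x u) = J₁ x u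
  mul₃₁ : ∀ x u, J₃ x (J₁ x u) = J₂ x u
  mul₁₃ : ∀ x u, J₁ x (J₃ x u) = -(J₂ x u)

/-- The vertical space `ker π_*` at `x`. -/
def vertical (π : M → N) (x : M) : Submodule ℝ (TangentSpace I x) :=
  LinearMap.ker (mfderiv I I' π x : TangentSpace I x →ₗ[ℝ] TangentSpace I' (π x))

/-- The horizontal space, the `g`-orthogonal complement of the vertical space at `x`. -/
def horizontal (g : FormField I M) (π : M → N) (x : M) : Submodule ℝ (TangentSpace I x) :=
  (g x).orthogonal (vertical I I' π x)

/-- `π : (M, g) → (N, h)` is a pseudo-Riemannian submersion. -/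
structure IsPseudoRiemannianSubmersion [IsManifold I 1 M] [IsManifold I' 1 N]
    (g : FormField I M) (h : FormField I' N) (π : M → N) : Prop where
  metric_total : IsPseudoRiemannianMetric I g
  metric_base : IsPseudoRiemannianMetric I' h
  smooth : ContMDiff I I' ∞ π
  submersion : ∀ x, Function.Surjective (mfderiv I I' π x)
  vertical_nondegenerate : ∀ x, ((g x).restrict (vertical I I' π x)).Nondegenerate
  isometry : ∀ x, ∀ u ∈ horizontal I I' g π x, ∀ v ∈ horizontal I I' g π x,
    h (π x) (mfderiv I I' π x u) (mfderiv I I' π x v) = g x u v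
  bijOn_horizontal : ∀ x,
    Set.BijOn (mfderiv I I' π x) (horizontal I I' g π x : Set (TangentSpace I x)) Set.univ

/-- `J` maps the vertical distribution into the horizontal distribution. -/
def MapsVerticalToHorizontal (g : FormField I M) (J : EndField I M) (π : M → N) : Prop :=
  ∀ x, ∀ u ∈ vertical I I' π x, J x u ∈ horizontal I I' g π x

/-- `π : (M, g, J) → (N, h)` is an anti-invariant Hermitian Riemannian submersion. -/
def IsAntiInvariantHermitian [IsManifold I 1 M] [IsManifold I' 1 N]
    (g : FormField I M) (J : EndField I M) (h : FormField I' N) (π : M → N) : Prop :=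
  IsHermitian I g J ∧ IsPseudoRiemannianSubmersion I I' g h π ∧
    MapsVerticalToHorizontal I I' g J π

/-- `π : (M, g, J) → (N, h)` is an anti-invariant para-Hermitian Riemannian submersion. -/
def IsAntiInvariantParaHermitian [IsManifold I 1 M] [IsManifold I' 1 N]
    (g : FormField I M) (J : EndField I M) (h : FormField I' N) (π : M → N) : Prop :=
  IsParaHermitian I g J ∧ IsPseudoRiemannianSubmersion I I' g h π ∧
    MapsVerticalToHorizontal I I' g J π

/-- `π : (M, g, J₁, J₂, J₃) → (N, h)` is an anti-invariant para-quaternion Riemannian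
submersion. -/
def IsAntiInvariantParaQuaternion [IsManifold I 1 M] [IsManifold I' 1 N]
    (g : FormField I M) (J₁ J₂ J₃ : EndField I M) (h : FormField I' N) (π : M → N) : Prop :=
  IsParaQuaternion I g J₁ J₂ J₃ ∧ IsPseudoRiemannianSubmersion I I' g h π ∧
    MapsVerticalToHorizontal I I' g J₁ π ∧ MapsVerticalToHorizontal I I' g J₂ π ∧
    MapsVerticalToHorizontal I I' g J₃ π

/-- The pull-back of a field of bilinear forms by a map. -/
def pullbackForm (h : FormField I' N) (F : M → N) : FormField I M := fun x =>
  (h (F x)).compl₁₂ (mfderiv I I' F x : TangentSpace I x →ₗ[ℝ] TangentSpace I' (F x))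
    (mfderiv I I' F x : TangentSpace I x →ₗ[ℝ] TangentSpace I' (F x))

/-- The metric `B y` on the open subset `U` of the vector space `E` has constant sectional
curvature `κ`. Here `Γ` is its Levi-Civita connection, determined by the Koszul formula, and
`Γ y u v = ∇_u v` for constant fields `u`, `v`; the last condition is
`⟨R(u, v) v, u⟩ = κ (⟨u, u⟩ ⟨v, v⟩ - ⟨u, v⟩²)`. -/
def HasConstantCurvatureOn (U : Set E) (B : E → LinearMap.BilinForm ℝ E) (κ : ℝ) : Prop :=
  ∃ Γ : E → E →L[ℝ] E →L[ℝ] E, DifferentiableOn ℝ Γ U ∧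
    (∀ y ∈ U, ∀ u v w : E,
      2 * B y (Γ y u v) w =
        fderiv ℝ (fun z => B z v w) y u + fderiv ℝ (fun z => B z u w) y v
          - fderiv ℝ (fun z => B z u v) y w) ∧
    (∀ y ∈ U, ∀ u v : E,
      B y (fderiv ℝ (fun z => Γ z v v) y u - fderiv ℝ (fun z => Γ z u v) y v
          + Γ y u (Γ y v v) - Γ y v (Γ y u v)) u
        = κ * (B y u u * B y v v - B y u v ^ 2))

/-- The metric `g` on `M` has constant sectional curvature `κ`: every point lies in the image of
a local parametrization `ψ : U → M`, `U` open in the model vector space, in whose coordinates the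
curvature is `κ`. -/
def HasConstantSectionalCurvature (g : FormField I M) (κ : ℝ) : Prop :=
  ∀ x : M, ∃ (U : Set E) (ψ : E → M), IsOpen U ∧ x ∈ ψ '' U ∧ ContMDiffOn 𝓘(ℝ, E) I ∞ ψ U ∧
    (∀ y ∈ U, Function.Bijective (mfderiv 𝓘(ℝ, E) I ψ y)) ∧
    HasConstantCurvatureOn U (fun y => pullbackForm 𝓘(ℝ, E) I g ψ y) κ

/-- The product metric `-dt² + h` on `ℝ × N`. -/
def lineProd (h : FormField I' N) : FormField (𝓘(ℝ, ℝ).prod I') (ℝ × N) := fun p =>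
  let p₁ : TangentSpace (𝓘(ℝ, ℝ).prod I') p →ₗ[ℝ] ℝ := LinearMap.fst ℝ ℝ E'
  let p₂ : TangentSpace (𝓘(ℝ, ℝ).prod I') p →ₗ[ℝ] TangentSpace I' p.2 := LinearMap.snd ℝ ℝ E'
  (h p.2).compl₁₂ p₂ p₂ - (LinearMap.mul ℝ ℝ).compl₁₂ p₁ p₁

end General

section LieGroups

variable {E : Type*} [NormedAddCommGroup E] [NormedSpace ℝ E]
  {H : Type*} [TopologicalSpace H] (I : ModelWithCorners ℝ E H)
  {G : Type*} [TopologicalSpace G] [ChartedSpace H G] [Group G]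

/-- The left-invariant vector field with value `X` at the identity. -/
def leftField (X : TangentSpace I (1 : G)) : VField I G := fun x =>
  (mfderiv I I (fun y => x * y) (1 : G) : E →L[ℝ] E) X

/-- The derivative at `x` of the left translation by `x⁻¹`, as a map `T_x G → T_1 G`. -/
def toIdentity (x : G) : TangentSpace I x →ₗ[ℝ] TangentSpace I (1 : G) :=
  let L : E →L[ℝ] E := mfderiv I I (fun y => x⁻¹ * y) x
  L.toLinearMap

/-- The derivative at `1` of the left translation by `x`, as a map `T_1 G → T_x G`. -/
def fromIdentity (x : G) : TangentSpace I (1 : G) →ₗ[ℝ] TangentSpace I x :=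
  let L : E →L[ℝ] E := mfderiv I I (fun y => x * y) (1 : G)
  L.toLinearMap

/-- The left-invariant field of bilinear forms with value `B` at the identity. -/
def leftForm (B : LinearMap.BilinForm ℝ (TangentSpace I (1 : G))) : FormField I G := fun x =>
  B.compl₁₂ (toIdentity I x) (toIdentity I x)

/-- The left-invariant endomorphism field with value `A` at the identity. -/
def leftEnd (A : TangentSpace I (1 : G) →ₗ[ℝ] TangentSpace I (1 : G)) : EndField I G := fun x =>
  fromIdentity I x ∘ₗ A ∘ₗ toIdentity I x

/-- Left and right translations are isometries of `g`. -/
def IsBiInvariant (g : FormField I G) : Prop :=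
  (∀ a x : G, ∀ u v : TangentSpace I x,
    g (a * x) (mfderiv I I (fun y => a * y) x u) (mfderiv I I (fun y => a * y) x v) = g x u v) ∧
  (∀ a x : G, ∀ u v : TangentSpace I x,
    g (x * a) (mfderiv I I (fun y => y * a) x u) (mfderiv I I (fun y => y * a) x v) = g x u v)

/-- The Lie algebra of a closed subgroup `K` of `G`, as a subset of `T_1 G`: the initial
velocities of the one-parameter subgroups of `G` that stay in `K`. -/
def lieAlgebraOf (K : Subgroup G) : Set (TangentSpace I (1 : G)) :=
  {X | ∃ γ : ℝ → G, ContMDiff 𝓘(ℝ, ℝ) I ∞ γ ∧ (∀ s t, γ (s + t) = γ s * γ t) ∧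
    (∀ t, γ t ∈ K) ∧ (mfderiv 𝓘(ℝ, ℝ) I γ 0 : ℝ →L[ℝ] E) 1 = X}

/-- `K` is a closed and connected subgroup of `G` with Lie algebra `V`. -/
def IsClosedConnectedWithLieAlgebra (K : Subgroup G) (V : Submodule ℝ (TangentSpace I (1 : G))) :
    Prop :=
  IsClosed (K : Set G) ∧ IsConnected (K : Set G) ∧ lieAlgebraOf I K = (V : Set (TangentSpace I (1 : G)))

end LieGroups

/-! ### The Lie group `SL(2, ℝ)` -/

/-- The group `SL(2, ℝ)`. -/
abbrev SL2 : Type := Matrix.SpecialLinearGroup (Fin 2) ℝ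

/-- The global coordinates `(a + √-1 c, a b + c d)` of the matrix with rows `(a, b)`, `(c, d)`;
the image is `(ℂ \ {0}) × ℝ`. -/
def slCoord (A : SL2) : ℂ × ℝ :=
  (⟨A 0 0, A 1 0⟩, A 0 0 * A 0 1 + A 1 0 * A 1 1)

/-- The inverse of `slCoord`: the second column is `(-c, a) / (a² + c²) + s (a, c) / (a² + c²)`. -/
def slMatrix (p : ℂ × ℝ) : Matrix (Fin 2) (Fin 2) ℝ :=
  !![p.1.re, (p.2 * p.1.re - p.1.im) / (p.1.re ^ 2 + p.1.im ^ 2);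
     p.1.im, (p.2 * p.1.im + p.1.re) / (p.1.re ^ 2 + p.1.im ^ 2)]

theorem sl_det (A : SL2) : A 0 0 * A 1 1 - A 0 1 * A 1 0 = 1 := by
  rw [← Matrix.det_fin_two, A.det_coe]

theorem sl_normSq_ne (A : SL2) : A 0 0 ^ 2 + A 1 0 ^ 2 ≠ 0 := by
  intro h
  have h0 : A 0 0 = 0 := by nlinarith [sq_nonneg (A 0 0), sq_nonneg (A 1 0)]
  have h1 : A 1 0 = 0 := by nlinarith [sq_nonneg (A 0 0), sq_nonneg (A 1 0)]
  have := sl_det A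
  simp [h0, h1] at this

theorem slMatrix_slCoord (A : SL2) : slMatrix (slCoord A) = A := by
  have h := sl_det A
  have hn := sl_normSq_ne A
  ext i j
  fin_cases i <;> fin_cases j
  · simp [slMatrix, slCoord]
  · simp only [slMatrix, slCoord, Fin.zero_eta, Fin.mk_one, Matrix.of_apply, Matrix.cons_val]
    rw [div_eq_iff hn]
    linear_combination (A 1 0) * h
  · simp [slMatrix, slCoord]
  · simp only [slMatrix, slCoord, Fin.mk_one, Matrix.of_apply, Matrix.cons_val]
    rw [div_eq_iff hn]
    linear_combination (-A 0 0) * h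

theorem complex_normSq_ne {z : ℂ} (hz : z ≠ 0) : z.re ^ 2 + z.im ^ 2 ≠ 0 := by
  intro h
  apply hz
  apply Complex.ext
  · simp only [Complex.zero_re]; nlinarith [sq_nonneg z.re, sq_nonneg z.im]
  · simp only [Complex.zero_im]; nlinarith [sq_nonneg z.re, sq_nonneg z.im]

theorem slMatrix_det (p : ℂ × ℝ) (hp : p.1 ≠ 0) : (slMatrix p).det = 1 := by
  have hn := complex_normSq_ne hp
  simp only [slMatrix, Matrix.det_fin_two_of]
  field_simp
  ring

theorem slCoord_slMatrix (p : ℂ × ℝ) (hp : p.1 ≠ 0) :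
    slCoord ⟨slMatrix p, slMatrix_det p hp⟩ = p := by
  have hn := complex_normSq_ne hp
  apply Prod.ext
  · simp [slCoord, slMatrix]
  · simp only [slCoord, slMatrix, Matrix.of_apply, Matrix.cons_val]
    field_simp
    ring

theorem slCoord_continuous : Continuous slCoord := by
  have hc : ∀ i j : Fin 2, Continuous fun A : SL2 => A i j := fun i j =>
    (continuous_apply j).comp ((continuous_apply i).comp continuous_subtype_val)
  have h1 : Continuous fun A : SL2 => (⟨A 0 0, A 1 0⟩ : ℂ) := by
    have : (fun A : SL2 => (⟨A 0 0, A 1 0⟩ : ℂ)) =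
        fun A : SL2 => ((A 0 0 : ℝ) : ℂ) + ((A 1 0 : ℝ) : ℂ) * Complex.I := by
      funext A
      apply Complex.ext <;> simp
    rw [this]
    exact (Complex.continuous_ofReal.comp (hc 0 0)).add
      ((Complex.continuous_ofReal.comp (hc 1 0)).mul continuous_const)
  exact h1.prodMk (((hc 0 0).mul (hc 0 1)).add ((hc 1 0).mul (hc 1 1)))

/-- `slCoord` as a homeomorphism from `SL(2, ℝ)` onto the open set `{p | p.1 ≠ 0}`. -/
def slHomeo : SL2 ≃ₜ {p : ℂ × ℝ // p.1 ≠ 0} where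
  toFun A := ⟨slCoord A, fun h => sl_normSq_ne A (by
    have h0 : A 0 0 = 0 := congrArg Complex.re h
    have h1 : A 1 0 = 0 := congrArg Complex.im h
    simp [h0, h1])⟩
  invFun p := ⟨slMatrix p.1, slMatrix_det p.1 p.2⟩
  left_inv A := Subtype.ext (slMatrix_slCoord A)
  right_inv p := Subtype.ext (slCoord_slMatrix p.1 p.2)
  continuous_toFun := slCoord_continuous.subtype_mk _
  continuous_invFun := by
    have hre : Continuous fun p : {p : ℂ × ℝ // p.1 ≠ 0} => p.1.1.re :=
      Complex.continuous_re.comp (continuous_fst.comp continuous_subtype_val)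
    have him : Continuous fun p : {p : ℂ × ℝ // p.1 ≠ 0} => p.1.1.im :=
      Complex.continuous_im.comp (continuous_fst.comp continuous_subtype_val)
    have hs : Continuous fun p : {p : ℂ × ℝ // p.1 ≠ 0} => p.1.2 :=
      continuous_snd.comp continuous_subtype_val
    have hn : Continuous fun p : {p : ℂ × ℝ // p.1 ≠ 0} => p.1.1.re ^ 2 + p.1.1.im ^ 2 :=
      (hre.pow 2).add (him.pow 2)
    refine Continuous.subtype_mk (continuous_matrix fun i j => ?_) _
    fin_cases i <;> fin_cases j
    · simpa [slMatrix] using hre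
    · exact ((hs.mul hre).sub him).div hn fun p => complex_normSq_ne p.2
    · simpa [slMatrix] using him
    · exact ((hs.mul him).add hre).div hn fun p => complex_normSq_ne p.2

theorem slCoord_isOpenEmbedding : Topology.IsOpenEmbedding slCoord := by
  have ho : IsOpen {p : ℂ × ℝ | p.1 ≠ 0} := isOpen_ne.preimage continuous_fst
  exact ho.isOpenEmbedding_subtypeVal.comp slHomeo.isOpenEmbedding

instance : ChartedSpace (ℂ × ℝ) SL2 := slCoord_isOpenEmbedding.singletonChartedSpace

instance (n : ℕ∞ω) : IsManifold 𝓘(ℝ, ℂ × ℝ) n SL2 :=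
  slCoord_isOpenEmbedding.isManifold_singleton

/-- The model with corners of `SL(2, ℝ)`. -/
abbrev ISL : ModelWithCorners ℝ (ℂ × ℝ) (ℂ × ℝ) := 𝓘(ℝ, ℂ × ℝ)

/-! ### The Lie group `G = ℝ × SL(2, ℝ)` -/

instance : ChartedSpace ℝ (Multiplicative ℝ) := inferInstanceAs (ChartedSpace ℝ ℝ)

instance (n : ℕ∞ω) : IsManifold 𝓘(ℝ, ℝ) n (Multiplicative ℝ) :=
  inferInstanceAs (IsManifold 𝓘(ℝ, ℝ) n ℝ)

/-- The Lie group `ℝ × SL(2, ℝ)`, with the additive group `ℝ` as first factor. -/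
abbrev G : Type := Multiplicative ℝ × SL2

/-- The model with corners of `ℝ × SL(2, ℝ)`. -/
abbrev IG : ModelWithCorners ℝ (ℝ × (ℂ × ℝ)) (ModelProd ℝ (ℂ × ℝ)) := 𝓘(ℝ, ℝ).prod ISL

/-! ### The frame, the metric and the structures on `G` and `SL(2, ℝ)` -/

/-- The coordinates of a vector of `T_1 SL(2, ℝ)` with respect to `f₁, f₂, f₃`, the tangent space
being identified with `ℂ × ℝ` by the coordinates `slCoord`. -/
def slEquiv : (ℂ × ℝ) ≃ₗ[ℝ] (Fin 3 → ℝ) where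
  toFun p := ![p.2 / 2 - p.1.im, p.2 / 2, p.1.re]
  invFun c := (⟨c 2, c 1 - c 0⟩, 2 * c 1)
  map_add' p q := by
    ext i; fin_cases i <;> simp <;> ring
  map_smul' r p := by
    ext i; fin_cases i <;> simp <;> ring
  left_inv p := by
    apply Prod.ext
    · apply Complex.ext <;> simp
    · simp; ring
  right_inv c := by
    ext i; fin_cases i <;> simp

/-- The basis `f₁, f₂, f₃` of `T_1 SL(2, ℝ)`, indexed by `0, 1, 2`. In the coordinates `slCoord`
these are `(-√-1, 0)`, `(√-1, 2)`, `(1, 0)`. -/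
def slFrame : Module.Basis (Fin 3) ℝ (TangentSpace ISL (1 : SL2)) :=
  Module.Basis.ofEquivFun slEquiv

/-- The bi-invariant Lorentzian metric of `SL(2, ℝ)` (an eighth of the Killing form): the
left-invariant one in which `f₁, f₂, f₃` are orthogonal with squares `-1, 1, 1`. -/
def gSL : FormField ISL SL2 :=
  leftForm ISL (Matrix.toBilin slFrame (Matrix.diagonal ![-1, 1, 1]))

/-- The coordinates of a vector of `T_1 G` with respect to `f₀, f₁, f₂, f₃`. -/
def gEquiv : (ℝ × (ℂ × ℝ)) ≃ₗ[ℝ] (Fin 4 → ℝ) where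
  toFun p := ![p.1, p.2.2 / 2 - p.2.1.im, p.2.2 / 2, p.2.1.re]
  invFun c := (c 0, (⟨c 3, c 2 - c 1⟩, 2 * c 2))
  map_add' p q := by
    ext i; fin_cases i <;> simp <;> ring
  map_smul' r p := by
    ext i; fin_cases i <;> simp <;> ring
  left_inv p := by
    apply Prod.ext
    · simp
    · apply Prod.ext
      · apply Complex.ext <;> simp
      · simp; ring
  right_inv c := by
    ext i; fin_cases i <;> simp

/-- The basis `f₀, f₁, f₂, f₃` of `T_1 G`: the vectors `(1, 0)` and `(0, fᵢ)`. -/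
def f : Module.Basis (Fin 4) ℝ (TangentSpace IG (1 : G)) :=
  Module.Basis.ofEquivFun gEquiv

/-- The squares `⟨fᵢ, fᵢ⟩`. -/
def sign : Fin 4 → ℝ := ![-1, -1, 1, 1]

/-- The neutral signature left-invariant metric on `G` in which the `fᵢ` are orthogonal with
squares `-1, -1, 1, 1`. -/
def gG : FormField IG G := leftForm IG (Matrix.toBilin f (Matrix.diagonal sign))

/-- The left-invariant almost complex structure with
`J f₀ = f₁`, `J f₁ = -f₀`, `J f₂ = f₃`, `J f₃ = -f₂`. -/
def J : EndField IG G := leftEnd IG (f.constr ℝ ![f 1, -f 0, f 3, -f 2])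

/-- The left-invariant para-complex structure with
`J' f₀ = f₂`, `J' f₁ = -f₃`, `J' f₂ = f₀`, `J' f₃ = -f₁`. -/
def J' : EndField IG G := leftEnd IG (f.constr ℝ ![f 2, -f 3, f 0, -f 1])

/-- The product `J J'`. -/
def J'' : EndField IG G := fun x => J x ∘ₗ J' x

/-- The one-parameter subgroup generated by `f₁` in `SL(2, ℝ)`. -/
def σ₁ (t : ℝ) : SL2 := ⟨!![Real.cos t, Real.sin t; -Real.sin t, Real.cos t], by
  rw [Matrix.det_fin_two_of]; nlinarith [Real.sin_sq_add_cos_sq t]⟩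

/-- The one-parameter subgroup generated by `f₂` in `SL(2, ℝ)`. -/
def σ₂ (t : ℝ) : SL2 := ⟨!![Real.cosh t, Real.sinh t; Real.sinh t, Real.cosh t], by
  rw [Matrix.det_fin_two_of]; nlinarith [Real.cosh_sq t]⟩

/-- The one-parameter subgroup generated by `f₃` in `SL(2, ℝ)`. -/
def σ₃ (t : ℝ) : SL2 := ⟨!![Real.exp t, 0; 0, Real.exp (-t)], by
  rw [Matrix.det_fin_two_of, ← Real.exp_add]; simp⟩

/-- The one-parameter subgroups of `G` generated by `f₀, f₁, f₂, f₃`. -/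
def σ : Fin 4 → ℝ → G :=
  ![fun t => (Multiplicative.ofAdd t, 1), fun t => (1, σ₁ t), fun t => (1, σ₂ t),
    fun t => (1, σ₃ t)]

/-! ### The hyperbolic planes of curvature `-4` -/

instance (n : ℕ∞ω) : IsManifold 𝓘(ℝ, ℂ) n ℍ :=
  UpperHalfPlane.isOpenEmbedding_coe.isManifold_singleton

/-- `ℍ²(0,2)`: the upper half-plane with the Riemannian metric `(dx² + dy²) / (4 y²)`. -/
def hyp02 : FormField 𝓘(ℝ, ℂ) ℍ := fun z =>
  let B : LinearMap.BilinForm ℝ ℂ := (1 / (4 * z.im ^ 2)) • innerₗ ℂ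
  B

/-- The flat metric `-dx² - dy² + dz²` on `ℂ × ℝ = ℝ³`. -/
def flat21 : FormField 𝓘(ℝ, ℂ × ℝ) (ℂ × ℝ) := fun _ =>
  let B : LinearMap.BilinForm ℝ (ℂ × ℝ) :=
    -((innerₗ ℂ).compl₁₂ (LinearMap.fst ℝ ℂ ℝ) (LinearMap.fst ℝ ℂ ℝ)) +
      (LinearMap.mul ℝ ℝ).compl₁₂ (LinearMap.snd ℝ ℂ ℝ) (LinearMap.snd ℝ ℂ ℝ)
  B

/-- The map `(u, s) ↦ (cosh s · u², sinh s) / 2`, a two-fold covering of the pseudo-sphere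
`-x² - y² + z² = -1/4` by the cylinder `S¹ × ℝ`. -/
def cover (p : Circle × ℝ) : ℂ × ℝ :=
  ((Real.cosh p.2 / 2 : ℝ) * (p.1 : ℂ) ^ 2, Real.sinh p.2 / 2)

/-- The model with corners of the cylinder `S¹ × ℝ`. -/
abbrev IC : ModelWithCorners ℝ (EuclideanSpace ℝ (Fin 1) × ℝ)
    (ModelProd (EuclideanSpace ℝ (Fin 1)) ℝ) := (𝓡 1).prod 𝓘(ℝ, ℝ)

/-- `ℍ²(1,1)`: the cylinder `S¹ × ℝ` with the Lorentzian metric induced by the two-fold covering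
`cover` of the pseudo-sphere `-x² - y² + z² = -1/4`. -/
def hyp11 : FormField IC (Circle × ℝ) := pullbackForm IC 𝓘(ℝ, ℂ × ℝ) flat21 cover

/-- `π : G → (N, h)` is at once an anti-invariant Hermitian, an anti-invariant para-Hermitian and
an anti-invariant para-quaternion Riemannian submersion, for `J`, for `J'`, and for `J, J', J J'`. -/
def IsTriplyAntiInvariant {E' : Type*} [NormedAddCommGroup E'] [NormedSpace ℝ E']
    {H' : Type*} [TopologicalSpace H'] (I' : ModelWithCorners ℝ E' H')
    {N : Type*} [TopologicalSpace N] [ChartedSpace H' N] [IsManifold I' 1 N]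
    (h : FormField I' N) (π : G → N) : Prop :=
  IsAntiInvariantHermitian IG I' gG J h π ∧
  IsAntiInvariantParaHermitian IG I' gG J' h π ∧
  IsAntiInvariantParaQuaternion IG I' gG J J' J'' h π

end

end AntiInvariant

/-! A tangent vector of `SL(2, ℝ)` at A is a variation dA of the matrix, and the metric of `SL(2,
ℝ)` is the polarization of -det(dA) (`gSL_apply`); the metric of G adds -dt². The determinant is
multiplicative, so this form is invariant under left and right translations, and at the identity
-det(x₁f₁ + x₂f₂ + x₃f₃) = -x₁² + x₂² + x₃². Hence the left-invariant frame is orthonormal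
(`gForm_frame`). The structures J and J̃ have constant coefficients in this frame, so their
algebraic identities are checked on four coefficients. J is integrable because f₀ is central and ad
f₁ = 2J on the span of f₂, f₃: the bracket [f₀ - i f₁, f₂ - i f₃] = 2(f₂ - i f₃) is again of type
(1,0).

Whether a map p : G → N is an anti-invariant submersion is read off from the frame. If p kills the
frame fields with index in S and sends the others to orthonormal vectors of the same signs
(`IsFrameAdapted`), the former span the vertical spaces, the latter span the horizontal spaces, and
p is isometric on these. Up to sign, J, J̃ and JJ̃ permute the frame by the pairings 01|23, 02|13
and 03|12; such a structure maps vertical to horizontal vectors when S contains no pair of its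
pairing. A singleton never does, and {0, 2} contains no pair of J.

The projections are explicit. For f₀ it is the projection to `SL(2, ℝ)`. For f₁ it is A ↦ A • i, the
stabilizer of i being the rotations. For f₂ it lifts the adjoint orbit map A ↦ ½ A f₂ A⁻¹ onto the
pseudo-sphere: the stabilizer of f₂ is ±exp(ℝf₂), so the quotient by the connected group is the
two-fold covering, the cylinder. The lift needs a square root of a unit complex number, and the
bisector of the images of the eigenvectors (1, 1), (1, -1) of f₂ provides it (`bisector_sq`). Each
projection has a continuous section, which identifies G/H with the base; the sections come from the
Iwasawa decomposition for f₁ and from rotation times diagonal matrix times exp(tf₂) for f₂.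

An arbitrary closed connected H with the given Lie algebra has to be recognized as the expected
group H₀. It contains H₀, since a one-parameter group is determined by its velocity
(`oneParameter_eq_σ`). If H were larger than H₀ near 1, the section would give elements of H
different from 1 and tending to 1. As in Cartan's closed subgroup theorem, a limit of their
normalized directions generates a one-parameter group in H (`exists_mem_lieAlgebraOf_of_tendsto`)
and so lies in the Lie algebra, to which the section is transverse. Thus H₀ is open in the connected
group H, and they agree (`le_of_directions`). -/

namespace AntiInvariant

noncomputable section

/-! ### Derivatives of maps of manifolds as maps of the model spaces -/

section TangentCalculus

variable {E : Type*} [NormedAddCommGroup E] [NormedSpace ℝ E]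
  {H : Type*} [TopologicalSpace H] (I : ModelWithCorners ℝ E H)
  {M : Type*} [TopologicalSpace M] [ChartedSpace H M]
  {E' : Type*} [NormedAddCommGroup E'] [NormedSpace ℝ E']
  {H' : Type*} [TopologicalSpace H'] (I' : ModelWithCorners ℝ E' H')
  {N : Type*} [TopologicalSpace N] [ChartedSpace H' N]
  {E'' : Type*} [NormedAddCommGroup E''] [NormedSpace ℝ E'']
  {H'' : Type*} [TopologicalSpace H''] (I'' : ModelWithCorners ℝ E'' H'')
  {P : Type*} [TopologicalSpace P] [ChartedSpace H'' P]
  {F : Type*} [NormedAddCommGroup F] [NormedSpace ℝ F]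

/-- The derivative of `p` at `x` as a map of the model vector spaces. -/
def dMap (p : M → N) (x : M) : E →L[ℝ] E' := mfderiv I I' p x

/-- The derivative at `x` of a map to a vector space. -/
def dVec (q : M → F) (x : M) : E →L[ℝ] F := dMap I 𝓘(ℝ, F) q x

variable {I I' I''}

/-- The types of `mfderiv` depend on base points, which obstructs rewriting. In `dMap` and `dVec`
all tangent spaces are the model vector space, and the usual rules can be used as equations there.
-/
theorem dMap_comp {q : N → P} {p : M → N} {x : M} (hq : MDifferentiableAt I' I'' q (p x))
    (hp : MDifferentiableAt I I' p x) (u : E) :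
    dMap I I'' (fun y => q (p y)) x u = dMap I' I'' q (p x) (dMap I I' p x u) := by
  have := mfderiv_comp x hq hp
  exact DFunLike.congr_fun this u

theorem dVec_comp {q : N → F} {p : M → N} {x : M} (hq : MDifferentiableAt I' 𝓘(ℝ, F) q (p x))
    (hp : MDifferentiableAt I I' p x) (u : E) :
    dVec I (fun y => q (p y)) x u = dVec I' q (p x) (dMap I I' p x u) :=
  dMap_comp hq hp u

theorem dVec_of_hasMFDerivAt {q : M → F} {x : M} {L : E →L[ℝ] F}
    (h : HasMFDerivAt I 𝓘(ℝ, F) q x L) : dVec I q x = L := h.mfderiv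

theorem hasMFDerivAt_dVec {q : M → F} {x : M} (h : MDifferentiableAt I 𝓘(ℝ, F) q x) :
    HasMFDerivAt I 𝓘(ℝ, F) q x (dVec I q x : E →L[ℝ] F) := h.hasMFDerivAt

theorem dVec_const (c : F) (x : M) (u : E) : dVec I (fun _ : M => c) x u = 0 := by
  have h : dVec I (fun _ : M => c) x = 0 := mfderiv_const
  rw [h]
  rfl

theorem dVec_add {p q : M → F} {x : M} (hp : MDifferentiableAt I 𝓘(ℝ, F) p x)
    (hq : MDifferentiableAt I 𝓘(ℝ, F) q x) (u : E) :
    dVec I (fun y => p y + q y) x u = dVec I p x u + dVec I q x u := by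
  have := (hasMFDerivAt_dVec hp).add (hasMFDerivAt_dVec hq)
  exact DFunLike.congr_fun (dVec_of_hasMFDerivAt this) u

theorem dVec_sub {p q : M → F} {x : M} (hp : MDifferentiableAt I 𝓘(ℝ, F) p x)
    (hq : MDifferentiableAt I 𝓘(ℝ, F) q x) (u : E) :
    dVec I (fun y => p y - q y) x u = dVec I p x u - dVec I q x u := by
  have := (hasMFDerivAt_dVec hp).sub (hasMFDerivAt_dVec hq)
  exact DFunLike.congr_fun (dVec_of_hasMFDerivAt this) u

theorem dVec_neg {p : M → F} {x : M} (u : E) :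
    dVec I (fun y => - p y) x u = - dVec I p x u := by
  have := mfderiv_neg (I := I) (f := p) (x := x)
  exact DFunLike.congr_fun this u

theorem dVec_mul {p q : M → ℝ} {x : M} (hp : MDifferentiableAt I 𝓘(ℝ, ℝ) p x)
    (hq : MDifferentiableAt I 𝓘(ℝ, ℝ) q x) (u : E) :
    dVec I (fun y => p y * q y) x u = p x * dVec I q x u + q x * dVec I p x u := by
  have := (hasMFDerivAt_dVec hp).mul (hasMFDerivAt_dVec hq)
  exact DFunLike.congr_fun (dVec_of_hasMFDerivAt this) u

theorem dVec_eq_fderiv {p : E → F} (x u : E) :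
    dVec 𝓘(ℝ, E) p x u = fderiv ℝ p x u := by
  rw [dVec, dMap, mfderiv_eq_fderiv]

/-- The derivative of a map along the velocity of a curve is the velocity of the image curve. -/
theorem hasDerivAt_comp_curve {q : M → F} {γ : ℝ → M} {t : ℝ}
    (hq : MDifferentiableAt I 𝓘(ℝ, F) q (γ t)) (hγ : MDifferentiableAt 𝓘(ℝ, ℝ) I γ t) :
    HasDerivAt (fun s => q (γ s)) (dVec I q (γ t) (dMap 𝓘(ℝ, ℝ) I γ t 1)) t := by
  have h : MDifferentiableAt 𝓘(ℝ, ℝ) 𝓘(ℝ, F) (fun s => q (γ s)) t := hq.comp t hγ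
  have h1 := h.differentiableAt.hasDerivAt
  have h2 : deriv (fun s => q (γ s)) t = dVec I q (γ t) (dMap 𝓘(ℝ, ℝ) I γ t 1) := by
    rw [← dVec_comp hq hγ, dVec_eq_fderiv]; simp
  rwa [h2] at h1

theorem dMap_prod_snd {q : N → P} {x : M × N} (hq : MDifferentiableAt I' I'' q x.2)
    (u : E × E') :
    dMap (I.prod I') I'' (fun y : M × N => q y.2) x u = dMap I' I'' q x.2 u.2 := by
  have h := dMap_comp (I := I.prod I') (p := (Prod.snd : M × N → N)) hq mdifferentiableAt_snd u
  rw [h]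
  congr 1
  exact DFunLike.congr_fun (mfderiv_snd (I := I) (I' := I') (x := x)) u

theorem dMap_prod_fst {q : M → P} {x : M × N} (hq : MDifferentiableAt I I'' q x.1)
    (u : E × E') :
    dMap (I.prod I') I'' (fun y : M × N => q y.1) x u = dMap I I'' q x.1 u.1 := by
  have h := dMap_comp (I := I.prod I') (p := (Prod.fst : M × N → M)) hq mdifferentiableAt_fst u
  rw [h]
  congr 1
  exact DFunLike.congr_fun (mfderiv_fst (I := I) (I' := I') (x := x)) u

theorem dMap_prodMk {p : M → N} {q : M → P} {x : M} (hp : MDifferentiableAt I I' p x)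
    (hq : MDifferentiableAt I I'' q x) (u : E) :
    dMap I (I'.prod I'') (fun y => (p y, q y)) x u = (dMap I I' p x u, dMap I I'' q x u) :=
  DFunLike.congr_fun (mfderiv_prodMk hp hq) u

end TangentCalculus

/-! ### Manifolds with a single chart -/

section ConstantChart

variable {E : Type*} [NormedAddCommGroup E] [NormedSpace ℝ E]
  {H : Type*} [TopologicalSpace H] {I : ModelWithCorners ℝ E H}
  {M : Type*} [TopologicalSpace M] [ChartedSpace H M] [IsManifold I 1 M]

/-- The fibre coordinate is a change of coordinates between two charts; when these are equal it is
the identity. -/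
theorem trivializationAt_of_const_chart (hc : ∀ x y : M, chartAt H x = chartAt H y) (x₀ x : M)
    (v : TangentSpace I x) :
    (trivializationAt E (TangentSpace I) x₀ ⟨x, v⟩).2 = v := by
  have h1 := tangentCoordChange_self (I := I) (x := x) (z := x) (v := v) (mem_extChartAt_source x)
  rw [tangentCoordChange_def] at h1
  rw [TangentBundle.trivializationAt_apply]
  simp only [hc x₀ x]
  exact h1

/-- On a manifold with a single chart, vector fields are maps to the model vector space. -/
theorem smoothField_iff_of_const_chart (hc : ∀ x y : M, chartAt H x = chartAt H y)
    (X : VField I M) :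
    SmoothField I X ↔ ContMDiff I 𝓘(ℝ, E) ∞ (fun x => (X x : E)) := by
  unfold SmoothField
  refine forall_congr' fun x₀ => ?_
  have := Bundle.contMDiffAt_section (IB := I) (n := ∞) (F := E) (E := (TangentSpace I : M → Type _))
    (s := X) x₀
  refine this.trans ?_
  simp only [trivializationAt_of_const_chart hc]

/-- The derivative of a smooth map to a vector space along a smooth vector field is smooth. -/
theorem SmoothField.contMDiff_dVec {F : Type*} [NormedAddCommGroup F] [NormedSpace ℝ F]
    [IsManifold I ∞ M] {q : M → F} (hq : ContMDiff I 𝓘(ℝ, F) ∞ q) {X : VField I M}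
    (hX : SmoothField I X) :
    ContMDiff I 𝓘(ℝ, F) ∞ (fun x => dVec I q x (X x)) := by
  have h := (hq.contMDiff_tangentMap (m := ∞) le_rfl).comp hX
  exact (contMDiff_snd_tangentBundle_modelSpace F 𝓘(ℝ, F)).comp h

theorem dVec_extChartAt_of_const_chart (hc : ∀ x y : M, chartAt H x = chartAt H y) (x₀ x : M) :
    dVec I (extChartAt I x₀) x = ContinuousLinearMap.id ℝ E := by
  have he : extChartAt I x₀ = extChartAt I x := by simp only [extChartAt, hc x₀ x]
  rw [he]
  have h : MDifferentiableAt I 𝓘(ℝ, E) (extChartAt I x) x :=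
    mdifferentiableAt_extChartAt (mem_chart_source H x)
  have h2 : dVec I (extChartAt I x) x = tangentCoordChange I x x x := by
    rw [tangentCoordChange_def]
    exact h.mfderiv
  rw [h2]
  ext v
  exact tangentCoordChange_self (mem_extChartAt_source x)

theorem mfderivWithin_extChartAt_symm_of_const_chart [I.Boundaryless]
    (hc : ∀ x y : M, chartAt H x = chartAt H y) (x₀ : M) {y : E}
    (hy : y ∈ (extChartAt I x₀).target) :
    (mfderivWithin 𝓘(ℝ, E) I (extChartAt I x₀).symm (Set.range I) y : E →L[ℝ] E) =
      ContinuousLinearMap.id ℝ E := by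
  have h := mfderiv_extChartAt_comp_mfderivWithin_extChartAt_symm (I := I) hy
  have h2 := dVec_extChartAt_of_const_chart (I := I) hc x₀ ((extChartAt I x₀).symm y)
  have h3 : (dVec I (extChartAt I x₀) ((extChartAt I x₀).symm y)).comp
    (mfderivWithin 𝓘(ℝ, E) I (extChartAt I x₀).symm (Set.range I) y : E →L[ℝ] E) =
      ContinuousLinearMap.id ℝ E := h
  -- Stated for arbitrary endomorphisms of `E`, so that the base points of the tangent spaces play
  -- no role.
  have h4 : ∀ A B : E →L[ℝ] E, A = ContinuousLinearMap.id ℝ E →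
      A.comp B = ContinuousLinearMap.id ℝ E → B = ContinuousLinearMap.id ℝ E := by
    intro A B hA hAB
    rwa [hA, ContinuousLinearMap.id_comp] at hAB
  exact h4 _ _ h2 h3

/-- On a manifold with a single chart, the Lie bracket is that of the coordinate expressions. -/
theorem mlieBracket_of_const_chart [I.Boundaryless] (hc : ∀ x y : M, chartAt H x = chartAt H y)
    {V W : VField I M} (hV : SmoothField I V) (hW : SmoothField I W) (x : M) :
    (VectorField.mlieBracket I V W x : E) =
      dVec I (fun y => (W y : E)) x (V x) - dVec I (fun y => (V y : E)) x (W x) := by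
  have hinv : ∀ A : E →L[ℝ] E, A = ContinuousLinearMap.id ℝ E → ∀ v : E, A.inverse v = v := by
    rintro A rfl v
    rw [ContinuousLinearMap.inverse_id]
    rfl
  -- The derivative of the inverse chart is the identity, so pulling a field back to the chart only
  -- composes it with the inverse chart.
  have hp : ∀ {U : VField I M}, ∀ y ∈ (extChartAt I x).target,
      (VectorField.mpullbackWithin 𝓘(ℝ, E) I (extChartAt I x).symm U (Set.range I) y : E) =
        U ((extChartAt I x).symm y) := by
    intro U y hy
    exact hinv _ (mfderivWithin_extChartAt_symm_of_const_chart (I := I) hc x hy) _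
  have hd : ∀ {U : VField I M}, SmoothField I U →
      fderiv ℝ (fun y => (VectorField.mpullbackWithin 𝓘(ℝ, E) I (extChartAt I x).symm U (Set.range I) y : E))
        (extChartAt I x x) = dVec I (fun y => (U y : E)) x := by
    intro U hU
    have h1 := (((smoothField_iff_of_const_chart hc U).1 hU) x).mdifferentiableAt (by simp)
    have h2 : dVec I (fun y => (U y : E)) x =
      fderivWithin ℝ (fun y => U ((extChartAt I x).symm y)) (Set.range I) (extChartAt I x x) := h1.mfderiv
    rw [h2]
    have h3 : fderivWithin ℝ (fun y => (U ((extChartAt I x).symm y) : E)) (Set.range I)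
        (extChartAt I x x) =
        fderiv ℝ (fun y => (U ((extChartAt I x).symm y) : E)) (extChartAt I x x) := by
      have : ∀ (g : E → E) (z : E), fderivWithin ℝ g (Set.range I) z = fderiv ℝ g z := by
        intro g z
        rw [I.range_eq_univ, fderivWithin_univ]
      exact this _ _
    refine Eq.trans ?_ h3.symm
    apply Filter.EventuallyEq.fderiv_eq
    filter_upwards [extChartAt_target_mem_nhds (I := I) x] with y hy
    exact hp (U := U) y hy
  have hb : ∀ (f g : E → E) (s : Set E) (z : E), s = Set.univ →
      VectorField.lieBracketWithin ℝ f g s z = fderiv ℝ g z (f z) - fderiv ℝ f z (g z) := by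
    rintro f g s z rfl
    rw [VectorField.lieBracketWithin_univ]
    rfl
  have hs : (extChartAt I x).symm ⁻¹' Set.univ ∩ Set.range I = Set.univ := by
    rw [I.range_eq_univ]; simp
  rw [← VectorField.mlieBracketWithin_univ, VectorField.mlieBracketWithin_apply]
  refine (hinv _ (dVec_extChartAt_of_const_chart hc x x) _).trans ((hb _ _ _ _ hs).trans ?_)
  have e1 := hp (U := V) _ (mem_extChartAt_target x)
  have e2 := hp (U := W) _ (mem_extChartAt_target x)
  rw [extChartAt_to_inv] at e1 e2
  exact congrArg₂ (fun a b : E => a - b) (congrArg₂ (fun (A : E →L[ℝ] E) (v : E) => A v) (hd hW) e1)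
    (congrArg₂ (fun (A : E →L[ℝ] E) (v : E) => A v) (hd hV) e2)

end ConstantChart

/-! ### Smooth structure and tangent vectors of `SL(2, ℝ)` and G -/

section SpecialLinear

variable {E : Type*} [NormedAddCommGroup E] [NormedSpace ℝ E]
  {H : Type*} [TopologicalSpace H] {I : ModelWithCorners ℝ E H}
  {M : Type*} [TopologicalSpace M] [ChartedSpace H M]

theorem mdifferentiableAt_mul {p q : M → ℝ} {x : M} (hp : MDifferentiableAt I 𝓘(ℝ, ℝ) p x)
    (hq : MDifferentiableAt I 𝓘(ℝ, ℝ) q x) :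
    MDifferentiableAt I 𝓘(ℝ, ℝ) (fun y => p y * q y) x := hp.mul hq

theorem sl2_chartAt_eq (x y : SL2) : chartAt (ℂ × ℝ) x = chartAt (ℂ × ℝ) y := rfl

theorem contMDiff_slCoord : ContMDiff ISL ISL ∞ slCoord :=
  contMDiff_isOpenEmbedding slCoord_isOpenEmbedding

theorem dVec_slCoord (x : SL2) (u : ℂ × ℝ) : dVec ISL slCoord x u = u := by
  have h := dVec_extChartAt_of_const_chart (I := ISL) sl2_chartAt_eq x x
  exact DFunLike.congr_fun h u

theorem contMDiff_re {φ : M → ℂ} (h : ContMDiff I 𝓘(ℝ, ℂ) ∞ φ) :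
    ContMDiff I 𝓘(ℝ, ℝ) ∞ (fun x => (φ x).re) :=
  (Complex.reCLM.contDiff (n := ∞)).contMDiff.comp h

theorem contMDiff_im {φ : M → ℂ} (h : ContMDiff I 𝓘(ℝ, ℂ) ∞ φ) :
    ContMDiff I 𝓘(ℝ, ℝ) ∞ (fun x => (φ x).im) :=
  (Complex.imCLM.contDiff (n := ∞)).contMDiff.comp h

theorem contMDiff_complexMk {a b : M → ℝ} (ha : ContMDiff I 𝓘(ℝ, ℝ) ∞ a)
    (hb : ContMDiff I 𝓘(ℝ, ℝ) ∞ b) : ContMDiff I 𝓘(ℝ, ℂ) ∞ (fun x => (⟨a x, b x⟩ : ℂ)) := by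
  have h : (fun x => (⟨a x, b x⟩ : ℂ)) = fun x => Complex.equivRealProdCLM.symm (a x, b x) := rfl
  rw [h]
  exact (Complex.equivRealProdCLM.symm.contDiff (n := ∞)).contMDiff.comp (ha.prodMk_space hb)

/-- By `slMatrix_slCoord` the entries are rational functions of the coordinates, with denominator a²
+ c², which has no zero. -/
theorem contMDiff_entry (i j : Fin 2) : ContMDiff ISL 𝓘(ℝ, ℝ) ∞ (fun A : SL2 => A i j) := by
  have h1 : ContMDiff ISL 𝓘(ℝ, ℂ) ∞ (fun A : SL2 => (slCoord A).1) :=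
    contDiff_fst.contMDiff.comp contMDiff_slCoord
  have h2 : ContMDiff ISL 𝓘(ℝ, ℝ) ∞ (fun A : SL2 => (slCoord A).2) :=
    contDiff_snd.contMDiff.comp contMDiff_slCoord
  have ha := contMDiff_re h1
  have hc := contMDiff_im h1
  have hn : ∀ A : SL2, (slCoord A).1.re ^ 2 + (slCoord A).1.im ^ 2 ≠ 0 := sl_normSq_ne
  have key : (fun A : SL2 => A i j) = fun A => slMatrix (slCoord A) i j := by
    funext A; rw [slMatrix_slCoord]
  rw [key]
  fin_cases i <;> fin_cases j
  · exact ha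
  · exact ((h2.mul ha).sub hc).div₀ ((ha.pow 2).add (hc.pow 2)) hn
  · exact hc
  · exact ((h2.mul hc).add ha).div₀ ((ha.pow 2).add (hc.pow 2)) hn

/-- Conversely the chart is polynomial in the entries. From here on, smoothness into `SL(2, ℝ)` is
tested on matrix entries. -/
theorem contMDiff_sl2_of_entries {φ : M → SL2}
    (h : ∀ i j, ContMDiff I 𝓘(ℝ, ℝ) ∞ (fun x => φ x i j)) : ContMDiff I ISL ∞ φ := by
  refine ContMDiff.of_comp_isOpenEmbedding slCoord_isOpenEmbedding ?_
  exact (contMDiff_complexMk (h 0 0) (h 1 0)).prodMk_space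
    (((h 0 0).mul (h 0 1)).add ((h 1 0).mul (h 1 1)))

theorem contMDiff_entry_comp {φ : M → SL2} (h : ContMDiff I ISL ∞ φ) (i j : Fin 2) :
    ContMDiff I 𝓘(ℝ, ℝ) ∞ (fun x => φ x i j) :=
  (contMDiff_entry i j).comp h

theorem sl2_mul_apply (A B : SL2) (i j : Fin 2) :
    (A * B) i j = A i 0 * B 0 j + A i 1 * B 1 j := by
  simp [Matrix.SpecialLinearGroup.coe_mul, Matrix.mul_apply, Fin.sum_univ_two]

instance : LieGroup ISL ∞ SL2 where
  contMDiff_mul := by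
    refine contMDiff_sl2_of_entries fun i j => ?_
    simp only [sl2_mul_apply]
    have h1 := fun i j => contMDiff_entry_comp (I := ISL.prod ISL) (contMDiff_fst (M := SL2) (N := SL2)) i j
    have h2 := fun i j => contMDiff_entry_comp (I := ISL.prod ISL) (contMDiff_snd (M := SL2) (N := SL2)) i j
    exact ((h1 i 0).mul (h2 0 j)).add ((h1 i 1).mul (h2 1 j))
  contMDiff_inv := by
    refine contMDiff_sl2_of_entries fun i j => ?_
    simp only [Matrix.SpecialLinearGroup.coe_inv, Matrix.adjugate_fin_two]
    fin_cases i <;> fin_cases j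
    · exact contMDiff_entry 1 1
    · exact (contMDiff_entry 0 1).neg
    · exact (contMDiff_entry 1 0).neg
    · exact contMDiff_entry 0 0

instance : LieGroup 𝓘(ℝ, ℝ) ∞ (Multiplicative ℝ) where
  contMDiff_mul := by
    have h : ContMDiff (𝓘(ℝ, ℝ).prod 𝓘(ℝ, ℝ)) 𝓘(ℝ, ℝ) ∞ (fun p : ℝ × ℝ => p.1 + p.2) :=
      contMDiff_fst.add contMDiff_snd
    exact h
  contMDiff_inv := by
    have h : ContMDiff 𝓘(ℝ, ℝ) 𝓘(ℝ, ℝ) ∞ (fun p : ℝ => - p) := contMDiff_neg 𝓘(ℝ, ℝ) ∞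
    exact h

instance : LieGroup IG ∞ G := inferInstance

theorem g_chartAt_eq (x y : G) :
    chartAt (ModelProd ℝ (ℂ × ℝ)) x = chartAt (ModelProd ℝ (ℂ × ℝ)) y := rfl

/-- The coordinate of the factor `ℝ` of `G`. -/
def tCoord (x : G) : ℝ := Multiplicative.toAdd x.1

theorem contMDiff_toAdd : ContMDiff 𝓘(ℝ, ℝ) 𝓘(ℝ, ℝ) ∞ (Multiplicative.toAdd : Multiplicative ℝ → ℝ) :=
  contMDiff_id (I := 𝓘(ℝ, ℝ)) (M := ℝ)

theorem contMDiff_ofAdd : ContMDiff 𝓘(ℝ, ℝ) 𝓘(ℝ, ℝ) ∞ (Multiplicative.ofAdd : ℝ → Multiplicative ℝ) :=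
  contMDiff_id (I := 𝓘(ℝ, ℝ)) (M := ℝ)

theorem contMDiff_tCoord : ContMDiff IG 𝓘(ℝ, ℝ) ∞ tCoord := contMDiff_toAdd.comp contMDiff_fst

theorem contMDiff_gEntry (i j : Fin 2) : ContMDiff IG 𝓘(ℝ, ℝ) ∞ (fun x : G => x.2 i j) :=
  (contMDiff_entry i j).comp contMDiff_snd

theorem contMDiff_g_of_coords {φ : M → G} (ht : ContMDiff I 𝓘(ℝ, ℝ) ∞ (fun x => tCoord (φ x)))
    (h : ∀ i j, ContMDiff I 𝓘(ℝ, ℝ) ∞ (fun x => (φ x).2 i j)) : ContMDiff I IG ∞ φ :=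
  (contMDiff_ofAdd.comp ht).prodMk (contMDiff_sl2_of_entries h)

theorem dVec_tCoord (x : G) (u : ℝ × (ℂ × ℝ)) : dVec IG tCoord x u = u.1 := by
  have h := dMap_prod_fst (I := 𝓘(ℝ, ℝ)) (I' := ISL) (I'' := 𝓘(ℝ, ℝ)) (x := x)
    (contMDiff_toAdd.mdifferentiableAt (by simp)) u
  refine h.trans ?_
  have h2 : dMap 𝓘(ℝ, ℝ) 𝓘(ℝ, ℝ) (id : ℝ → ℝ) x.1 = ContinuousLinearMap.id ℝ ℝ := mfderiv_id
  exact DFunLike.congr_fun h2 u.1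

/-- The derivative of a matrix entry on `SL(2, ℝ)`. -/
def dEntry (i j : Fin 2) (A : SL2) : (ℂ × ℝ) →L[ℝ] ℝ := dVec ISL (fun A : SL2 => A i j) A

theorem dVec_gEntry (i j : Fin 2) (x : G) (u : ℝ × (ℂ × ℝ)) :
    dVec IG (fun x : G => x.2 i j) x u = dEntry i j x.2 u.2 :=
  dMap_prod_snd (I := 𝓘(ℝ, ℝ)) (I' := ISL) (I'' := 𝓘(ℝ, ℝ))
    ((contMDiff_entry i j).mdifferentiableAt (by simp)) u

theorem mdifferentiableAt_entry (i j : Fin 2) (A : SL2) :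
    MDifferentiableAt ISL 𝓘(ℝ, ℝ) (fun A : SL2 => A i j) A :=
  (contMDiff_entry i j).mdifferentiableAt (by simp)

/-- A tangent vector of `SL(2, ℝ)` in terms of the derivatives of the matrix entries. -/
theorem sl2_vector_eq (A : SL2) (u : ℂ × ℝ) :
    u = (⟨dEntry 0 0 A u, dEntry 1 0 A u⟩,
      A 0 0 * dEntry 0 1 A u + A 0 1 * dEntry 0 0 A u +
        (A 1 0 * dEntry 1 1 A u + A 1 1 * dEntry 1 0 A u)) := by
  have hs : MDifferentiableAt ISL ISL slCoord A := contMDiff_slCoord.mdifferentiableAt (by simp)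
  have hu := dVec_slCoord A u
  have d1 : ∀ L : (ℂ × ℝ) →L[ℝ] ℝ, dVec ISL (fun B : SL2 => L (slCoord B)) A u = L u := by
    intro L
    have := dVec_comp (I := ISL) (q := L) (p := slCoord) (x := A)
      L.differentiableAt.mdifferentiableAt hs u
    rw [this, dVec_eq_fderiv, L.fderiv]
    exact congrArg L hu
  have e1 := d1 (Complex.reCLM.comp (ContinuousLinearMap.fst ℝ ℂ ℝ))
  have e2 := d1 (Complex.imCLM.comp (ContinuousLinearMap.fst ℝ ℂ ℝ))
  have e3 := d1 (ContinuousLinearMap.snd ℝ ℂ ℝ)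
  have e3' : dVec ISL (fun B : SL2 => B 0 0 * B 0 1 + B 1 0 * B 1 1) A u = u.2 := e3
  rw [dVec_add (mdifferentiableAt_mul (mdifferentiableAt_entry 0 0 A) (mdifferentiableAt_entry 0 1 A))
    (mdifferentiableAt_mul (mdifferentiableAt_entry 1 0 A) (mdifferentiableAt_entry 1 1 A)),
    dVec_mul (mdifferentiableAt_entry 0 0 A) (mdifferentiableAt_entry 0 1 A),
    dVec_mul (mdifferentiableAt_entry 1 0 A) (mdifferentiableAt_entry 1 1 A)] at e3'
  refine Prod.ext (Complex.ext ?_ ?_) ?_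
  · exact e1.symm
  · exact e2.symm
  · exact e3'.symm

/-- The chart is a function of the entries, so their differentials separate tangent vectors.
Equalities of tangent vectors below are mostly proved in this way. -/
theorem sl2_vector_ext {A : SL2} {u v : ℂ × ℝ} (h : ∀ i j, dEntry i j A u = dEntry i j A v) :
    u = v := by
  rw [sl2_vector_eq A u, sl2_vector_eq A v]
  simp only [h]

theorem g_vector_ext {x : G} {u v : ℝ × (ℂ × ℝ)} (ht : u.1 = v.1)
    (h : ∀ i j, dEntry i j x.2 u.2 = dEntry i j x.2 v.2) : u = v :=
  Prod.ext ht (sl2_vector_ext h)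

/-- The derivative of the determinant vanishes on `SL(2, ℝ)`. -/
theorem dEntry_det (A : SL2) (u : ℂ × ℝ) :
    A 0 0 * dEntry 1 1 A u + A 1 1 * dEntry 0 0 A u
      - (A 0 1 * dEntry 1 0 A u + A 1 0 * dEntry 0 1 A u) = 0 := by
  have h := dVec_const (I := ISL) (1 : ℝ) A u
  have h2 : (fun _ : SL2 => (1 : ℝ)) = fun B => B 0 0 * B 1 1 - B 0 1 * B 1 0 := by
    funext B; exact (sl_det B).symm
  rw [h2, dVec_sub (mdifferentiableAt_mul (mdifferentiableAt_entry 0 0 A) (mdifferentiableAt_entry 1 1 A))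
    (mdifferentiableAt_mul (mdifferentiableAt_entry 0 1 A) (mdifferentiableAt_entry 1 0 A)),
    dVec_mul (mdifferentiableAt_entry 0 0 A) (mdifferentiableAt_entry 1 1 A),
    dVec_mul (mdifferentiableAt_entry 0 1 A) (mdifferentiableAt_entry 1 0 A)] at h
  exact h

end SpecialLinear

/-! ### One-parameter subgroups and the left-invariant frame -/

section Frame

/-- The matrices `f₁, f₂, f₃` and the zero matrix for `f₀`. -/
def frameMatrix : Fin 4 → Matrix (Fin 2) (Fin 2) ℝ :=
  ![0, !![0, 1; -1, 0], !![0, 1; 1, 0], !![1, 0; 0, -1]]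

/-- The component of `f₀, …, f₃` in the factor `ℝ`. -/
def frameTime : Fin 4 → ℝ := ![1, 0, 0, 0]

theorem tCoord_mul (x y : G) : tCoord (x * y) = tCoord x + tCoord y := rfl

theorem tCoord_σ (k : Fin 4) (t : ℝ) : tCoord (σ k t) = frameTime k * t := by
  fin_cases k <;> simp [tCoord, σ, frameTime]

theorem contDiff_σ_entry (k : Fin 4) (i j : Fin 2) :
    ContDiff ℝ ∞ (fun t => (σ k t).2 i j) := by
  fin_cases k <;> fin_cases i <;> fin_cases j <;>
    simp [σ, σ₁, σ₂, σ₃, Matrix.SpecialLinearGroup.coe_one] <;> fun_prop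

theorem contMDiff_σ (k : Fin 4) : ContMDiff 𝓘(ℝ, ℝ) IG ∞ (σ k) := by
  refine contMDiff_g_of_coords ?_ fun i j => (contDiff_σ_entry k i j).contMDiff
  simp only [tCoord_σ]
  exact (contDiff_const.mul contDiff_id).contMDiff

theorem hasDerivAt_σ_entry (k : Fin 4) (i j : Fin 2) :
    HasDerivAt (fun t => (σ k t).2 i j) (frameMatrix k i j) 0 := by
  fin_cases k <;> fin_cases i <;> fin_cases j <;>
    simp [σ, σ₁, σ₂, σ₃, frameMatrix, hasDerivAt_const]
  · simpa using Real.hasDerivAt_cos 0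
  · simpa using Real.hasDerivAt_sin 0
  · have h := (Real.hasDerivAt_sin 0).neg
    rw [Real.cos_zero] at h
    exact h
  · simpa using Real.hasDerivAt_cos 0
  · simpa using Real.hasDerivAt_cosh 0
  · simpa using Real.hasDerivAt_sinh 0
  · simpa using Real.hasDerivAt_sinh 0
  · simpa using Real.hasDerivAt_cosh 0
  · simpa using Real.hasDerivAt_exp 0
  · simpa using (hasDerivAt_neg (0 : ℝ)).exp

theorem σ_zero (k : Fin 4) : σ k 0 = 1 := by
  fin_cases k
  · rfl
  all_goals
    refine Prod.ext rfl ?_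
    ext i j
    fin_cases i <;> fin_cases j <;> simp [σ, σ₁, σ₂, σ₃]

theorem σ_add (k : Fin 4) (s t : ℝ) : σ k (s + t) = σ k s * σ k t := by
  fin_cases k
  · exact Prod.ext rfl (one_mul _).symm
  all_goals
    refine Prod.ext (one_mul _).symm ?_
    ext i j
    rw [Prod.snd_mul, sl2_mul_apply]
    fin_cases i <;> fin_cases j <;>
      simp [σ, σ₁, σ₂, σ₃, Real.cos_add, Real.sin_add, Real.cosh_add, Real.sinh_add,
        Real.exp_add] <;> ring

/-- At the identity the differential of the chart (a + ic, ab + cd) is (da + i dc, db + dc), and the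
determinant condition becomes da + dd = 0. -/
theorem dEntry_one (u : ℂ × ℝ) : dEntry 0 0 1 u = u.1.re ∧ dEntry 1 0 1 u = u.1.im ∧
    dEntry 0 1 1 u = u.2 - u.1.im ∧ dEntry 1 1 1 u = -u.1.re := by
  have h := sl2_vector_eq 1 u
  have hd := dEntry_det 1 u
  simp only [Matrix.SpecialLinearGroup.coe_one, Matrix.one_apply_eq, Matrix.one_apply_ne, ne_eq,
    zero_ne_one, one_ne_zero, not_false_eq_true] at h hd
  have h1 := congrArg (fun p : ℂ × ℝ => p.1.re) h
  have h2 := congrArg (fun p : ℂ × ℝ => p.1.im) h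
  have h3 := congrArg (fun p : ℂ × ℝ => p.2) h
  simp only at h1 h2 h3
  refine ⟨?_, ?_, ?_, ?_⟩ <;> linarith

theorem f_apply (k : Fin 4) : (f k : ℝ × (ℂ × ℝ)) =
    (frameTime k, (⟨frameMatrix k 0 0, frameMatrix k 1 0⟩, frameMatrix k 0 1 + frameMatrix k 1 0)) := by
  have h : (f k : ℝ × (ℂ × ℝ)) = gEquiv.symm (Pi.single k 1) :=
    Module.Basis.coe_ofEquivFun gEquiv ▸ rfl
  rw [h]
  fin_cases k <;> simp [gEquiv, frameTime, frameMatrix] <;>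
    refine Prod.ext ?_ (Prod.ext (Complex.ext ?_ ?_) ?_) <;> norm_num

/-- This connects the basis `f`, which is defined through coordinates, with the matrices f₁, f₂, f₃.
The last entry comes from the vanishing of the trace. -/
theorem dEntry_f (k : Fin 4) (i j : Fin 2) :
    dEntry i j 1 (f k : ℝ × (ℂ × ℝ)).2 = frameMatrix k i j := by
  obtain ⟨h1, h2, h3, h4⟩ := dEntry_one (f k : ℝ × (ℂ × ℝ)).2
  rw [f_apply] at *
  have hm : frameMatrix k 1 1 = - frameMatrix k 0 0 := by
    fin_cases k <;> simp [frameMatrix]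
  fin_cases i <;> fin_cases j
  · exact h1
  · exact h3.trans (by simp)
  · exact h2
  · exact h4.trans hm.symm

theorem dMap_σ (k : Fin 4) : dMap 𝓘(ℝ, ℝ) IG (σ k) 0 1 = (f k : ℝ × (ℂ × ℝ)) := by
  have hs : MDifferentiableAt 𝓘(ℝ, ℝ) IG (σ k) 0 := (contMDiff_σ k).mdifferentiableAt (by simp)
  apply g_vector_ext (x := (1 : G))
  · have h := hasDerivAt_comp_curve (q := tCoord) (γ := σ k) (t := 0)
      (contMDiff_tCoord.mdifferentiableAt (by simp)) hs
    rw [dVec_tCoord] at h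
    rw [f_apply]
    refine h.unique ?_
    simp only [tCoord_σ]
    simpa using (hasDerivAt_id (0 : ℝ)).const_mul (frameTime k)
  · intro i j
    have h := hasDerivAt_comp_curve (q := fun x : G => x.2 i j) (γ := σ k) (t := 0)
      ((contMDiff_gEntry i j).mdifferentiableAt (by simp)) hs
    rw [σ_zero, dVec_gEntry] at h
    refine (h.unique (hasDerivAt_σ_entry k i j)).trans ?_
    exact (dEntry_f k i j).symm

/-- The left-invariant frame of `G`. -/
def frame (k : Fin 4) (x : G) : ℝ × (ℂ × ℝ) := leftField IG (f k) x

theorem contMDiff_mul_left_sl2g (x : G) : ContMDiff IG IG ∞ (fun y : G => x * y) :=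
  contMDiff_mul_left

theorem mdifferentiableAt_mul_σ (k : Fin 4) (x : G) (t : ℝ) :
    MDifferentiableAt 𝓘(ℝ, ℝ) IG (fun t => x * σ k t) t :=
  ((contMDiff_mul_left_sl2g x).comp (contMDiff_σ k)).mdifferentiableAt (by simp)

theorem dMap_mul_σ (k : Fin 4) (x : G) :
    dMap 𝓘(ℝ, ℝ) IG (fun t => x * σ k t) 0 1 = frame k x := by
  have h := dMap_comp (I := 𝓘(ℝ, ℝ)) (I' := IG) (I'' := IG) (q := fun y : G => x * y) (p := σ k)
    (x := (0 : ℝ)) ((contMDiff_mul_left_sl2g x).mdifferentiableAt (by simp))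
    ((contMDiff_σ k).mdifferentiableAt (by simp)) 1
  rw [h, dMap_σ, σ_zero]
  rfl

/-- The frame field at x is the velocity of t ↦ x σₖ(t), so a derivative along the frame is an
ordinary derivative in one real variable. All later derivatives of projections along the frame are
computed with this. -/
theorem hasDerivAt_frame {F : Type*} [NormedAddCommGroup F] [NormedSpace ℝ F] {q : G → F} {x : G}
    (hq : MDifferentiableAt IG 𝓘(ℝ, F) q x) (k : Fin 4) :
    HasDerivAt (fun t => q (x * σ k t)) (dVec IG q x (frame k x)) 0 := by
  have hx : x * σ k 0 = x := by rw [σ_zero, mul_one]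
  have h := hasDerivAt_comp_curve (I := IG) (q := q) (γ := fun t => x * σ k t) (t := 0)
    (by rwa [hx]) (mdifferentiableAt_mul_σ k x 0)
  rw [dMap_mul_σ] at h
  simpa only [hx] using h

theorem frame_fst (k : Fin 4) (x : G) : (frame k x).1 = frameTime k := by
  have h := hasDerivAt_frame (x := x) (contMDiff_tCoord.mdifferentiableAt (by simp)) k
  rw [dVec_tCoord] at h
  refine h.unique ?_
  simp only [tCoord_mul, tCoord_σ]
  simpa using ((hasDerivAt_id (0 : ℝ)).const_mul (frameTime k)).const_add (tCoord x)

theorem dEntry_frame (k : Fin 4) (x : G) (i j : Fin 2) :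
    dEntry i j x.2 (frame k x).2 = x.2 i 0 * frameMatrix k 0 j + x.2 i 1 * frameMatrix k 1 j := by
  have h := hasDerivAt_frame (x := x) ((contMDiff_gEntry i j).mdifferentiableAt (by simp)) k
  rw [dVec_gEntry] at h
  refine h.unique ?_
  simp only [Prod.snd_mul, sl2_mul_apply]
  exact ((hasDerivAt_σ_entry k 0 j).const_mul _).add ((hasDerivAt_σ_entry k 1 j).const_mul _)

theorem frame_eq (k : Fin 4) (x : G) : frame k x = (frameTime k,
    (⟨x.2 0 0 * frameMatrix k 0 0 + x.2 0 1 * frameMatrix k 1 0,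
      x.2 1 0 * frameMatrix k 0 0 + x.2 1 1 * frameMatrix k 1 0⟩,
      x.2 0 0 * (x.2 0 0 * frameMatrix k 0 1 + x.2 0 1 * frameMatrix k 1 1) +
      x.2 0 1 * (x.2 0 0 * frameMatrix k 0 0 + x.2 0 1 * frameMatrix k 1 0) +
      (x.2 1 0 * (x.2 1 0 * frameMatrix k 0 1 + x.2 1 1 * frameMatrix k 1 1) +
      x.2 1 1 * (x.2 1 0 * frameMatrix k 0 0 + x.2 1 1 * frameMatrix k 1 0)))) := by
  refine Prod.ext (frame_fst k x) ?_
  have h := sl2_vector_eq x.2 (frame k x).2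
  simp only [dEntry_frame] at h
  exact h

theorem contMDiff_frame (k : Fin 4) : ContMDiff IG 𝓘(ℝ, ℝ × (ℂ × ℝ)) ∞ (frame k) := by
  have h : frame k = fun x => frame k x := rfl
  have e := contMDiff_gEntry
  rw [h]
  simp only [frame_eq]
  have c : ∀ r : ℝ, ContMDiff IG 𝓘(ℝ, ℝ) ∞ (fun _ : G => r) := fun r => contMDiff_const
  have l := fun i j => ((e i 0).mul (c (frameMatrix k 0 j))).add ((e i 1).mul (c (frameMatrix k 1 j)))
  exact (c _).prodMk_space ((contMDiff_complexMk (l 0 0) (l 1 0)).prodMk_space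
    ((((e 0 0).mul (l 0 1)).add ((e 0 1).mul (l 0 0))).add
      (((e 1 0).mul (l 1 1)).add ((e 1 1).mul (l 1 0)))))

theorem smoothField_frame (k : Fin 4) : SmoothField IG (fun x => (frame k x : TangentSpace IG x)) :=
  (smoothField_iff_of_const_chart g_chartAt_eq _).2 (contMDiff_frame k)

end Frame

/-! ### The metrics as polarized determinants -/

section Metrics

/-- The polarization of minus the determinant of the matrix differential. -/
def detForm (A : SL2) (u v : ℂ × ℝ) : ℝ :=
  (dEntry 0 1 A u * dEntry 1 0 A v + dEntry 1 0 A u * dEntry 0 1 A v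
    - dEntry 0 0 A u * dEntry 1 1 A v - dEntry 1 1 A u * dEntry 0 0 A v) / 2

theorem mdifferentiableAt_sl2_mul_left (a x : SL2) :
    MDifferentiableAt ISL ISL (fun y : SL2 => a * y) x :=
  (contMDiff_mul_left (I := ISL) (n := ∞) (a := a)).mdifferentiableAt (by simp)

theorem mdifferentiableAt_sl2_mul_right (a x : SL2) :
    MDifferentiableAt ISL ISL (fun y : SL2 => y * a) x :=
  (contMDiff_mul_right (I := ISL) (n := ∞) (a := a)).mdifferentiableAt (by simp)

theorem mdifferentiableAt_g_mul_left (a x : G) :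
    MDifferentiableAt IG IG (fun y : G => a * y) x :=
  (contMDiff_mul_left (I := IG) (n := ∞) (a := a)).mdifferentiableAt (by simp)

theorem mdifferentiableAt_g_mul_right (a x : G) :
    MDifferentiableAt IG IG (fun y : G => y * a) x :=
  (contMDiff_mul_right (I := IG) (n := ∞) (a := a)).mdifferentiableAt (by simp)

theorem dVec_const_mul {E H M : Type*} [NormedAddCommGroup E] [NormedSpace ℝ E]
    [TopologicalSpace H] {I : ModelWithCorners ℝ E H} [TopologicalSpace M] [ChartedSpace H M]
    {p : M → ℝ} {x : M} (c : ℝ) (hp : MDifferentiableAt I 𝓘(ℝ, ℝ) p x) (u : E) :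
    dVec I (fun y => c * p y) x u = c * dVec I p x u := by
  rw [dVec_mul mdifferentiableAt_const hp, dVec_const]
  ring

theorem mdifferentiableAt_const_mul {E H M : Type*} [NormedAddCommGroup E] [NormedSpace ℝ E]
    [TopologicalSpace H] {I : ModelWithCorners ℝ E H} [TopologicalSpace M] [ChartedSpace H M]
    {p : M → ℝ} {x : M} (c : ℝ) (hp : MDifferentiableAt I 𝓘(ℝ, ℝ) p x) :
    MDifferentiableAt I 𝓘(ℝ, ℝ) (fun y => c * p y) x :=
  mdifferentiableAt_mul mdifferentiableAt_const hp

theorem dEntry_mul_left (a x : SL2) (u : ℂ × ℝ) (i j : Fin 2) :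
    dEntry i j (a * x) (dMap ISL ISL (fun y => a * y) x u) =
      a i 0 * dEntry 0 j x u + a i 1 * dEntry 1 j x u := by
  have h := dVec_comp (I := ISL) (I' := ISL) (q := fun A : SL2 => A i j) (p := fun y => a * y)
    (mdifferentiableAt_entry i j (a * x)) (mdifferentiableAt_sl2_mul_left a x) u
  refine h.symm.trans ?_
  simp only [sl2_mul_apply]
  rw [dVec_add (mdifferentiableAt_const_mul _ (mdifferentiableAt_entry 0 j x))
    (mdifferentiableAt_const_mul _ (mdifferentiableAt_entry 1 j x)),
    dVec_const_mul _ (mdifferentiableAt_entry 0 j x),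
    dVec_const_mul _ (mdifferentiableAt_entry 1 j x)]
  rfl

theorem dEntry_mul_right (a x : SL2) (u : ℂ × ℝ) (i j : Fin 2) :
    dEntry i j (x * a) (dMap ISL ISL (fun y => y * a) x u) =
      a 0 j * dEntry i 0 x u + a 1 j * dEntry i 1 x u := by
  have h := dVec_comp (I := ISL) (I' := ISL) (q := fun A : SL2 => A i j) (p := fun y => y * a)
    (mdifferentiableAt_entry i j (x * a)) (mdifferentiableAt_sl2_mul_right a x) u
  refine h.symm.trans ?_
  simp only [sl2_mul_apply, mul_comm _ (a _ _)]
  rw [dVec_add (mdifferentiableAt_const_mul _ (mdifferentiableAt_entry i 0 x))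
    (mdifferentiableAt_const_mul _ (mdifferentiableAt_entry i 1 x)),
    dVec_const_mul _ (mdifferentiableAt_entry i 0 x),
    dVec_const_mul _ (mdifferentiableAt_entry i 1 x)]
  rfl

/-- The differential of y ↦ ay is dA ↦ a dA, and det(a dA) = det(a) det(dA) with det(a) = 1. -/
theorem detForm_mul_left (a x : SL2) (u v : ℂ × ℝ) :
    detForm (a * x) (dMap ISL ISL (fun y => a * y) x u) (dMap ISL ISL (fun y => a * y) x v) =
      detForm x u v := by
  simp only [detForm, dEntry_mul_left]
  linear_combination ((dEntry 0 1 x u * dEntry 1 0 x v + dEntry 1 0 x u * dEntry 0 1 x v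
    - dEntry 0 0 x u * dEntry 1 1 x v - dEntry 1 1 x u * dEntry 0 0 x v) / 2) * sl_det a

theorem detForm_mul_right (a x : SL2) (u v : ℂ × ℝ) :
    detForm (x * a) (dMap ISL ISL (fun y => y * a) x u) (dMap ISL ISL (fun y => y * a) x v) =
      detForm x u v := by
  simp only [detForm, dEntry_mul_right]
  linear_combination ((dEntry 0 1 x u * dEntry 1 0 x v + dEntry 1 0 x u * dEntry 0 1 x v
    - dEntry 0 0 x u * dEntry 1 1 x v - dEntry 1 1 x u * dEntry 0 0 x v) / 2) * sl_det a

theorem g_mul_left_dMap (a x : G) (u : ℝ × (ℂ × ℝ)) :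
    dMap IG IG (fun y => a * y) x u = (u.1, dMap ISL ISL (fun y => a.2 * y) x.2 u.2) := by
  have h1 : MDifferentiableAt IG 𝓘(ℝ, ℝ) (fun y : G => a.1 * y.1) x :=
    (mdifferentiableAt_g_mul_left a x).fst
  have h2 : MDifferentiableAt IG ISL (fun y : G => a.2 * y.2) x :=
    (mdifferentiableAt_g_mul_left a x).snd
  have h := dMap_prodMk h1 h2 u
  refine h.trans (Prod.ext ?_ ?_)
  -- The first component is read off with `tCoord`, in which the translation is an addition.
  · have e := dVec_comp (I := IG) (I' := IG) (q := tCoord) (p := fun y => a * y) (x := x)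
      (contMDiff_tCoord.mdifferentiableAt (by simp)) (mdifferentiableAt_g_mul_left a x) u
    rw [dVec_tCoord] at e
    have h' : dMap IG IG (fun y => a * y) x u = _ := h
    rw [h'] at e
    refine e.symm.trans ?_
    simp only [tCoord_mul]
    rw [dVec_add mdifferentiableAt_const (contMDiff_tCoord.mdifferentiableAt (by simp)), dVec_const,
      dVec_tCoord, zero_add]
  · exact dMap_prod_snd (mdifferentiableAt_sl2_mul_left a.2 x.2) u

theorem g_mul_right_dMap (a x : G) (u : ℝ × (ℂ × ℝ)) :
    dMap IG IG (fun y => y * a) x u = (u.1, dMap ISL ISL (fun y => y * a.2) x.2 u.2) := by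
  have h1 : MDifferentiableAt IG 𝓘(ℝ, ℝ) (fun y : G => y.1 * a.1) x :=
    (mdifferentiableAt_g_mul_right a x).fst
  have h2 : MDifferentiableAt IG ISL (fun y : G => y.2 * a.2) x :=
    (mdifferentiableAt_g_mul_right a x).snd
  have h := dMap_prodMk h1 h2 u
  refine h.trans (Prod.ext ?_ ?_)
  · have e := dVec_comp (I := IG) (I' := IG) (q := tCoord) (p := fun y => y * a) (x := x)
      (contMDiff_tCoord.mdifferentiableAt (by simp)) (mdifferentiableAt_g_mul_right a x) u
    rw [dVec_tCoord] at e
    have h' : dMap IG IG (fun y => y * a) x u = _ := h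
    rw [h'] at e
    refine e.symm.trans ?_
    simp only [tCoord_mul]
    rw [dVec_add (contMDiff_tCoord.mdifferentiableAt (by simp)) mdifferentiableAt_const, dVec_const,
      dVec_tCoord, add_zero]
  · exact dMap_prod_snd (mdifferentiableAt_sl2_mul_right a.2 x.2) u

/-- The matrix x₁f₁ + x₂f₂ + x₃f₃ has rows (x₃, x₁ + x₂) and (x₂ - x₁, -x₃), and minus its
determinant is -x₁² + x₂² + x₃². -/
theorem detForm_one (u v : ℂ × ℝ) : detForm 1 u v =
    -((u.2 / 2 - u.1.im) * (v.2 / 2 - v.1.im)) + u.2 / 2 * (v.2 / 2) + u.1.re * v.1.re := by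
  obtain ⟨h1, h2, h3, h4⟩ := dEntry_one u
  obtain ⟨k1, k2, k3, k4⟩ := dEntry_one v
  simp only [detForm, h1, h2, h3, h4, k1, k2, k3, k4]
  ring

/-- Both forms are left-invariant, so it is enough to compare them at the identity, where
`detForm_one` applies. -/
theorem gSL_apply (A : SL2) (u v : ℂ × ℝ) : gSL A u v = detForm A u v := by
  have h : gSL A u v = Matrix.toBilin (Module.Basis.ofEquivFun slEquiv) (Matrix.diagonal ![-1, 1, 1])
    (dMap ISL ISL (fun y => A⁻¹ * y) A u) (dMap ISL ISL (fun y => A⁻¹ * y) A v) := rfl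
  rw [h, ← detForm_mul_left A⁻¹ A, inv_mul_cancel, detForm_one, Matrix.toBilin_apply]
  simp only [Fin.sum_univ_three]
  simp only [Module.Basis.ofEquivFun_repr_apply]
  simp [slEquiv, Matrix.diagonal]
  ring

/-- The metric of `G` as a family of bilinear forms on the model vector space. -/
def gForm (x : G) : LinearMap.BilinForm ℝ (ℝ × (ℂ × ℝ)) := gG x

theorem gForm_apply (x : G) (u v : ℝ × (ℂ × ℝ)) :
    gForm x u v = -(u.1 * v.1) + detForm x.2 u.2 v.2 := by
  have h : gForm x u v = Matrix.toBilin (Module.Basis.ofEquivFun gEquiv) (Matrix.diagonal sign)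
    (dMap IG IG (fun y => x⁻¹ * y) x u) (dMap IG IG (fun y => x⁻¹ * y) x v) := rfl
  rw [h, ← detForm_mul_left x.2⁻¹ x.2, inv_mul_cancel, detForm_one, Matrix.toBilin_apply,
    g_mul_left_dMap, g_mul_left_dMap]
  simp only [Fin.sum_univ_four, Prod.snd_inv]
  simp only [Module.Basis.ofEquivFun_repr_apply]
  simp [gEquiv, Matrix.diagonal, sign]
  ring

theorem isBiInvariant_gSL : IsBiInvariant ISL gSL := by
  refine ⟨fun a x u v => ?_, fun a x u v => ?_⟩
  · exact (gSL_apply _ _ _).trans ((detForm_mul_left a x u v).trans (gSL_apply _ _ _).symm)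
  · exact (gSL_apply _ _ _).trans ((detForm_mul_right a x u v).trans (gSL_apply _ _ _).symm)

theorem isBiInvariant_gG : IsBiInvariant IG gG := by
  have hl : ∀ (a x : G) (u v : ℝ × (ℂ × ℝ)), gForm (a * x) (dMap IG IG (fun y => a * y) x u)
      (dMap IG IG (fun y => a * y) x v) = gForm x u v := by
    intro a x u v
    rw [gForm_apply, gForm_apply, g_mul_left_dMap, g_mul_left_dMap, Prod.snd_mul, detForm_mul_left]
  have hr : ∀ (a x : G) (u v : ℝ × (ℂ × ℝ)), gForm (x * a) (dMap IG IG (fun y => y * a) x u)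
      (dMap IG IG (fun y => y * a) x v) = gForm x u v := by
    intro a x u v
    rw [gForm_apply, gForm_apply, g_mul_right_dMap, g_mul_right_dMap, Prod.snd_mul,
      detForm_mul_right]
  exact ⟨hl, hr⟩

theorem gForm_frame (x : G) (i j : Fin 4) :
    gForm x (frame i x) (frame j x) = if i = j then sign i else 0 := by
  rw [gForm_apply]
  simp only [detForm, frame_fst, dEntry_frame]
  have h := sl_det x.2
  -- With A = `x.2`, the polarized -det of the pair AP, AQ is det(A) = 1 times that of P, Q. This
  -- reduces the claim to the matrices f₀, …, f₃.
  have e : ∀ P Q : Matrix (Fin 2) (Fin 2) ℝ, ∀ r : ℝ,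
      r = (P 0 1 * Q 1 0 + P 1 0 * Q 0 1 - P 0 0 * Q 1 1 - P 1 1 * Q 0 0) / 2 →
      ((x.2 0 0 * P 0 1 + x.2 0 1 * P 1 1) * (x.2 1 0 * Q 0 0 + x.2 1 1 * Q 1 0) +
        (x.2 1 0 * P 0 0 + x.2 1 1 * P 1 0) * (x.2 0 0 * Q 0 1 + x.2 0 1 * Q 1 1) -
        (x.2 0 0 * P 0 0 + x.2 0 1 * P 1 0) * (x.2 1 0 * Q 0 1 + x.2 1 1 * Q 1 1) -
        (x.2 1 0 * P 0 1 + x.2 1 1 * P 1 1) * (x.2 0 0 * Q 0 0 + x.2 0 1 * Q 1 0)) / 2 = r := by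
    rintro P Q r rfl
    linear_combination
      ((P 0 1 * Q 1 0 + P 1 0 * Q 0 1 - P 0 0 * Q 1 1 - P 1 1 * Q 0 0) / 2) * h
  rw [e _ _ _ rfl]
  fin_cases i <;> fin_cases j <;> simp [frameTime, frameMatrix, sign]

/-- Pairing a linear relation with a frame field isolates one coefficient, multiplied by the nonzero
number `sign i`. -/
theorem linearIndependent_frame (x : G) : LinearIndependent ℝ (fun k => frame k x) := by
  rw [Fintype.linearIndependent_iff]
  intro c hc i
  have h : gForm x (∑ k, c k • frame k x) (frame i x) = 0 := by
    rw [hc]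
    exact LinearMap.map_zero₂ (gForm x) _
  have h2 : gForm x (∑ k, c k • frame k x) (frame i x) =
      ∑ k, c k * gForm x (frame k x) (frame i x) := by
    refine (LinearMap.map_sum₂ (gForm x) _ _ _).trans (Finset.sum_congr rfl fun k _ => ?_)
    exact LinearMap.map_smul₂ (gForm x) _ _ _
  rw [h2] at h
  simp only [gForm_frame, mul_ite, mul_zero, Finset.sum_ite_eq', Finset.mem_univ, if_true] at h
  have hs : sign i ≠ 0 := by fin_cases i <;> simp [sign]
  exact (mul_eq_zero.1 h).resolve_right hs

/-- The left-invariant frame as a basis of the tangent space. -/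
def frameBasis (x : G) : Module.Basis (Fin 4) ℝ (ℝ × (ℂ × ℝ)) :=
  basisOfLinearIndependentOfCardEqFinrank (linearIndependent_frame x) (by simp)

theorem frameBasis_apply (x : G) (k : Fin 4) : frameBasis x k = frame k x := by
  simp [frameBasis]

/-- The coefficients of a tangent vector of `G` with respect to the left-invariant frame. -/
def coeff (k : Fin 4) (x : G) (u : ℝ × (ℂ × ℝ)) : ℝ := (frameBasis x).repr u k

theorem sum_coeff (x : G) (u : ℝ × (ℂ × ℝ)) : ∑ k, coeff k x u • frame k x = u := by
  have h := (frameBasis x).sum_repr u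
  simp only [frameBasis_apply] at h
  exact h

theorem coeff_frame (x : G) (k l : Fin 4) : coeff k x (frame l x) = if l = k then 1 else 0 := by
  rw [coeff, ← frameBasis_apply, Module.Basis.repr_self, Finsupp.single_apply]

theorem coeff_add (k : Fin 4) (x : G) (u v : ℝ × (ℂ × ℝ)) :
    coeff k x (u + v) = coeff k x u + coeff k x v := by simp [coeff]

theorem coeff_smul (k : Fin 4) (x : G) (r : ℝ) (v : ℝ × (ℂ × ℝ)) :
    coeff k x (r • v) = r * coeff k x v := by simp [coeff]

theorem coeff_neg (k : Fin 4) (x : G) (v : ℝ × (ℂ × ℝ)) :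
    coeff k x (-v) = - coeff k x v := by simp [coeff]

theorem coeff_sub (k : Fin 4) (x : G) (u v : ℝ × (ℂ × ℝ)) :
    coeff k x (u - v) = coeff k x u - coeff k x v := by simp [coeff]

theorem coeff_ext {x : G} {u v : ℝ × (ℂ × ℝ)} (h : ∀ k, coeff k x u = coeff k x v) : u = v := by
  rw [← sum_coeff x u, ← sum_coeff x v]
  simp only [h]

theorem gForm_frame_right (x : G) (u : ℝ × (ℂ × ℝ)) (i : Fin 4) :
    gForm x u (frame i x) = sign i * coeff i x u := by
  conv_lhs => rw [← sum_coeff x u]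
  have h2 : gForm x (∑ k, coeff k x u • frame k x) (frame i x) =
      ∑ k, coeff k x u * gForm x (frame k x) (frame i x) := by
    refine (LinearMap.map_sum₂ (gForm x) _ _ _).trans (Finset.sum_congr rfl fun k _ => ?_)
    exact LinearMap.map_smul₂ (gForm x) _ _ _
  rw [h2]
  simp only [gForm_frame, mul_ite, mul_zero, Finset.sum_ite_eq', Finset.mem_univ, if_true, mul_comm]

theorem gForm_coeff (x : G) (u v : ℝ × (ℂ × ℝ)) :
    gForm x u v = -(coeff 0 x u * coeff 0 x v) - coeff 1 x u * coeff 1 x v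
      + coeff 2 x u * coeff 2 x v + coeff 3 x u * coeff 3 x v := by
  have h2 : gForm x u (∑ k, coeff k x v • frame k x) =
      ∑ k, coeff k x v * gForm x u (frame k x) := by
    refine (map_sum (gForm x u) _ _).trans (Finset.sum_congr rfl fun k _ => ?_)
    exact (gForm x u).map_smul _ _
  rw [sum_coeff] at h2
  rw [h2]
  simp only [gForm_frame_right, Fin.sum_univ_four]
  simp [sign]
  ring

theorem sign_sq (i : Fin 4) : sign i * sign i = 1 := by fin_cases i <;> simp [sign]

theorem coeff_eq_gForm (x : G) (u : ℝ × (ℂ × ℝ)) (i : Fin 4) :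
    coeff i x u = sign i * gForm x u (frame i x) := by
  rw [gForm_frame_right, ← mul_assoc, sign_sq, one_mul]

theorem contMDiff_detForm {E H M : Type*} [NormedAddCommGroup E] [NormedSpace ℝ E]
    [TopologicalSpace H] {I : ModelWithCorners ℝ E H} [TopologicalSpace M] [ChartedSpace H M]
    {a : M → SL2} {u v : M → ℂ × ℝ}
    (hu : ∀ i j, ContMDiff I 𝓘(ℝ, ℝ) ∞ (fun x => dEntry i j (a x) (u x)))
    (hv : ∀ i j, ContMDiff I 𝓘(ℝ, ℝ) ∞ (fun x => dEntry i j (a x) (v x))) :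
    ContMDiff I 𝓘(ℝ, ℝ) ∞ (fun x => detForm (a x) (u x) (v x)) :=
  ((((hu 0 1).mul (hv 1 0)).add ((hu 1 0).mul (hv 0 1))).sub ((hu 0 0).mul (hv 1 1))).sub
    ((hu 1 1).mul (hv 0 0)) |>.div_const 2

theorem detForm_comm (A : SL2) (u v : ℂ × ℝ) : detForm A u v = detForm A v u := by
  simp only [detForm]; ring

theorem contMDiff_gG {X Y : VField IG G} (hX : SmoothField IG X) (hY : SmoothField IG Y) :
    ContMDiff IG 𝓘(ℝ, ℝ) ∞ (fun x => gG x (X x) (Y x)) := by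
  have ht : ∀ {X : VField IG G}, SmoothField IG X → ContMDiff IG 𝓘(ℝ, ℝ) ∞ (fun x => (X x : ℝ × (ℂ × ℝ)).1) := by
    intro X hX
    have := hX.contMDiff_dVec contMDiff_tCoord
    exact this.congr fun x => (dVec_tCoord x (X x)).symm
  have he : ∀ {X : VField IG G}, SmoothField IG X → ∀ i j,
      ContMDiff IG 𝓘(ℝ, ℝ) ∞ (fun x => dEntry i j x.2 (X x : ℝ × (ℂ × ℝ)).2) := by
    intro X hX i j
    have := hX.contMDiff_dVec (contMDiff_gEntry i j)
    exact this.congr fun x => (dVec_gEntry i j x (X x)).symm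
  have h := ((ht hX).mul (ht hY)).neg.add (contMDiff_detForm (a := Prod.snd) (he hX) (he hY))
  exact h.congr fun x => gForm_apply x (X x) (Y x)

theorem gForm_comm (x : G) (u v : ℝ × (ℂ × ℝ)) : gForm x u v = gForm x v u := by
  rw [gForm_apply, gForm_apply, detForm_comm, mul_comm]

theorem gForm_nondegenerate {x : G} {u : ℝ × (ℂ × ℝ)} (h : ∀ v, gForm x u v = 0) : u = 0 := by
  refine coeff_ext (x := x) fun k => ?_
  rw [coeff_eq_gForm, coeff_eq_gForm, h, map_zero, LinearMap.zero_apply]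

theorem isPseudoRiemannianMetric_gG : IsPseudoRiemannianMetric IG gG where
  symm x u v := gForm_comm x u v
  nondegenerate x := ⟨fun _ hu => gForm_nondegenerate hu,
    fun u hu => gForm_nondegenerate fun v => (gForm_comm x u v).trans (hu v)⟩
  smooth _ _ hX hY := contMDiff_gG hX hY

/-- A vector in the radical of `detForm` at A, placed in the second factor, is in the radical of the
metric of G. -/
theorem detForm_nondegenerate {A : SL2} {u : ℂ × ℝ} (h : ∀ v, detForm A u v = 0) : u = 0 := by
  have hn := gForm_nondegenerate (x := ((1, A) : G)) (u := ((0, u) : ℝ × (ℂ × ℝ)))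
    (fun v => by rw [gForm_apply, h]; simp)
  exact congrArg Prod.snd hn

theorem isPseudoRiemannianMetric_gSL : IsPseudoRiemannianMetric ISL gSL where
  symm A u v := (gSL_apply A u v).trans ((detForm_comm A u v).trans (gSL_apply A v u).symm)
  nondegenerate A := by
    refine ⟨fun u hu => detForm_nondegenerate (A := A) fun v => (gSL_apply A u v).symm.trans (hu v),
      fun u hu => detForm_nondegenerate (A := A) fun v =>
        (detForm_comm A u v).trans ((gSL_apply A v u).symm.trans (hu v))⟩
  smooth X Y hX hY := by
    have h := contMDiff_detForm (a := fun A => A) (u := fun x => X x) (v := fun x => Y x)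
      (fun i j => hX.contMDiff_dVec (contMDiff_entry i j))
      (fun i j => hY.contMDiff_dVec (contMDiff_entry i j))
    exact h.congr fun x => gSL_apply x (X x) (Y x)

end Metrics

/-! ### The structures J, J̃, JJ̃ and the integrability of J -/

section Structures

theorem dMap_inv_mul_frame (x : G) (k : Fin 4) :
    dMap IG IG (fun y => x⁻¹ * y) x (frame k x) = (f k : ℝ × (ℂ × ℝ)) := by
  have hd := sl_det x.2
  rw [g_mul_left_dMap]
  refine g_vector_ext (x := (1 : G)) ?_ fun i j => ?_
  · rw [frame_fst, f_apply]
  · refine Eq.trans ?_ (dEntry_f k i j).symm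
    have h := dEntry_mul_left x.2⁻¹ x.2 (frame k x).2 i j
    rw [inv_mul_cancel, dEntry_frame, dEntry_frame] at h
    refine h.trans ?_
    simp only [Matrix.SpecialLinearGroup.coe_inv, Matrix.adjugate_fin_two]
    fin_cases i <;> simp
    · linear_combination (frameMatrix k 0 j) * hd
    · linear_combination (frameMatrix k 1 j) * hd

theorem leftEnd_frame (b : Fin 4 → TangentSpace IG (1 : G)) (x : G) (k : Fin 4) :
    (leftEnd IG (f.constr ℝ b) x (frame k x) : ℝ × (ℂ × ℝ)) =
      dMap IG IG (fun y => x * y) 1 (b k) := by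
  have h : (leftEnd IG (f.constr ℝ b) x (frame k x) : ℝ × (ℂ × ℝ)) =
    dMap IG IG (fun y => x * y) 1
      (f.constr ℝ b (dMap IG IG (fun y => x⁻¹ * y) x (frame k x) : ℝ × (ℂ × ℝ))) := rfl
  rw [h, dMap_inv_mul_frame]
  congr 1
  exact f.constr_basis ℝ b k

theorem dMap_mul_f (x : G) (k : Fin 4) :
    dMap IG IG (fun y => x * y) 1 (f k : ℝ × (ℂ × ℝ)) = frame k x := rfl

theorem dMap_mul_neg_f (x : G) (k : Fin 4) :
    dMap IG IG (fun y => x * y) 1 (-f k : ℝ × (ℂ × ℝ)) = -frame k x :=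
  map_neg (dMap IG IG (fun y => x * y) 1) _

/-- The structures `J`, `J'` and `J''` as families of endomorphisms of the model vector space. -/
def jMap (x : G) : (ℝ × (ℂ × ℝ)) →ₗ[ℝ] (ℝ × (ℂ × ℝ)) := J x

/-- The structure `J'` as a family of endomorphisms of the model vector space. -/
def jMap' (x : G) : (ℝ × (ℂ × ℝ)) →ₗ[ℝ] (ℝ × (ℂ × ℝ)) := J' x

theorem jMap_frame (x : G) : jMap x (frame 0 x) = frame 1 x ∧ jMap x (frame 1 x) = -frame 0 x ∧
    jMap x (frame 2 x) = frame 3 x ∧ jMap x (frame 3 x) = -frame 2 x := by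
  refine ⟨?_, ?_, ?_, ?_⟩
  · exact (leftEnd_frame _ x 0).trans (dMap_mul_f x 1)
  · exact (leftEnd_frame _ x 1).trans (dMap_mul_neg_f x 0)
  · exact (leftEnd_frame _ x 2).trans (dMap_mul_f x 3)
  · exact (leftEnd_frame _ x 3).trans (dMap_mul_neg_f x 2)

theorem jMap'_frame (x : G) : jMap' x (frame 0 x) = frame 2 x ∧
    jMap' x (frame 1 x) = -frame 3 x ∧
    jMap' x (frame 2 x) = frame 0 x ∧ jMap' x (frame 3 x) = -frame 1 x := by
  refine ⟨?_, ?_, ?_, ?_⟩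
  · exact (leftEnd_frame _ x 0).trans (dMap_mul_f x 2)
  · exact (leftEnd_frame _ x 1).trans (dMap_mul_neg_f x 3)
  · exact (leftEnd_frame _ x 2).trans (dMap_mul_f x 0)
  · exact (leftEnd_frame _ x 3).trans (dMap_mul_neg_f x 1)

theorem linearMap_eq_sum (A : (ℝ × (ℂ × ℝ)) →ₗ[ℝ] (ℝ × (ℂ × ℝ))) (x : G) (u : ℝ × (ℂ × ℝ)) :
    A u = coeff 0 x u • A (frame 0 x) + coeff 1 x u • A (frame 1 x) +
      coeff 2 x u • A (frame 2 x) + coeff 3 x u • A (frame 3 x) := by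
  conv_lhs => rw [← sum_coeff x u]
  simp only [Fin.sum_univ_four, map_add, map_smul]

/-- The structure is left-invariant, hence has constant coefficients in the frame. The algebraic
identities then become identities between signed permutations of four real numbers. -/
theorem coeff_jMap (x : G) (u : ℝ × (ℂ × ℝ)) : coeff 0 x (jMap x u) = -coeff 1 x u ∧
    coeff 1 x (jMap x u) = coeff 0 x u ∧ coeff 2 x (jMap x u) = -coeff 3 x u ∧
    coeff 3 x (jMap x u) = coeff 2 x u := by
  obtain ⟨h0, h1, h2, h3⟩ := jMap_frame x
  rw [linearMap_eq_sum (jMap x) x u, h0, h1, h2, h3]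
  simp [coeff_add, coeff_smul, coeff_neg, coeff_frame]

theorem coeff_jMap' (x : G) (u : ℝ × (ℂ × ℝ)) : coeff 0 x (jMap' x u) = coeff 2 x u ∧
    coeff 1 x (jMap' x u) = -coeff 3 x u ∧ coeff 2 x (jMap' x u) = coeff 0 x u ∧
    coeff 3 x (jMap' x u) = -coeff 1 x u := by
  obtain ⟨h0, h1, h2, h3⟩ := jMap'_frame x
  rw [linearMap_eq_sum (jMap' x) x u, h0, h1, h2, h3]
  simp [coeff_add, coeff_smul, coeff_neg, coeff_frame]

theorem forall_fin_four {p : Fin 4 → Prop} (h0 : p 0) (h1 : p 1) (h2 : p 2) (h3 : p 3) (k : Fin 4) :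
    p k := by
  fin_cases k <;> assumption

theorem jMap_jMap (x : G) (u : ℝ × (ℂ × ℝ)) : jMap x (jMap x u) = -u := by
  obtain ⟨h0, h1, h2, h3⟩ := coeff_jMap x (jMap x u)
  obtain ⟨k0, k1, k2, k3⟩ := coeff_jMap x u
  refine coeff_ext (x := x) (forall_fin_four ?_ ?_ ?_ ?_) <;> simp [*, coeff_neg]

theorem jMap'_jMap' (x : G) (u : ℝ × (ℂ × ℝ)) : jMap' x (jMap' x u) = u := by
  obtain ⟨h0, h1, h2, h3⟩ := coeff_jMap' x (jMap' x u)
  obtain ⟨k0, k1, k2, k3⟩ := coeff_jMap' x u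
  refine coeff_ext (x := x) (forall_fin_four ?_ ?_ ?_ ?_) <;> simp [*]

theorem jMap'_jMap (x : G) (u : ℝ × (ℂ × ℝ)) : jMap' x (jMap x u) = -jMap x (jMap' x u) := by
  obtain ⟨h0, h1, h2, h3⟩ := coeff_jMap x (jMap' x u)
  obtain ⟨k0, k1, k2, k3⟩ := coeff_jMap x u
  obtain ⟨l0, l1, l2, l3⟩ := coeff_jMap' x (jMap x u)
  obtain ⟨m0, m1, m2, m3⟩ := coeff_jMap' x u
  refine coeff_ext (x := x) (forall_fin_four ?_ ?_ ?_ ?_) <;> simp [*, coeff_neg]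

theorem gForm_jMap (x : G) (u v : ℝ × (ℂ × ℝ)) : gForm x (jMap x u) (jMap x v) = gForm x u v := by
  obtain ⟨h0, h1, h2, h3⟩ := coeff_jMap x u
  obtain ⟨k0, k1, k2, k3⟩ := coeff_jMap x v
  rw [gForm_coeff, gForm_coeff, h0, h1, h2, h3, k0, k1, k2, k3]
  ring

theorem gForm_jMap' (x : G) (u v : ℝ × (ℂ × ℝ)) :
    gForm x (jMap' x u) (jMap' x v) = -gForm x u v := by
  obtain ⟨h0, h1, h2, h3⟩ := coeff_jMap' x u
  obtain ⟨k0, k1, k2, k3⟩ := coeff_jMap' x v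
  rw [gForm_coeff, gForm_coeff, h0, h1, h2, h3, k0, k1, k2, k3]
  ring

/-- Orthonormality makes a coefficient equal, up to sign, to the metric pairing with a smooth frame
field. -/
theorem SmoothField.contMDiff_coeff {X : VField IG G} (hX : SmoothField IG X) (k : Fin 4) :
    ContMDiff IG 𝓘(ℝ, ℝ) ∞ (fun x => coeff k x (X x)) := by
  have h := (contMDiff_const (c := sign k)).mul (contMDiff_gG hX (smoothField_frame k))
  exact h.congr fun x => coeff_eq_gForm x (X x) k

theorem smoothField_of_coeff {X : VField IG G}
    (h : ∀ k, ContMDiff IG 𝓘(ℝ, ℝ) ∞ (fun x => coeff k x (X x))) : SmoothField IG X := by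
  rw [smoothField_iff_of_const_chart g_chartAt_eq]
  have hs : ContMDiff IG 𝓘(ℝ, ℝ × (ℂ × ℝ)) ∞ (fun x => ∑ k, coeff k x (X x) • frame k x) :=
    ContMDiff.sum fun k _ => (h k).smul (contMDiff_frame k)
  exact hs.congr fun x => (sum_coeff x (X x)).symm

theorem smoothEnd_J : SmoothEnd IG J := by
  intro X hX
  have hc := hX.contMDiff_coeff
  have e := fun x => coeff_jMap x (X x)
  refine smoothField_of_coeff (forall_fin_four ?_ ?_ ?_ ?_)
  · exact (hc 1).neg.congr fun x => (e x).1
  · exact (hc 0).congr fun x => (e x).2.1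
  · exact (hc 3).neg.congr fun x => (e x).2.2.1
  · exact (hc 2).congr fun x => (e x).2.2.2

theorem smoothEnd_J' : SmoothEnd IG J' := by
  intro X hX
  have hc := hX.contMDiff_coeff
  have e := fun x => coeff_jMap' x (X x)
  refine smoothField_of_coeff (forall_fin_four ?_ ?_ ?_ ?_)
  · exact (hc 2).congr fun x => (e x).1
  · exact (hc 3).neg.congr fun x => (e x).2.1
  · exact (hc 0).congr fun x => (e x).2.2.1
  · exact (hc 1).neg.congr fun x => (e x).2.2.2

/-- The structure constants of the frame: `[f₁, f₂] = 2 f₃`, `[f₁, f₃] = -2 f₂`,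
`[f₂, f₃] = -2 f₁`. -/
def bracketCoeff (a b : Fin 4 → ℝ) : Fin 4 → ℝ :=
  ![0, -2 * (a 2 * b 3 - a 3 * b 2), -2 * (a 1 * b 3 - a 3 * b 1), 2 * (a 1 * b 2 - a 2 * b 1)]

theorem dVec_clm {E H M F F' : Type*} [NormedAddCommGroup E] [NormedSpace ℝ E]
    [TopologicalSpace H] {I : ModelWithCorners ℝ E H} [TopologicalSpace M] [ChartedSpace H M]
    [NormedAddCommGroup F] [NormedSpace ℝ F] [NormedAddCommGroup F'] [NormedSpace ℝ F']
    (L : F →L[ℝ] F') {q : M → F} {x : M} (hq : MDifferentiableAt I 𝓘(ℝ, F) q x) (u : E) :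
    dVec I (fun y => L (q y)) x u = L (dVec I q x u) := by
  have := dVec_comp (I := I) (q := L) (p := q) (x := x) L.differentiableAt.mdifferentiableAt hq u
  rw [this, dVec_eq_fderiv, L.fderiv]
  rfl

theorem hasDerivAt_gEntry_frame (k : Fin 4) (x : G) (i j : Fin 2) :
    HasDerivAt (fun t => (x * σ k t).2 i j)
      (x.2 i 0 * frameMatrix k 0 j + x.2 i 1 * frameMatrix k 1 j) 0 := by
  have h := hasDerivAt_frame (x := x) ((contMDiff_gEntry i j).mdifferentiableAt (by simp)) k
  rwa [dVec_gEntry, dEntry_frame] at h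

theorem hasDerivAt_clm_frame (L : (ℝ × (ℂ × ℝ)) →L[ℝ] ℝ) (k l : Fin 4) (x : G) :
    HasDerivAt (fun t => L (frame l (x * σ k t))) (L (dVec IG (frame l) x (frame k x))) 0 := by
  have hl : MDifferentiableAt IG 𝓘(ℝ, ℝ × (ℂ × ℝ)) (frame l) x :=
    (contMDiff_frame l).mdifferentiableAt (by simp)
  have h := hasDerivAt_frame (q := fun y => L (frame l y)) (x := x)
    (L.differentiableAt.mdifferentiableAt.comp x hl) k
  rwa [dVec_clm L hl] at h

/-- Along x σₖ(t) the matrix x moves with velocity x fₖ, so the matrix x f_l of the field moves with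
velocity x fₖ f_l. Here `m n` holds the entries of x fₙ and `p` those of x fₖ f_l; the last
coordinate follows from ab + cd by the product rule. -/
theorem dVec_frame_frame (k l : Fin 4) (x : G) :
    let m := fun (n : Fin 4) (i j : Fin 2) =>
      x.2 i 0 * frameMatrix n 0 j + x.2 i 1 * frameMatrix n 1 j
    let p := fun (i j : Fin 2) => m k i 0 * frameMatrix l 0 j + m k i 1 * frameMatrix l 1 j
    dVec IG (frame l) x (frame k x) = (0, (⟨p 0 0, p 1 0⟩,
      (m k 0 0 * m l 0 1 + x.2 0 0 * p 0 1) + (m k 0 1 * m l 0 0 + x.2 0 1 * p 0 0) +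
      ((m k 1 0 * m l 1 1 + x.2 1 0 * p 1 1) + (m k 1 1 * m l 1 0 + x.2 1 1 * p 1 0)))) := by
  intro m p
  have hx : x * σ k 0 = x := by rw [σ_zero, mul_one]
  have e := hasDerivAt_gEntry_frame k x
  have q : ∀ i j, HasDerivAt (fun t => (x * σ k t).2 i 0 * frameMatrix l 0 j +
      (x * σ k t).2 i 1 * frameMatrix l 1 j) (p i j) 0 := fun i j =>
    ((e i 0).mul_const _).add ((e i 1).mul_const _)
  have c := fun L => hasDerivAt_clm_frame L k l x
  refine Prod.ext ?_ (Prod.ext (Complex.ext ?_ ?_) ?_)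
  · have h := c (ContinuousLinearMap.fst ℝ ℝ (ℂ × ℝ))
    simp only [ContinuousLinearMap.coe_fst', frame_fst] at h
    exact h.unique (hasDerivAt_const _ _)
  · have h := c (Complex.reCLM.comp ((ContinuousLinearMap.fst ℝ ℂ ℝ).comp
      (ContinuousLinearMap.snd ℝ ℝ (ℂ × ℝ))))
    refine h.unique ((q 0 0).congr_of_eventuallyEq (Filter.Eventually.of_forall fun t => ?_))
    simp [frame_eq]
  · have h := c (Complex.imCLM.comp ((ContinuousLinearMap.fst ℝ ℂ ℝ).comp
      (ContinuousLinearMap.snd ℝ ℝ (ℂ × ℝ))))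
    refine h.unique ((q 1 0).congr_of_eventuallyEq (Filter.Eventually.of_forall fun t => ?_))
    simp [frame_eq]
  · have h := c ((ContinuousLinearMap.snd ℝ ℂ ℝ).comp (ContinuousLinearMap.snd ℝ ℝ (ℂ × ℝ)))
    have h2 := (((e 0 0).mul (q 0 1)).add ((e 0 1).mul (q 0 0))).add
      (((e 1 0).mul (q 1 1)).add ((e 1 1).mul (q 1 0)))
    have h3 := h.unique (h2.congr_of_eventuallyEq (Filter.Eventually.of_forall fun t => by
      simp [frame_eq]))
    simp only [hx] at h3
    exact h3

theorem frameMatrix_bracket (k l : Fin 4) (i j : Fin 2) :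
    frameMatrix k i 0 * frameMatrix l 0 j + frameMatrix k i 1 * frameMatrix l 1 j
      - (frameMatrix l i 0 * frameMatrix k 0 j + frameMatrix l i 1 * frameMatrix k 1 j) =
      ∑ n, bracketCoeff (Pi.single k 1) (Pi.single l 1) n * frameMatrix n i j := by
  rw [Fin.sum_univ_four]
  fin_cases k <;> fin_cases l <;> simp [bracketCoeff, frameMatrix] <;>
    fin_cases i <;> fin_cases j <;> simp <;> norm_num

/-- In the last coordinate the products of entries of x fₖ and x f_l are symmetric in k and l and
cancel. What remains is the tangent vector with matrix x(fₖ f_l - f_l fₖ). -/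
theorem dVec_frame_sub (k l : Fin 4) (x : G) :
    dVec IG (frame l) x (frame k x) - dVec IG (frame k) x (frame l x) =
      ∑ n, bracketCoeff (Pi.single k 1) (Pi.single l 1) n • frame n x := by
  have h := frameMatrix_bracket k l
  have ht : bracketCoeff (Pi.single k 1) (Pi.single l 1) 0 = 0 := rfl
  rw [dVec_frame_frame, dVec_frame_frame]
  simp only [Fin.sum_univ_four, frame_eq] at h ⊢
  generalize bracketCoeff (Pi.single k 1) (Pi.single l 1) = b at h ht ⊢
  refine Prod.ext ?_ (Prod.ext (Complex.ext ?_ ?_) ?_)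
  · simp [frameTime, ht]
  · simp only [Prod.fst_sub, Prod.snd_sub, Complex.sub_re, Prod.fst_add, Prod.snd_add,
      Complex.add_re, Prod.smul_fst, Prod.smul_snd, Complex.real_smul, Complex.re_ofReal_mul]
    linear_combination x.2 0 0 * h 0 0 + x.2 0 1 * h 1 0
  · simp only [Prod.fst_sub, Prod.snd_sub, Complex.sub_im, Prod.fst_add, Prod.snd_add,
      Complex.add_im, Prod.smul_fst, Prod.smul_snd, Complex.real_smul, Complex.im_ofReal_mul]
    linear_combination x.2 1 0 * h 0 0 + x.2 1 1 * h 1 0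
  · simp only [Prod.snd_sub, Prod.snd_add, Prod.smul_snd, smul_eq_mul]
    linear_combination x.2 0 0 * (x.2 0 0 * h 0 1 + x.2 0 1 * h 1 1) +
      x.2 0 1 * (x.2 0 0 * h 0 0 + x.2 0 1 * h 1 0) +
      (x.2 1 0 * (x.2 1 0 * h 0 1 + x.2 1 1 * h 1 1) +
      x.2 1 1 * (x.2 1 0 * h 0 0 + x.2 1 1 * h 1 0))

theorem dVec_smul_frame {a : G → ℝ} {x : G} (ha : MDifferentiableAt IG 𝓘(ℝ, ℝ) a x) (l : Fin 4)
    (u : ℝ × (ℂ × ℝ)) :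
    dVec IG (fun y => a y • frame l y) x u =
      dVec IG a x u • frame l x + a x • dVec IG (frame l) x u := by
  have hl : MDifferentiableAt IG 𝓘(ℝ, ℝ × (ℂ × ℝ)) (frame l) x :=
    (contMDiff_frame l).mdifferentiableAt (by simp)
  have h := mvfderiv_smul (I := IG) ha hl
  have h2 : dVec IG (fun y => a y • frame l y) x u =
    a x • dVec IG (frame l) x u + dVec IG a x u • frame l x := DFunLike.congr_fun h u
  rw [h2, add_comm]

theorem coeff_sum {ι : Type*} (s : Finset ι) (n : Fin 4) (x : G) (u : ι → ℝ × (ℂ × ℝ)) :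
    coeff n x (∑ i ∈ s, u i) = ∑ i ∈ s, coeff n x (u i) := by
  simp [coeff]

theorem contMDiff_coeff {Y : G → ℝ × (ℂ × ℝ)} (hY : ContMDiff IG 𝓘(ℝ, ℝ × (ℂ × ℝ)) ∞ Y)
    (l : Fin 4) : ContMDiff IG 𝓘(ℝ, ℝ) ∞ (fun y => coeff l y (Y y)) :=
  SmoothField.contMDiff_coeff ((smoothField_iff_of_const_chart g_chartAt_eq _).2 hY) l

/-- This is the Leibniz rule for Y = Σ Yˡ f_l: the derivatives of the coefficients, plus a term that
is tensorial in Y and in u. -/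
theorem coeff_dVec_field {Y : G → ℝ × (ℂ × ℝ)}
    (hY : ContMDiff IG 𝓘(ℝ, ℝ × (ℂ × ℝ)) ∞ Y) (x : G) (u : ℝ × (ℂ × ℝ))
    (n : Fin 4) :
    coeff n x (dVec IG Y x u) =
      dVec IG (fun y => coeff n y (Y y)) x u +
        ∑ l, coeff l x (Y x) * ∑ k, coeff k x u * coeff n x (dVec IG (frame l) x (frame k x)) := by
  have hc : ∀ l, MDifferentiableAt IG 𝓘(ℝ, ℝ) (fun y => coeff l y (Y y)) x := fun l =>
    (contMDiff_coeff hY l).mdifferentiableAt (by simp)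
  have hadd : ∀ {p q : G → ℝ × (ℂ × ℝ)}, MDifferentiableAt IG 𝓘(ℝ, ℝ × (ℂ × ℝ)) p x →
      MDifferentiableAt IG 𝓘(ℝ, ℝ × (ℂ × ℝ)) q x →
      MDifferentiableAt IG 𝓘(ℝ, ℝ × (ℂ × ℝ)) (fun y => p y + q y) x := fun hp hq => hp.add hq
  have hcl : ∀ l, MDifferentiableAt IG 𝓘(ℝ, ℝ × (ℂ × ℝ))
      (fun y => coeff l y (Y y) • frame l y) x := fun l =>
    ((contMDiff_coeff hY l).smul (contMDiff_frame l)).mdifferentiableAt (by simp)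
  have e : Y = fun y => coeff 0 y (Y y) • frame 0 y +
      coeff 1 y (Y y) • frame 1 y + coeff 2 y (Y y) • frame 2 y + coeff 3 y (Y y) • frame 3 y := by
    funext y
    conv_lhs => rw [← sum_coeff y (Y y), Fin.sum_univ_four]
  have hl : ∀ l, dVec IG (frame l) x u = ∑ k, coeff k x u • dVec IG (frame l) x (frame k x) := by
    intro l
    conv_lhs => rw [← sum_coeff x u]
    simp only [map_sum, map_smul]
  have hd : dVec IG Y x u =
      ∑ l, (dVec IG (fun y => coeff l y (Y y)) x u • frame l x +
        coeff l x (Y x) • dVec IG (frame l) x u) := by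
    conv_lhs => rw [e]
    rw [dVec_add (hadd (hadd (hcl 0) (hcl 1)) (hcl 2)) (hcl 3),
      dVec_add (hadd (hcl 0) (hcl 1)) (hcl 2), dVec_add (hcl 0) (hcl 1), Fin.sum_univ_four]
    simp only [dVec_smul_frame (hc _)]
  rw [hd, coeff_sum]
  simp only [coeff_add, coeff_smul, hl, coeff_sum, coeff_frame, Finset.sum_add_distrib, mul_ite,
    mul_one, mul_zero, Finset.sum_ite_eq', Finset.mem_univ, if_true]

theorem sum_bracketCoeff (a b : Fin 4 → ℝ) (n : Fin 4) :
    ∑ k, ∑ l, a k * b l * bracketCoeff (Pi.single k 1) (Pi.single l 1) n = bracketCoeff a b n := by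
  simp only [Fin.sum_univ_four]
  fin_cases n <;> simp [bracketCoeff] <;> ring

/-- The Lie bracket of vector fields on `G` in terms of coordinate expressions. -/
def coordBracket (X Y : G → ℝ × (ℂ × ℝ)) (x : G) : ℝ × (ℂ × ℝ) :=
  dVec IG Y x (X x) - dVec IG X x (Y x)

/-- The coefficients of the Lie bracket with respect to the left-invariant frame. -/
theorem coeff_coordBracket {X Y : G → ℝ × (ℂ × ℝ)} (hX : ContMDiff IG 𝓘(ℝ, ℝ × (ℂ × ℝ)) ∞ X)
    (hY : ContMDiff IG 𝓘(ℝ, ℝ × (ℂ × ℝ)) ∞ Y) (x : G) (n : Fin 4) :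
    coeff n x (coordBracket X Y x) =
      dVec IG (fun y => coeff n y (Y y)) x (X x) - dVec IG (fun y => coeff n y (X y)) x (Y x) +
        bracketCoeff (fun k => coeff k x (X x)) (fun k => coeff k x (Y x)) n := by
  rw [coordBracket, coeff_sub, coeff_dVec_field hX, coeff_dVec_field hY]
  -- The tensorial terms enter antisymmetrized, and therefore only through the structure constants.
  have hs : ∀ k l, coeff n x (dVec IG (frame l) x (frame k x)) -
      coeff n x (dVec IG (frame k) x (frame l x)) =
        bracketCoeff (Pi.single k 1) (Pi.single l 1) n := by
    intro k l
    rw [← coeff_sub, dVec_frame_sub, coeff_sum]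
    simp only [coeff_smul, coeff_frame, mul_ite, mul_one, mul_zero, Finset.sum_ite_eq',
      Finset.mem_univ, if_true]
  rw [← sum_bracketCoeff]
  simp only [← hs, Fin.sum_univ_four]
  ring

theorem contMDiff_coordBracket {X Y : G → ℝ × (ℂ × ℝ)} (hX : ContMDiff IG 𝓘(ℝ, ℝ × (ℂ × ℝ)) ∞ X)
    (hY : ContMDiff IG 𝓘(ℝ, ℝ × (ℂ × ℝ)) ∞ Y) :
    ContMDiff IG 𝓘(ℝ, ℝ × (ℂ × ℝ)) ∞ (coordBracket X Y) := by
  have h : ∀ {X : G → ℝ × (ℂ × ℝ)}, ContMDiff IG 𝓘(ℝ, ℝ × (ℂ × ℝ)) ∞ X →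
      SmoothField IG (M := G) X := (smoothField_iff_of_const_chart g_chartAt_eq _).2
  exact ((h hX).contMDiff_dVec hY).sub ((h hY).contMDiff_dVec hX)

/-- The Nijenhuis tensor of `J` vanishes. -/
theorem jMap_coordBracket {X Y X' Y' : G → ℝ × (ℂ × ℝ)}
    (hX : ContMDiff IG 𝓘(ℝ, ℝ × (ℂ × ℝ)) ∞ X) (hY : ContMDiff IG 𝓘(ℝ, ℝ × (ℂ × ℝ)) ∞ Y)
    (hX' : ContMDiff IG 𝓘(ℝ, ℝ × (ℂ × ℝ)) ∞ X') (hY' : ContMDiff IG 𝓘(ℝ, ℝ × (ℂ × ℝ)) ∞ Y')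
    (hJ : ∀ x, jMap x (X x) = -(Y x)) (hJ' : ∀ x, jMap x (X' x) = -(Y' x)) (x : G) :
    jMap x (coordBracket X X' x - coordBracket Y Y' x) =
      -(coordBracket X Y' x + coordBracket Y X' x) := by
  -- The condition JX = -Y expresses the coefficients of Y by those of X, namely (X₁, -X₀, X₃, -X₂).
  have hc : ∀ {X Y : G → ℝ × (ℂ × ℝ)}, (∀ x, jMap x (X x) = -(Y x)) → ∀ x,
      coeff 0 x (Y x) = coeff 1 x (X x) ∧ coeff 1 x (Y x) = -coeff 0 x (X x) ∧
      coeff 2 x (Y x) = coeff 3 x (X x) ∧ coeff 3 x (Y x) = -coeff 2 x (X x) := by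
    intro X Y hJ x
    obtain ⟨k0, k1, k2, k3⟩ := coeff_jMap x (X x)
    rw [hJ, coeff_neg] at k0 k1 k2 k3
    refine ⟨?_, ?_, ?_, ?_⟩ <;> linarith
  have e0 := fun x => (hc hJ x).1
  have e1 := fun x => (hc hJ x).2.1
  have e2 := fun x => (hc hJ x).2.2.1
  have e3 := fun x => (hc hJ x).2.2.2
  have e0' := fun x => (hc hJ' x).1
  have e1' := fun x => (hc hJ' x).2.1
  have e2' := fun x => (hc hJ' x).2.2.1
  have e3' := fun x => (hc hJ' x).2.2.2
  obtain ⟨k0, k1, k2, k3⟩ := coeff_jMap x (coordBracket X X' x - coordBracket Y Y' x)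
  refine coeff_ext (x := x) (forall_fin_four (k0.trans ?_) (k1.trans ?_) (k2.trans ?_)
    (k3.trans ?_)) <;>
  -- After elimination of Y and Y' the derivatives of coefficients cancel, as J has constant
  -- coefficients; the rest is an identity for the structure constants.
  · simp only [coeff_neg, coeff_add, coeff_sub, coeff_coordBracket hX hX', coeff_coordBracket hY hY',
      coeff_coordBracket hX hY', coeff_coordBracket hY hX', e0, e1, e2, e3, e0', e1', e2', e3',
      dVec_neg]
    simp [bracketCoeff, e1, e2, e3, e1', e2', e3']
    ring

theorem isIntegrable_J : IsIntegrable IG J := by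
  rintro X Y X' Y' ⟨hX, hY, hJ, -⟩ ⟨hX', hY', hJ', -⟩
  have hb : ∀ {X Y : VField IG G}, SmoothField IG X → SmoothField IG Y → ∀ x,
      (VectorField.mlieBracket IG X Y x : ℝ × (ℂ × ℝ)) = coordBracket X Y x := fun hX hY x =>
    mlieBracket_of_const_chart g_chartAt_eq hX hY x
  have hi : ∀ {X : VField IG G}, SmoothField IG X ↔ ContMDiff IG 𝓘(ℝ, ℝ × (ℂ × ℝ)) ∞ X :=
    smoothField_iff_of_const_chart g_chartAt_eq _
  have h1 : (fun x => VectorField.mlieBracket IG X X' x - VectorField.mlieBracket IG Y Y' x) =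
      fun x => (coordBracket X X' x - coordBracket Y Y' x : ℝ × (ℂ × ℝ)) := by
    funext x
    exact congrArg₂ (fun u v : ℝ × (ℂ × ℝ) => u - v) (hb hX hX' x) (hb hY hY' x)
  have h2 : (fun x => VectorField.mlieBracket IG X Y' x + VectorField.mlieBracket IG Y X' x) =
      fun x => (coordBracket X Y' x + coordBracket Y X' x : ℝ × (ℂ × ℝ)) := by
    funext x
    exact congrArg₂ (fun u v : ℝ × (ℂ × ℝ) => u + v) (hb hX hY' x) (hb hY hX' x)
  have key := jMap_coordBracket (hi.1 hX) (hi.1 hY) (hi.1 hX') (hi.1 hY') hJ hJ'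
  rw [h1, h2]
  refine ⟨hi.2 ((contMDiff_coordBracket (hi.1 hX) (hi.1 hX')).sub
    (contMDiff_coordBracket (hi.1 hY) (hi.1 hY'))), hi.2 ((contMDiff_coordBracket (hi.1 hX)
    (hi.1 hY')).add (contMDiff_coordBracket (hi.1 hY) (hi.1 hX'))), key, fun x => ?_⟩
  -- Of the two conditions for type (1,0), the second follows from the first by applying J.
  have e : ∀ u v : ℝ × (ℂ × ℝ), jMap x u = -v → jMap x v = u := by
    intro u v huv
    have h := jMap_jMap x u
    rw [huv, map_neg] at h
    exact neg_injective h
  exact e _ _ (key x)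

theorem isNeutral_gG : IsNeutral IG gG := by
  intro x
  -- P is the span of f₂, f₃, on which the metric is positive, and Q is the span of f₀, f₁, on which
  -- it is negative.
  let P : Submodule ℝ (ℝ × (ℂ × ℝ)) :=
    LinearMap.ker ((frameBasis x).coord 0) ⊓ LinearMap.ker ((frameBasis x).coord 1)
  let Q : Submodule ℝ (ℝ × (ℂ × ℝ)) :=
    LinearMap.ker ((frameBasis x).coord 2) ⊓ LinearMap.ker ((frameBasis x).coord 3)
  have hP : ∀ u, u ∈ P ↔ coeff 0 x u = 0 ∧ coeff 1 x u = 0 := fun u => Iff.rfl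
  have hQ : ∀ u, u ∈ Q ↔ coeff 2 x u = 0 ∧ coeff 3 x u = 0 := fun u => Iff.rfl
  have h0 : ∀ k, coeff k x 0 = 0 := fun k => by simp [coeff]
  have zero : ∀ u, u ∈ P → u ∈ Q → u = 0 := fun u h1 h2 =>
    coeff_ext (x := x) (forall_fin_four (((hP u).1 h1).1.trans (h0 0).symm)
      (((hP u).1 h1).2.trans (h0 1).symm) (((hQ u).1 h2).1.trans (h0 2).symm)
      (((hQ u).1 h2).2.trans (h0 3).symm))
  have hpos : ∀ u ∈ P, u ≠ 0 → 0 < gForm x u u := by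
    intro u hu hne
    obtain ⟨c0, c1⟩ := (hP u).1 hu
    rw [gForm_coeff, c0, c1]
    by_cases h2 : coeff 2 x u = 0
    · have h3 : coeff 3 x u ≠ 0 := fun h3 => hne (zero u hu ((hQ u).2 ⟨h2, h3⟩))
      nlinarith [mul_self_pos.2 h3, mul_self_nonneg (coeff 2 x u)]
    · nlinarith [mul_self_pos.2 h2, mul_self_nonneg (coeff 3 x u)]
  have hneg : ∀ u ∈ Q, u ≠ 0 → gForm x u u < 0 := by
    intro u hu hne
    obtain ⟨c0, c1⟩ := (hQ u).1 hu
    rw [gForm_coeff, c0, c1]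
    by_cases h2 : coeff 0 x u = 0
    · have h3 : coeff 1 x u ≠ 0 := fun h3 => hne (zero u ((hP u).2 ⟨h2, h3⟩) hu)
      nlinarith [mul_self_pos.2 h3, mul_self_nonneg (coeff 0 x u)]
    · nlinarith [mul_self_pos.2 h2, mul_self_nonneg (coeff 1 x u)]
  have hcompl : IsCompl P Q := by
    refine IsCompl.of_eq ?_ ?_
    · rw [Submodule.eq_bot_iff]
      exact fun u hu => zero u hu.1 hu.2
    · rw [Submodule.eq_top_iff']
      intro u
      have h := sum_coeff x u
      rw [Fin.sum_univ_four] at h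
      rw [← h, add_assoc, add_comm]
      refine Submodule.add_mem_sup ?_ ?_
      · rw [hP]
        constructor <;> simp [coeff_add, coeff_smul, coeff_frame]
      · rw [hQ]
        constructor <;> simp [coeff_add, coeff_smul, coeff_frame]
  have hrank : Module.finrank ℝ P = Module.finrank ℝ Q := by
    -- J̃ is an involution that interchanges P and Q, so their dimensions agree.
    let e : (ℝ × (ℂ × ℝ)) ≃ₗ[ℝ] (ℝ × (ℂ × ℝ)) := LinearEquiv.ofInvolutive (jMap' x) (jMap'_jMap' x)
    have hm : P.map e.toLinearMap = Q := by
      ext u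
      rw [Submodule.mem_map_equiv, hP, hQ]
      have hu : e.symm u = jMap' x u := rfl
      obtain ⟨k0, k1, -, -⟩ := coeff_jMap' x u
      rw [hu, k0, k1, neg_eq_zero]
    rw [← hm]
    exact (LinearEquiv.finrank_map_eq e P).symm
  exact ⟨P, Q, hcompl, hrank, hpos, hneg⟩

theorem isHermitian_J : IsHermitian IG gG J where
  metric := isPseudoRiemannianMetric_gG
  smooth := smoothEnd_J
  sq x u := jMap_jMap x u
  compat x u v := gForm_jMap x u v
  integrable := isIntegrable_J

theorem isParaHermitian_J' : IsParaHermitian IG gG J' where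
  metric := isPseudoRiemannianMetric_gG
  neutral := isNeutral_gG
  smooth := smoothEnd_J'
  sq x u := jMap'_jMap' x u
  compat x u v := gForm_jMap' x u v

theorem isParaHermitian_J'' : IsParaHermitian IG gG J'' where
  metric := isPseudoRiemannianMetric_gG
  neutral := isNeutral_gG
  smooth X hX := smoothEnd_J _ (smoothEnd_J' X hX)
  sq x u := by
    have h : ∀ u, jMap x (jMap' x (jMap x (jMap' x u))) = u := by
      intro u
      rw [jMap'_jMap, map_neg, jMap_jMap, neg_neg, jMap'_jMap']
    exact h u
  compat x u v := (gForm_jMap x (jMap' x u) (jMap' x v)).trans (gForm_jMap' x u v)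

theorem isParaQuaternion_J : IsParaQuaternion IG gG J J' J'' where
  herm := isHermitian_J
  para₂ := isParaHermitian_J'
  para₃ := isParaHermitian_J''
  mul₁₂ _ _ := rfl
  mul₂₁ x u := jMap'_jMap x u
  mul₂₃ x u := by
    have h : ∀ u, jMap' x (jMap x (jMap' x u)) = -jMap x u := by
      intro u
      rw [jMap'_jMap, jMap'_jMap']
    exact h u
  mul₃₂ x u := congrArg (jMap x) (jMap'_jMap' x u)
  mul₃₁ x u := by
    have h : ∀ u, jMap x (jMap' x (jMap x u)) = jMap' x u := by
      intro u
      rw [jMap'_jMap, map_neg, jMap_jMap, neg_neg]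
    exact h u
  mul₁₃ x u := jMap_jMap x (jMap' x u)

end Structures





/-! ### Constant curvature in coordinates -/

section Curvature

/-- Since U is open, the derivatives of the metric at points of U depend only on its values in U. -/
theorem HasConstantCurvatureOn.congr {E : Type*} [NormedAddCommGroup E] [NormedSpace ℝ E]
    {U : Set E} (hU : IsOpen U) {B B' : E → LinearMap.BilinForm ℝ E} {κ : ℝ}
    (h : HasConstantCurvatureOn U B κ) (hB : ∀ y ∈ U, B' y = B y) :
    HasConstantCurvatureOn U B' κ := by
  obtain ⟨Γ, h1, h2, h3⟩ := h
  have hf : ∀ y ∈ U, ∀ v w, fderiv ℝ (fun z => B' z v w) y = fderiv ℝ (fun z => B z v w) y := by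
    intro y hy v w
    apply Filter.EventuallyEq.fderiv_eq
    filter_upwards [hU.mem_nhds hy] with z hz
    rw [hB z hz]
  refine ⟨Γ, h1, fun y hy u v w => ?_, fun y hy u v => ?_⟩
  · rw [hB y hy, hf y hy, hf y hy, hf y hy, h2 y hy]
  · rw [hB y hy, h3 y hy]

theorem differentiableAt_smul_const {E F : Type*} [NormedAddCommGroup E] [NormedSpace ℝ E]
    [NormedAddCommGroup F] [NormedSpace ℝ F] {s : E → ℝ} {y : E} (hs : DifferentiableAt ℝ s y)
    (T : F) : DifferentiableAt ℝ (fun z => s z • T) y :=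
  hs.smul_const T

/-- The metric `(dx² + dy²) / (4 y²)` in the coordinate of `ℂ`. -/
def halfPlaneForm (z : ℂ) : LinearMap.BilinForm ℝ ℂ := (1 / (4 * z.im ^ 2)) • innerₗ ℂ

theorem halfPlaneForm_apply (z u v : ℂ) :
    halfPlaneForm z u v = 1 / (4 * z.im ^ 2) * (u.re * v.re + u.im * v.im) := by
  have h : halfPlaneForm z u v = 1 / (4 * z.im ^ 2) * inner ℝ u v := rfl
  rw [h, Complex.inner, Complex.mul_re, Complex.conj_re, Complex.conj_im]
  ring

/-- The Christoffel symbols of the upper half-plane, up to the factor `-1 / y`. -/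
def halfPlaneTensor : ℂ →L[ℝ] ℂ →L[ℝ] ℂ :=
  Complex.imCLM.smulRight (ContinuousLinearMap.id ℝ ℂ) +
    ContinuousLinearMap.smulRightL ℝ ℂ ℂ Complex.imCLM -
    (Complex.reCLM.smulRight (Complex.reCLM.smulRight Complex.I) +
      Complex.imCLM.smulRight (Complex.imCLM.smulRight Complex.I))

theorem halfPlaneTensor_apply (u v : ℂ) : halfPlaneTensor u v =
    (⟨u.im * v.re + v.im * u.re, u.im * v.im - u.re * v.re⟩ : ℂ) := by
  apply Complex.ext
  · simp [halfPlaneTensor]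
    try ring
  · simp [halfPlaneTensor]
    try ring

/-- The factor 1/4 does not change the Levi-Civita connection of the hyperbolic metric and
multiplies its curvature -1 by 4. The connection `-(1/y) halfPlaneTensor` is inserted in the Koszul
formula and in the curvature. -/
theorem hasConstantCurvatureOn_halfPlaneForm :
    HasConstantCurvatureOn {z : ℂ | 0 < z.im} halfPlaneForm (-4) := by
  have him : ∀ y : ℂ, HasFDerivAt (fun z : ℂ => z.im) Complex.imCLM y :=
    fun y => Complex.imCLM.hasFDerivAt
  have hinv : ∀ y : ℂ, 0 < y.im → HasFDerivAt (fun z : ℂ => -(z.im)⁻¹)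
      (-((-(y.im ^ 2)⁻¹) • Complex.imCLM)) y := fun y hy =>
    ((hasDerivAt_inv hy.ne').comp_hasFDerivAt y (him y)).neg
  have hB : ∀ y : ℂ, 0 < y.im → ∀ u v w : ℂ,
      fderiv ℝ (fun z => halfPlaneForm z v w) y u =
        -(u.im / (2 * y.im ^ 3)) * (v.re * w.re + v.im * w.im) := by
    intro y hy u v w
    have h1 : HasDerivAt (fun t : ℝ => 1 / (4 * t ^ 2)) (-(1 / (2 * y.im ^ 3))) y.im := by
      have h := ((hasDerivAt_pow 2 y.im).const_mul 4).inv (by positivity)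
      simp only [← one_div] at h
      refine h.congr_deriv ?_
      field_simp
      norm_num
      try ring
    have h2 := (h1.comp_hasFDerivAt y (him y)).mul_const (v.re * w.re + v.im * w.im)
    have h3 : HasFDerivAt (fun z => halfPlaneForm z v w) _ y :=
      h2.congr_of_eventuallyEq (Filter.Eventually.of_forall fun z => halfPlaneForm_apply z v w)
    rw [h3.fderiv]
    simp
    field_simp
  have hΓ : ∀ y : ℂ, 0 < y.im → ∀ u v w : ℂ,
      fderiv ℝ (fun z : ℂ => (-(z.im)⁻¹ • halfPlaneTensor) v w) y u =
        (u.im / y.im ^ 2) • halfPlaneTensor v w := by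
    intro y hy u v w
    have h : HasFDerivAt (fun z : ℂ => (-(z.im)⁻¹ • halfPlaneTensor) v w) _ y :=
      (hinv y hy).smul_const (halfPlaneTensor v w)
    rw [h.fderiv]
    simp
    left
    field_simp
  refine ⟨fun z => -(z.im)⁻¹ • halfPlaneTensor, fun y hy => ?_, fun y hy u v w => ?_,
    fun y hy u v => ?_⟩
  · exact (differentiableAt_smul_const (hinv y hy).differentiableAt
      halfPlaneTensor).differentiableWithinAt
  · have hy' : y.im ≠ 0 := ne_of_gt hy
    rw [hB y hy, hB y hy, hB y hy, halfPlaneForm_apply]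
    simp [halfPlaneTensor_apply]
    field_simp
    ring
  · have hy' : y.im ≠ 0 := ne_of_gt hy
    rw [hΓ y hy, hΓ y hy]
    simp only [halfPlaneForm_apply, smul_apply, halfPlaneTensor_apply,
      Complex.add_re, Complex.add_im, Complex.sub_re, Complex.sub_im, Complex.smul_re,
      Complex.smul_im, smul_eq_mul]
    field_simp
    ring

/-- The metric `-cosh² s dθ² + ds² / 4` in the coordinates `(θ, s)` of the cylinder. -/
def cylinderForm (y : EuclideanSpace ℝ (Fin 1) × ℝ) :
    LinearMap.BilinForm ℝ (EuclideanSpace ℝ (Fin 1) × ℝ) :=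
  let p : (EuclideanSpace ℝ (Fin 1) × ℝ) →ₗ[ℝ] ℝ :=
    (EuclideanSpace.proj (0 : Fin 1) : EuclideanSpace ℝ (Fin 1) →L[ℝ] ℝ).toLinearMap ∘ₗ
      LinearMap.fst ℝ (EuclideanSpace ℝ (Fin 1)) ℝ
  let q : (EuclideanSpace ℝ (Fin 1) × ℝ) →ₗ[ℝ] ℝ := LinearMap.snd ℝ (EuclideanSpace ℝ (Fin 1)) ℝ
  (-(Real.cosh y.2 ^ 2)) • (LinearMap.mul ℝ ℝ).compl₁₂ p p +
    (1 / 4 : ℝ) • (LinearMap.mul ℝ ℝ).compl₁₂ q q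

theorem cylinderForm_apply (y u v : EuclideanSpace ℝ (Fin 1) × ℝ) :
    cylinderForm y u v = -(Real.cosh y.2 ^ 2) * (u.1 0 * v.1 0) + 1 / 4 * (u.2 * v.2) := rfl

/-- The projection of the model space of the cylinder onto the angular coordinate. -/
def angleCLM : (EuclideanSpace ℝ (Fin 1) × ℝ) →L[ℝ] ℝ :=
  (EuclideanSpace.proj (0 : Fin 1)).comp (ContinuousLinearMap.fst ℝ (EuclideanSpace ℝ (Fin 1)) ℝ)

/-- The projection of the model space of the cylinder onto the linear coordinate. -/
def heightCLM : (EuclideanSpace ℝ (Fin 1) × ℝ) →L[ℝ] ℝ :=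
  ContinuousLinearMap.snd ℝ (EuclideanSpace ℝ (Fin 1)) ℝ

/-- The two parts of the Christoffel symbols of the cylinder. -/
def cylinderTensor₁ : (EuclideanSpace ℝ (Fin 1) × ℝ) →L[ℝ] (EuclideanSpace ℝ (Fin 1) × ℝ) →L[ℝ]
    (EuclideanSpace ℝ (Fin 1) × ℝ) :=
  heightCLM.smulRight (angleCLM.smulRight (EuclideanSpace.single 0 1, 0)) +
    angleCLM.smulRight (heightCLM.smulRight (EuclideanSpace.single 0 1, 0))

/-- The second part of the Christoffel symbols of the cylinder. -/
def cylinderTensor₂ : (EuclideanSpace ℝ (Fin 1) × ℝ) →L[ℝ] (EuclideanSpace ℝ (Fin 1) × ℝ) →L[ℝ]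
    (EuclideanSpace ℝ (Fin 1) × ℝ) :=
  angleCLM.smulRight (angleCLM.smulRight (0, 4))

theorem cylinderTensor₁_apply (u v : EuclideanSpace ℝ (Fin 1) × ℝ) :
    (cylinderTensor₁ u v).1 0 = u.2 * v.1 0 + u.1 0 * v.2 ∧ (cylinderTensor₁ u v).2 = 0 := by
  simp [cylinderTensor₁, angleCLM, heightCLM]

theorem cylinderTensor₂_apply (u v : EuclideanSpace ℝ (Fin 1) × ℝ) :
    (cylinderTensor₂ u v).1 0 = 0 ∧ (cylinderTensor₂ u v).2 = 4 * (u.1 0 * v.1 0) := by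
  simp [cylinderTensor₂, angleCLM]
  ring

/-- With r = s/2 the metric is dr² - φ(r)² dθ² for φ(r) = cosh 2r, of curvature -φ''/φ = -4. In the
coordinates (θ, s) the nonzero Christoffel symbols are tanh s for the mixed pair (θ, s) in direction
θ, and 4 cosh s sinh s for (θ, θ) in direction s; these give the two tensors and their coefficients.
-/
theorem hasConstantCurvatureOn_cylinderForm :
    HasConstantCurvatureOn Set.univ cylinderForm (-4) := by
  have hs : ∀ y : EuclideanSpace ℝ (Fin 1) × ℝ,
      HasFDerivAt (fun z : EuclideanSpace ℝ (Fin 1) × ℝ => z.2) heightCLM y :=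
    fun y => heightCLM.hasFDerivAt
  have hB : ∀ y u v w, fderiv ℝ (fun z => cylinderForm z v w) y u =
      -(2 * Real.cosh y.2 * Real.sinh y.2 * u.2) * (v.1 0 * w.1 0) := by
    intro y u v w
    have h1 : HasDerivAt (fun t : ℝ => -(Real.cosh t ^ 2)) (-(2 * Real.cosh y.2 * Real.sinh y.2)) y.2 := by
      have h := ((Real.hasDerivAt_cosh y.2).pow 2).neg
      refine h.congr_deriv ?_
      simp
    have h2 := ((h1.comp_hasFDerivAt y (hs y)).mul_const (v.1 0 * w.1 0)).add_const
      (1 / 4 * (v.2 * w.2))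
    have h3 : HasFDerivAt (fun z => cylinderForm z v w) _ y :=
      h2.congr_of_eventuallyEq (Filter.Eventually.of_forall fun z => cylinderForm_apply z v w)
    rw [h3.fderiv]
    simp [heightCLM]
    ring
  have hd1 : ∀ t : ℝ, HasDerivAt (fun t => Real.sinh t / Real.cosh t) (1 / Real.cosh t ^ 2) t := by
    intro t
    have h := (Real.hasDerivAt_sinh t).div (Real.hasDerivAt_cosh t) (Real.cosh_pos t).ne'
    refine h.congr_deriv ?_
    have := Real.cosh_sq t
    congr 1
    linarith
  have hd2 : ∀ t : ℝ, HasDerivAt (fun t => Real.cosh t * Real.sinh t)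
      (Real.cosh t ^ 2 + Real.sinh t ^ 2) t := by
    intro t
    refine ((Real.hasDerivAt_cosh t).mul (Real.hasDerivAt_sinh t)).congr_deriv ?_
    ring
  have hΓ : ∀ y u v w, fderiv ℝ (fun z : EuclideanSpace ℝ (Fin 1) × ℝ =>
        ((Real.sinh z.2 / Real.cosh z.2) • cylinderTensor₁ +
          (Real.cosh z.2 * Real.sinh z.2) • cylinderTensor₂) v w) y u =
      (u.2 / Real.cosh y.2 ^ 2) • cylinderTensor₁ v w +
        ((Real.cosh y.2 ^ 2 + Real.sinh y.2 ^ 2) * u.2) • cylinderTensor₂ v w := by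
    intro y u v w
    have h : HasFDerivAt (fun z : EuclideanSpace ℝ (Fin 1) × ℝ =>
        ((Real.sinh z.2 / Real.cosh z.2) • cylinderTensor₁ +
          (Real.cosh z.2 * Real.sinh z.2) • cylinderTensor₂) v w) _ y :=
      (((hd1 y.2).comp_hasFDerivAt y (hs y)).smul_const (cylinderTensor₁ v w)).add
        (((hd2 y.2).comp_hasFDerivAt y (hs y)).smul_const (cylinderTensor₂ v w))
    rw [h.fderiv]
    simp [heightCLM, div_eq_inv_mul]
  refine ⟨fun z => (Real.sinh z.2 / Real.cosh z.2) • cylinderTensor₁ +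
    (Real.cosh z.2 * Real.sinh z.2) • cylinderTensor₂, fun y _ => ?_, fun y _ u v w => ?_,
    fun y _ u v => ?_⟩
  · exact ((differentiableAt_smul_const ((hd1 y.2).comp_hasFDerivAt y (hs y)).differentiableAt
      cylinderTensor₁).add (differentiableAt_smul_const
        ((hd2 y.2).comp_hasFDerivAt y (hs y)).differentiableAt
        cylinderTensor₂)).differentiableWithinAt
  · have hc : Real.cosh y.2 ≠ 0 := (Real.cosh_pos _).ne'
    rw [hB, hB, hB, cylinderForm_apply]
    simp [cylinderTensor₁_apply, cylinderTensor₂_apply]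
    field_simp
    ring
  · have hc : Real.cosh y.2 ≠ 0 := (Real.cosh_pos _).ne'
    have hsq : Real.sinh y.2 ^ 2 = Real.cosh y.2 ^ 2 - 1 := by
      have := Real.cosh_sq y.2
      linarith
    rw [hΓ, hΓ]
    simp only [cylinderForm_apply]
    simp [cylinderTensor₁_apply, cylinderTensor₂_apply, hsq]
    field_simp
    simp only [hsq]
    ring

end Curvature

/-! ### Product metrics and the upper half-plane -/

section Bases

variable {E : Type*} [NormedAddCommGroup E] [NormedSpace ℝ E]
  {H : Type*} [TopologicalSpace H] {I : ModelWithCorners ℝ E H}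
  {M : Type*} [TopologicalSpace M] [ChartedSpace H M]
  {F : Type*} [NormedAddCommGroup F] [NormedSpace ℝ F]

theorem hasDerivAt_complexMk {a b : ℝ → ℝ} {a' b' t : ℝ} (ha : HasDerivAt a a' t)
    (hb : HasDerivAt b b' t) : HasDerivAt (fun s => (⟨a s, b s⟩ : ℂ)) ⟨a', b'⟩ t :=
  Complex.equivRealProdCLM.symm.hasFDerivAt.comp_hasDerivAt t (ha.prodMk hb)

/-- A derivative of a map on a vector space is computed along lines. -/
theorem dVec_eq_of_hasDerivAt_line {q : E → F} {y v : E} {w : F} (hq : DifferentiableAt ℝ q y)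
    (h : HasDerivAt (fun t : ℝ => q (y + t • v)) w 0) : dVec 𝓘(ℝ, E) q y v = w := by
  rw [dVec_eq_fderiv]
  have h1 : HasDerivAt (fun t : ℝ => y + t • v) v 0 := by
    simpa using ((hasDerivAt_id (0 : ℝ)).smul_const v).const_add y
  have h2 : HasFDerivAt q (fderiv ℝ q y) (y + (0 : ℝ) • v) := by
    simpa using hq.hasFDerivAt
  exact (h2.comp_hasDerivAt 0 h1).unique h

/-- A field of forms that is a multiple of the pull-back of a constant bilinear form is smooth. -/
theorem contMDiff_pullback_form [IsManifold I ∞ M] {q : M → F} (hq : ContMDiff I 𝓘(ℝ, F) ∞ q)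
    {ρ : M → ℝ} (hρ : ContMDiff I 𝓘(ℝ, ℝ) ∞ ρ) (b : F →L[ℝ] F →L[ℝ] ℝ) {X Y : VField I M}
    (hX : SmoothField I X) (hY : SmoothField I Y) :
    ContMDiff I 𝓘(ℝ, ℝ) ∞ (fun x => ρ x * b (dVec I q x (X x)) (dVec I q x (Y x))) :=
  hρ.mul ((b.contDiff.contMDiff.comp (hX.contMDiff_dVec hq)).clm_apply (hY.contMDiff_dVec hq))

theorem lineProd_apply (h : FormField I M) (x : ℝ × M) (u v : ℝ × E) :
    lineProd I h x u v = h x.2 u.2 v.2 - u.1 * v.1 := rfl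

theorem dVec_snd {q : M → F} {x : ℝ × M} (hq : MDifferentiableAt I 𝓘(ℝ, F) q x.2) (u : ℝ × E) :
    dVec (𝓘(ℝ, ℝ).prod I) (fun y : ℝ × M => q y.2) x u = dVec I q x.2 u.2 :=
  dMap_prod_snd hq u

theorem dVec_fst (x : ℝ × M) (u : ℝ × E) :
    dVec (𝓘(ℝ, ℝ).prod I) (fun y : ℝ × M => y.1) x u = u.1 := by
  have h := dMap_prod_fst (I := 𝓘(ℝ, ℝ)) (I' := I) (I'' := 𝓘(ℝ, ℝ)) (x := x) (q := fun t : ℝ => t)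
    mdifferentiableAt_id u
  refine h.trans ?_
  have h2 : dMap 𝓘(ℝ, ℝ) 𝓘(ℝ, ℝ) (fun t : ℝ => t) x.1 = ContinuousLinearMap.id ℝ ℝ := mfderiv_id
  rw [h2]
  rfl

/-- The second component of a field on ℝ × M also depends on the first variable, so smoothness of
`h` on fields of M does not apply to it directly. The representation `e` of `h` through a map to a
vector space makes sense on the product and gives smoothness there. -/
theorem isPseudoRiemannianMetric_lineProd [IsManifold I ∞ M] [IsManifold I 1 M]
    {h : FormField I M} (hh : IsPseudoRiemannianMetric I h)
    {q : M → F} (hq : ContMDiff I 𝓘(ℝ, F) ∞ q) {ρ : M → ℝ} (hρ : ContMDiff I 𝓘(ℝ, ℝ) ∞ ρ)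
    (b : F →L[ℝ] F →L[ℝ] ℝ)
    (e : ∀ (x : M) (u v : E), h x u v = ρ x * b (dVec I q x u) (dVec I q x v)) :
    IsPseudoRiemannianMetric (𝓘(ℝ, ℝ).prod I) (lineProd I h) where
  symm x u v := by
    refine (lineProd_apply h x u v).trans (Eq.trans ?_ (lineProd_apply h x v u).symm)
    exact congrArg₂ (fun a b : ℝ => a - b) (hh.symm x.2 u.2 v.2) (mul_comm (u.1 : ℝ) v.1)
  nondegenerate x := by
    constructor
    · intro u hu
      have h2 : (u.2 : E) = 0 := (hh.nondegenerate x.2).1 u.2 fun v => by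
        have h3 := (lineProd_apply h x u ((0, v) : ℝ × E)).symm.trans (hu ((0, v) : ℝ × E))
        have h4 : ∀ a b : ℝ, a - b * 0 = 0 → a = 0 := by intro a b; simp
        exact h4 _ _ h3
      have h1 : (u.1 : ℝ) = 0 := by
        have h3 := (lineProd_apply h x u ((1, 0) : ℝ × E)).symm.trans (hu ((1, 0) : ℝ × E))
        have h5 : h x.2 u.2 (0 : E) = 0 := map_zero (h x.2 u.2)
        have h4 : ∀ a b : ℝ, b = 0 → b - a * 1 = 0 → a = 0 := by
          intro a b hb hab
          linarith
        exact h4 _ _ h5 h3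
      exact Prod.ext h1 h2
    · intro u hu
      have h2 : (u.2 : E) = 0 := (hh.nondegenerate x.2).2 u.2 fun v => by
        have h3 := (lineProd_apply h x ((0, v) : ℝ × E) u).symm.trans (hu ((0, v) : ℝ × E))
        have h4 : ∀ a b : ℝ, a - 0 * b = 0 → a = 0 := by intro a b; simp
        exact h4 _ _ h3
      have h1 : (u.1 : ℝ) = 0 := by
        have h3 := (lineProd_apply h x ((1, 0) : ℝ × E) u).symm.trans (hu ((1, 0) : ℝ × E))
        have h5 : h x.2 (0 : E) u.2 = 0 :=
          DFunLike.congr_fun (map_zero (h x.2)) u.2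
        have h4 : ∀ a b : ℝ, b = 0 → b - 1 * a = 0 → a = 0 := by
          intro a b hb hab
          linarith
        exact h4 _ _ h5 h3
      exact Prod.ext h1 h2
  smooth X Y hX hY := by
    have h1 : ∀ {X : VField (𝓘(ℝ, ℝ).prod I) (ℝ × M)}, SmoothField (𝓘(ℝ, ℝ).prod I) X →
        ContMDiff (𝓘(ℝ, ℝ).prod I) 𝓘(ℝ, ℝ) ∞ (fun x => (X x : ℝ × E).1) := by
      intro X hX
      have h := hX.contMDiff_dVec (q := fun y : ℝ × M => y.1) contMDiff_fst
      exact h.congr fun x => (dVec_fst x (X x)).symm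
    have hq' : ContMDiff (𝓘(ℝ, ℝ).prod I) 𝓘(ℝ, F) ∞ (fun y : ℝ × M => q y.2) :=
      hq.comp contMDiff_snd
    have h2 := contMDiff_pullback_form hq' (hρ.comp contMDiff_snd) b hX hY
    refine (h2.sub ((h1 hX).mul (h1 hY))).congr fun x => ?_
    refine (lineProd_apply h x (X x) (Y x)).trans ?_
    refine congrArg (fun a : ℝ => a - (X x).1 * (Y x).1) ?_
    refine (e x.2 _ _).trans ?_
    have h3 := fun u : ℝ × E => (dVec_snd (x := x) (hq.mdifferentiableAt (by simp)) u).symm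
    exact congrArg₂ (fun u v : F => ρ x.2 * b u v) (h3 _) (h3 _)

/-! ### The upper half-plane -/

theorem contMDiff_coe_upperHalfPlane : ContMDiff 𝓘(ℝ, ℂ) 𝓘(ℝ, ℂ) ∞ ((↑) : ℍ → ℂ) :=
  contMDiff_isOpenEmbedding UpperHalfPlane.isOpenEmbedding_coe

theorem contMDiff_upperHalfPlane_of_coe {φ : M → ℍ}
    (h : ContMDiff I 𝓘(ℝ, ℂ) ∞ (fun x => (φ x : ℂ))) : ContMDiff I 𝓘(ℝ, ℂ) ∞ φ :=
  ContMDiff.of_comp_isOpenEmbedding UpperHalfPlane.isOpenEmbedding_coe h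

theorem dVec_coe_upperHalfPlane (z : ℍ) (u : ℂ) :
    dVec 𝓘(ℝ, ℂ) ((↑) : ℍ → ℂ) z u = u := by
  have h := dVec_extChartAt_of_const_chart (I := 𝓘(ℝ, ℂ)) (M := ℍ) (fun _ _ => rfl) z z
  exact DFunLike.congr_fun h u

theorem hyp02_eq (z : ℍ) (u v : ℂ) : hyp02 z u v = 1 / (4 * z.im ^ 2) *
    innerSL ℝ (dVec 𝓘(ℝ, ℂ) ((↑) : ℍ → ℂ) z u) (dVec 𝓘(ℝ, ℂ) ((↑) : ℍ → ℂ) z v) := by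
  rw [dVec_coe_upperHalfPlane, dVec_coe_upperHalfPlane]
  rfl

theorem contMDiff_hyp02_factor :
    ContMDiff 𝓘(ℝ, ℂ) 𝓘(ℝ, ℝ) ∞ (fun z : ℍ => 1 / (4 * z.im ^ 2)) := by
  have h := contMDiff_im contMDiff_coe_upperHalfPlane
  exact contMDiff_const.div₀ (contMDiff_const.mul (h.pow 2)) fun z => by
    have := z.im_pos
    positivity

theorem isPseudoRiemannianMetric_hyp02 : IsPseudoRiemannianMetric 𝓘(ℝ, ℂ) hyp02 where
  symm z u v := by
    refine (halfPlaneForm_apply z u v).trans (Eq.trans ?_ (halfPlaneForm_apply z v u).symm)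
    exact congrArg (fun a : ℝ => 1 / (4 * (z : ℂ).im ^ 2) * a)
      (congrArg₂ (fun a b : ℝ => a + b) (mul_comm (u.re : ℝ) v.re) (mul_comm (u.im : ℝ) v.im))
  nondegenerate z := by
    have hp : 0 < (1 / (4 * (z : ℂ).im ^ 2)) := by
      have := z.im_pos
      positivity
    have h0 : ∀ u : ℂ, halfPlaneForm z u u = 0 → u = 0 := by
      intro u hu
      rw [halfPlaneForm_apply] at hu
      have h1 : u.re * u.re + u.im * u.im = 0 := by
        rcases mul_eq_zero.1 hu with h | h
        · exact absurd h hp.ne'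
        · exact h
      apply Complex.ext <;> simp only [Complex.zero_re, Complex.zero_im] <;> nlinarith
    exact ⟨fun u hu => h0 u (hu u), fun u hu => h0 u (hu u)⟩
  smooth X Y hX hY := by
    refine (contMDiff_pullback_form contMDiff_coe_upperHalfPlane contMDiff_hyp02_factor
      (innerSL ℝ) hX hY).congr fun z => hyp02_eq z (X z) (Y z)

theorem isPseudoRiemannianMetric_lineProd_hyp02 :
    IsPseudoRiemannianMetric (𝓘(ℝ, ℝ).prod 𝓘(ℝ, ℂ)) (lineProd 𝓘(ℝ, ℂ) hyp02) :=
  isPseudoRiemannianMetric_lineProd isPseudoRiemannianMetric_hyp02 contMDiff_coe_upperHalfPlane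
    contMDiff_hyp02_factor (innerSL ℝ) hyp02_eq

theorem hasConstantSectionalCurvature_hyp02 :
    HasConstantSectionalCurvature 𝓘(ℝ, ℂ) hyp02 (-4) := by
  have hU : IsOpen {z : ℂ | 0 < z.im} := isOpen_lt continuous_const Complex.continuous_im
  have hs : ContMDiffOn 𝓘(ℝ, ℂ) 𝓘(ℝ, ℂ) ∞ UpperHalfPlane.ofComplex {z : ℂ | 0 < z.im} := by
    have h := contMDiffOn_isOpenEmbedding_symm (I := 𝓘(ℝ, ℂ)) (n := ∞)
      UpperHalfPlane.isOpenEmbedding_coe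
    refine ContMDiffOn.mono h fun z hz => ⟨⟨z, hz⟩, rfl⟩
  -- Near z the coercion composed with `ofComplex` is the identity, and the coercion itself has
  -- derivative the identity.
  have hd : ∀ z : ℂ, 0 < z.im → ∀ u : ℂ,
      dMap 𝓘(ℝ, ℂ) 𝓘(ℝ, ℂ) UpperHalfPlane.ofComplex z u = u := by
    intro z hz u
    have h1 : MDifferentiableAt 𝓘(ℝ, ℂ) 𝓘(ℝ, ℂ) UpperHalfPlane.ofComplex z :=
      ((hs z hz).contMDiffAt (hU.mem_nhds hz)).mdifferentiableAt (by simp)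
    have h2 := dVec_comp (contMDiff_coe_upperHalfPlane.mdifferentiableAt (by simp)) h1 u
    rw [dVec_coe_upperHalfPlane] at h2
    have h3 : fderiv ℝ (fun y => ((UpperHalfPlane.ofComplex y : ℍ) : ℂ)) z = fderiv ℝ id z :=
      (UpperHalfPlane.eventuallyEq_coe_comp_ofComplex hz).fderiv_eq (𝕜 := ℝ)
    rw [← h2, dVec_eq_fderiv, h3]
    simp
  intro x
  refine ⟨{z : ℂ | 0 < z.im}, UpperHalfPlane.ofComplex, hU,
    ⟨x, x.im_pos, UpperHalfPlane.ofComplex_apply x⟩, hs, fun y hy => ?_, ?_⟩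
  · have h : (dMap 𝓘(ℝ, ℂ) 𝓘(ℝ, ℂ) UpperHalfPlane.ofComplex y : ℂ → ℂ) = id :=
      funext fun u => hd y hy u
    have h2 : Function.Bijective (dMap 𝓘(ℝ, ℂ) 𝓘(ℝ, ℂ) UpperHalfPlane.ofComplex y : ℂ → ℂ) := by
      rw [h]; exact Function.bijective_id
    exact h2
  · refine HasConstantCurvatureOn.congr hU hasConstantCurvatureOn_halfPlaneForm fun y hy => ?_
    refine LinearMap.ext fun u => LinearMap.ext fun v => ?_
    have hy' : ((UpperHalfPlane.ofComplex y : ℍ) : ℂ) = y := by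
      rw [UpperHalfPlane.ofComplex_apply_of_im_pos hy]
    have h : ∀ w u' v' : ℂ, w = y → u' = u → v' = v →
        halfPlaneForm w u' v' = halfPlaneForm y u v := by
      rintro _ _ _ rfl rfl rfl
      rfl
    exact h _ _ _ hy' (hd y hy u) (hd y hy v)

end Bases

/-! ### The Lorentzian cylinder and its covering of the pseudo-sphere -/

section Cylinder

variable {E : Type*} [NormedAddCommGroup E] [NormedSpace ℝ E]
  {H : Type*} [TopologicalSpace H] {I : ModelWithCorners ℝ E H}
  {M : Type*} [TopologicalSpace M] [ChartedSpace H M]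

theorem contMDiff_coe_circle : ContMDiff (𝓡 1) 𝓘(ℝ, ℂ) ∞ (fun u : Circle => (u : ℂ)) :=
  haveI := finrank_real_complex_fact'
  contMDiff_coe_sphere (E := ℂ)

theorem contMDiff_circle_of_coe [IsManifold I ∞ M] {φ : M → Circle}
    (h : ContMDiff I 𝓘(ℝ, ℂ) ∞ (fun x => (φ x : ℂ))) : ContMDiff I (𝓡 1) ∞ φ :=
  haveI := finrank_real_complex_fact'
  h.codRestrict_sphere fun x => mem_sphere_zero_iff_norm.2 (Circle.norm_coe (φ x))

theorem contMDiff_complex_mul {p q : M → ℂ} (hp : ContMDiff I 𝓘(ℝ, ℂ) ∞ p)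
    (hq : ContMDiff I 𝓘(ℝ, ℂ) ∞ q) : ContMDiff I 𝓘(ℝ, ℂ) ∞ (fun x => p x * q x) :=
  (contDiff_mul (𝕜 := ℝ) (𝔸 := ℂ)).contMDiff.comp (hp.prodMk_space hq)

theorem contMDiff_ofReal {p : M → ℝ} (hp : ContMDiff I 𝓘(ℝ, ℝ) ∞ p) :
    ContMDiff I 𝓘(ℝ, ℂ) ∞ (fun x => (p x : ℂ)) :=
  Complex.ofRealCLM.contDiff.contMDiff.comp hp

theorem contMDiff_cover : ContMDiff IC 𝓘(ℝ, ℂ × ℝ) ∞ cover := by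
  have h1 : ContMDiff IC 𝓘(ℝ, ℂ) ∞ (fun p : Circle × ℝ => (p.1 : ℂ)) :=
    contMDiff_coe_circle.comp contMDiff_fst
  have h2 : ContMDiff IC 𝓘(ℝ, ℝ) ∞ (fun p : Circle × ℝ => Real.cosh p.2 / 2) :=
    (Real.contDiff_cosh.div_const 2).contMDiff.comp contMDiff_snd
  have h3 : ContMDiff IC 𝓘(ℝ, ℝ) ∞ (fun p : Circle × ℝ => Real.sinh p.2 / 2) :=
    (Real.contDiff_sinh.div_const 2).contMDiff.comp contMDiff_snd
  refine ((contMDiff_complex_mul (contMDiff_ofReal h2)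
    (contMDiff_complex_mul h1 h1)).prodMk_space h3).congr fun p => ?_
  simp only [cover, pow_two]

/-- The flat metric `-dx² - dy² + dz²` as a bilinear form. -/
def flatForm (u v : ℂ × ℝ) : ℝ := -(u.1.re * v.1.re + u.1.im * v.1.im) + u.2 * v.2

/-- The flat metric `-dx² - dy² + dz²` as a continuous bilinear map. -/
def flatCLM : (ℂ × ℝ) →L[ℝ] (ℂ × ℝ) →L[ℝ] ℝ :=
  let x := Complex.reCLM.comp (ContinuousLinearMap.fst ℝ ℂ ℝ)
  let y := Complex.imCLM.comp (ContinuousLinearMap.fst ℝ ℂ ℝ)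
  let z := ContinuousLinearMap.snd ℝ ℂ ℝ
  z.smulRight z - (x.smulRight x + y.smulRight y)

theorem flatCLM_apply (u v : ℂ × ℝ) : flatCLM u v = flatForm u v := by
  simp [flatCLM, flatForm]
  try ring

theorem flat21_apply (x u v : ℂ × ℝ) : flat21 x u v = flatForm u v := by
  have h : flat21 x u v = -(inner ℝ u.1 v.1) + u.2 * v.2 := rfl
  rw [h, Complex.inner, Complex.mul_re, Complex.conj_re, Complex.conj_im, flatForm]
  ring

theorem hyp11_apply (n : Circle × ℝ) (u v : EuclideanSpace ℝ (Fin 1) × ℝ) :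
    hyp11 n u v = flatForm (dVec IC cover n u) (dVec IC cover n v) :=
  flat21_apply (cover n) _ _

theorem hyp11_eq (n : Circle × ℝ) (u v : EuclideanSpace ℝ (Fin 1) × ℝ) :
    hyp11 n u v = 1 * flatCLM (dVec IC cover n u) (dVec IC cover n v) := by
  rw [one_mul, flatCLM_apply]
  exact hyp11_apply n u v

/-- The parametrization of the cylinder by its universal covering. -/
def cylinderParam (y : EuclideanSpace ℝ (Fin 1) × ℝ) : Circle × ℝ := (Circle.exp (y.1 0), y.2)

theorem contMDiff_cylinderParam :
    ContMDiff 𝓘(ℝ, EuclideanSpace ℝ (Fin 1) × ℝ) IC ∞ cylinderParam := by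
  have h1 : ContMDiff 𝓘(ℝ, EuclideanSpace ℝ (Fin 1) × ℝ) (𝓡 1) ∞
      (fun y : EuclideanSpace ℝ (Fin 1) × ℝ => Circle.exp (angleCLM y)) :=
    contMDiff_circleExp.comp angleCLM.contDiff.contMDiff
  exact h1.prodMk heightCLM.contDiff.contMDiff

theorem cylinderParam_surjective : Function.Surjective cylinderParam := by
  rintro ⟨u, s⟩
  obtain ⟨θ, hθ⟩ := Circle.exp_surjective u
  refine ⟨(EuclideanSpace.single 0 θ, s), Prod.ext ?_ rfl⟩
  simp [cylinderParam, hθ]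

theorem cover_cylinderParam (y : EuclideanSpace ℝ (Fin 1) × ℝ) : cover (cylinderParam y) =
    (⟨Real.cosh y.2 / 2 * Real.cos (2 * y.1 0), Real.cosh y.2 / 2 * Real.sin (2 * y.1 0)⟩,
      Real.sinh y.2 / 2) := by
  refine Prod.ext ?_ rfl
  have h : ((Circle.exp (y.1 0) : Circle) : ℂ) ^ 2 =
      (Real.cos (2 * y.1 0) : ℂ) + (Real.sin (2 * y.1 0) : ℂ) * Complex.I := by
    rw [Circle.coe_exp, ← Complex.exp_nat_mul, Complex.ofReal_cos, Complex.ofReal_sin,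
      ← Complex.exp_mul_I]
    congr 1
    push_cast
    ring
  have h2 : (cover (cylinderParam y)).1 =
    ((Real.cosh y.2 / 2 : ℝ) : ℂ) * ((Circle.exp (y.1 0) : Circle) : ℂ) ^ 2 := rfl
  rw [h2, h]
  apply Complex.ext
  · simp only [Complex.add_re, Complex.ofReal_re, Complex.mul_re,
      Complex.I_re, Complex.I_im, Complex.ofReal_im]
    ring
  · simp only [Complex.add_im, Complex.ofReal_re, Complex.mul_im,
      Complex.I_re, Complex.I_im, Complex.ofReal_im]
    ring

theorem dVec_cover_cylinderParam (y v : EuclideanSpace ℝ (Fin 1) × ℝ) :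
    dVec IC cover (cylinderParam y)
      (dMap 𝓘(ℝ, EuclideanSpace ℝ (Fin 1) × ℝ) IC cylinderParam y v) =
    (⟨Real.sinh y.2 / 2 * Real.cos (2 * y.1 0) * v.2 -
        Real.cosh y.2 * Real.sin (2 * y.1 0) * v.1 0,
      Real.sinh y.2 / 2 * Real.sin (2 * y.1 0) * v.2 +
        Real.cosh y.2 * Real.cos (2 * y.1 0) * v.1 0⟩, Real.cosh y.2 / 2 * v.2) := by
  have hψ : MDifferentiableAt 𝓘(ℝ, EuclideanSpace ℝ (Fin 1) × ℝ) IC cylinderParam y :=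
    contMDiff_cylinderParam.mdifferentiableAt (by simp)
  have hc : MDifferentiableAt IC 𝓘(ℝ, ℂ × ℝ) cover (cylinderParam y) :=
    contMDiff_cover.mdifferentiableAt (by simp)
  rw [← dVec_comp hc hψ]
  refine dVec_eq_of_hasDerivAt_line (hc.comp y hψ).differentiableAt ?_
  simp only [cover_cylinderParam]
  have hθ : HasDerivAt (fun t : ℝ => 2 * (y + t • v).1 0) (2 * v.1 0) 0 := by
    have h := (((hasDerivAt_id (0 : ℝ)).mul_const (v.1 0)).const_add (y.1 0)).const_mul 2
    rw [one_mul] at h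
    exact h
  have hs : HasDerivAt (fun t : ℝ => (y + t • v).2) v.2 0 := by
    have h := ((hasDerivAt_id (0 : ℝ)).mul_const v.2).const_add y.2
    rw [one_mul] at h
    exact h
  have e1 : (y + (0 : ℝ) • v).1 0 = y.1 0 := by simp
  have e2 : (y + (0 : ℝ) • v).2 = y.2 := by simp
  have hC := hs.cosh.div_const 2
  have hS := hs.sinh.div_const 2
  have h1 := hC.mul hθ.cos
  have h2 := hC.mul hθ.sin
  simp only [e1, e2] at h1 h2 hS
  refine ((hasDerivAt_complexMk h1 h2).prodMk hS).congr_deriv ?_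
  refine Prod.ext (Complex.ext ?_ ?_) ?_ <;> dsimp only <;> ring

/-- Squaring u doubles the angle, which compensates the radius factor 1/2 and leaves -cosh² s dθ².
The coefficient of ds² is (cosh² s - sinh² s)/4 = 1/4. -/
theorem flatForm_dVec_cover (y u v : EuclideanSpace ℝ (Fin 1) × ℝ) :
    flatForm (dVec IC cover (cylinderParam y)
        (dMap 𝓘(ℝ, EuclideanSpace ℝ (Fin 1) × ℝ) IC cylinderParam y u))
      (dVec IC cover (cylinderParam y)
        (dMap 𝓘(ℝ, EuclideanSpace ℝ (Fin 1) × ℝ) IC cylinderParam y v)) = cylinderForm y u v := by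
  have h := Real.cosh_sq y.2
  have h' := Real.sin_sq_add_cos_sq (2 * y.1 0)
  rw [dVec_cover_cylinderParam, dVec_cover_cylinderParam, cylinderForm_apply]
  simp only [flatForm]
  linear_combination (-(Real.sinh y.2 ^ 2 / 4 * u.2 * v.2) -
    Real.cosh y.2 ^ 2 * u.1 0 * v.1 0) * h' + u.2 * v.2 / 4 * h

theorem cylinderForm_nondegenerate {y u : EuclideanSpace ℝ (Fin 1) × ℝ}
    (h : ∀ v, cylinderForm y u v = 0) : u = 0 := by
  have h1 := h (EuclideanSpace.single 0 1, 0)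
  have h2 := h (0, 1)
  rw [cylinderForm_apply] at h1 h2
  have hc := (Real.cosh_pos y.2).ne'
  refine Prod.ext ?_ ?_
  · ext i
    fin_cases i
    simpa [hc] using h1
  · simpa using h2

/-- A kernel vector would lie in the radical of the pulled-back form `cylinderForm`, which is
nondegenerate; the dimensions agree. So the universal covering serves as a chart around every point
of the cylinder. -/
theorem dMap_cylinderParam_bijective (y : EuclideanSpace ℝ (Fin 1) × ℝ) :
    Function.Bijective (dMap 𝓘(ℝ, EuclideanSpace ℝ (Fin 1) × ℝ) IC cylinderParam y) := by
  have hi : Function.Injective (dMap 𝓘(ℝ, EuclideanSpace ℝ (Fin 1) × ℝ) IC cylinderParam y) := by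
    rw [injective_iff_map_eq_zero]
    intro u hu
    refine cylinderForm_nondegenerate (y := y) fun v => ?_
    rw [← flatForm_dVec_cover, hu, map_zero]
    simp [flatForm]
  exact ⟨hi, LinearMap.surjective_of_injective
    (f := (dMap 𝓘(ℝ, EuclideanSpace ℝ (Fin 1) × ℝ) IC cylinderParam y).toLinearMap) hi⟩

theorem hyp11_nondegenerate {n : Circle × ℝ} {u : EuclideanSpace ℝ (Fin 1) × ℝ}
    (h : ∀ v : EuclideanSpace ℝ (Fin 1) × ℝ,
      flatForm (dVec IC cover n u) (dVec IC cover n v) = 0) : u = 0 := by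
  obtain ⟨y, rfl⟩ := cylinderParam_surjective n
  obtain ⟨w, rfl⟩ := (dMap_cylinderParam_bijective y).2 u
  have hw : w = 0 := cylinderForm_nondegenerate (y := y) fun v => by
    rw [← flatForm_dVec_cover, h]
  rw [hw, map_zero]

theorem flatForm_comm (u v : ℂ × ℝ) : flatForm u v = flatForm v u := by
  simp only [flatForm]
  ring

theorem isPseudoRiemannianMetric_hyp11 : IsPseudoRiemannianMetric IC hyp11 where
  symm n u v :=
    (hyp11_apply n u v).trans ((flatForm_comm _ _).trans (hyp11_apply n v u).symm)
  nondegenerate n := ⟨fun u hu => hyp11_nondegenerate fun v => (hyp11_apply n u v).symm.trans (hu v),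
    fun u hu => hyp11_nondegenerate fun v =>
      (flatForm_comm _ _).trans ((hyp11_apply n v u).symm.trans (hu v))⟩
  smooth X Y hX hY := (contMDiff_pullback_form contMDiff_cover contMDiff_const
    flatCLM hX hY).congr fun n => hyp11_eq n (X n) (Y n)

theorem isPseudoRiemannianMetric_lineProd_hyp11 :
    IsPseudoRiemannianMetric (𝓘(ℝ, ℝ).prod IC) (lineProd IC hyp11) :=
  isPseudoRiemannianMetric_lineProd isPseudoRiemannianMetric_hyp11 contMDiff_cover
    (ρ := fun _ => 1) contMDiff_const flatCLM hyp11_eq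

theorem pullbackForm_cylinderParam (y : EuclideanSpace ℝ (Fin 1) × ℝ) :
    pullbackForm 𝓘(ℝ, EuclideanSpace ℝ (Fin 1) × ℝ) IC hyp11 cylinderParam y =
      cylinderForm y :=
  LinearMap.ext fun u => LinearMap.ext fun v =>
    (hyp11_apply (cylinderParam y)
      (dMap 𝓘(ℝ, EuclideanSpace ℝ (Fin 1) × ℝ) IC cylinderParam y u)
      (dMap 𝓘(ℝ, EuclideanSpace ℝ (Fin 1) × ℝ) IC cylinderParam y v)).trans
      (flatForm_dVec_cover y u v)

theorem hasConstantSectionalCurvature_hyp11 :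
    HasConstantSectionalCurvature IC hyp11 (-4) := by
  intro x
  obtain ⟨y, hy⟩ := cylinderParam_surjective x
  have hb : ∀ y ∈ Set.univ, Function.Bijective
      (mfderiv 𝓘(ℝ, EuclideanSpace ℝ (Fin 1) × ℝ) IC cylinderParam y) :=
    fun y _ => dMap_cylinderParam_bijective y
  exact ⟨Set.univ, cylinderParam, isOpen_univ, ⟨y, trivial, hy⟩,
    contMDiff_cylinderParam.contMDiffOn, hb,
    HasConstantCurvatureOn.congr isOpen_univ hasConstantCurvatureOn_cylinderForm
      fun y _ => pullbackForm_cylinderParam y⟩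

end Cylinder

/-! ### Submersions adapted to the frame -/

section Submersion

variable {E' : Type*} [NormedAddCommGroup E'] [NormedSpace ℝ E']
  {H' : Type*} [TopologicalSpace H'] {I' : ModelWithCorners ℝ E' H'}
  {N : Type*} [TopologicalSpace N] [ChartedSpace H' N]

/-- A map that is constant along the flow of a frame field kills the frame field. -/
theorem dMap_frame_eq_zero {p : G → N} (hp : ContMDiff IG I' ∞ p) (k : Fin 4)
    (h : ∀ x t, p (x * σ k t) = p x) (x : G) : dMap IG I' p x (frame k x) = 0 := by
  have hx : x * σ k 0 = x := by rw [σ_zero, mul_one]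
  have h1 := dMap_comp (I := 𝓘(ℝ, ℝ)) (I' := IG) (I'' := I') (q := p)
    (p := fun t => x * σ k t) (x := (0 : ℝ)) (hp.mdifferentiableAt (by simp))
    (mdifferentiableAt_mul_σ k x 0) 1
  rw [dMap_mul_σ, hx] at h1
  rw [← h1]
  have h2 : (fun t => p (x * σ k t)) = fun _ => p x := funext fun t => h x t
  rw [h2]
  have h3 : dMap 𝓘(ℝ, ℝ) I' (fun _ : ℝ => p x) 0 = 0 := mfderiv_const
  rw [h3]
  rfl

theorem gForm_eq_sum (x : G) (u v : ℝ × (ℂ × ℝ)) :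
    gForm x u v = ∑ k, sign k * (coeff k x u * coeff k x v) := by
  rw [gForm_coeff, Fin.sum_univ_four]
  simp [sign]
  ring

theorem coeff_zero (k : Fin 4) (x : G) : coeff k x 0 = 0 := by simp [coeff]

/-- The frame fields outside `S` are mapped to orthonormal vectors, those in `S` to zero. -/
structure IsFrameAdapted (I' : ModelWithCorners ℝ E' H') (b : N → LinearMap.BilinForm ℝ E')
    (p : G → N) (S : Finset (Fin 4)) : Prop where
  zero : ∀ x, ∀ i ∈ S, dMap IG I' p x (frame i x) = 0
  ortho : ∀ x, ∀ i ∉ S, ∀ j ∉ S, b (p x) (dMap IG I' p x (frame i x))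
    (dMap IG I' p x (frame j x)) = if i = j then sign i else 0

variable {b : N → LinearMap.BilinForm ℝ E'} {p : G → N} {S : Finset (Fin 4)}

theorem IsFrameAdapted.dMap_eq (h : IsFrameAdapted I' b p S) (x : G) (u : ℝ × (ℂ × ℝ)) :
    dMap IG I' p x u = ∑ k ∈ Sᶜ, coeff k x u • dMap IG I' p x (frame k x) := by
  conv_lhs => rw [← sum_coeff x u, map_sum]
  refine (Finset.sum_subset (Finset.subset_univ Sᶜ) fun k _ hk => ?_).symm.trans ?_
  · rw [map_smul, h.zero x k (by simpa using hk), smul_zero]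
  · exact Finset.sum_congr rfl fun k _ => map_smul _ _ _

theorem IsFrameAdapted.form_frame (h : IsFrameAdapted I' b p S) (x : G) (u : ℝ × (ℂ × ℝ))
    {j : Fin 4} (hj : j ∉ S) :
    b (p x) (dMap IG I' p x u) (dMap IG I' p x (frame j x)) = sign j * coeff j x u := by
  rw [h.dMap_eq x u, LinearMap.map_sum₂]
  rw [Finset.sum_eq_single_of_mem j (Finset.mem_compl.2 hj)]
  · rw [LinearMap.map_smul₂, h.ortho x j hj j hj, if_pos rfl, smul_eq_mul, mul_comm]
  · intro k hk hkj
    rw [LinearMap.map_smul₂, h.ortho x k (Finset.mem_compl.1 hk) j hj, if_neg hkj, smul_zero]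

theorem IsFrameAdapted.form_eq (h : IsFrameAdapted I' b p S) (x : G) (u v : ℝ × (ℂ × ℝ)) :
    b (p x) (dMap IG I' p x u) (dMap IG I' p x v) =
      ∑ k ∈ Sᶜ, sign k * (coeff k x u * coeff k x v) := by
  conv_lhs => rw [h.dMap_eq x v]
  rw [map_sum]
  refine Finset.sum_congr rfl fun k hk => ?_
  rw [map_smul, h.form_frame x u (Finset.mem_compl.1 hk), smul_eq_mul]
  ring

/-- Pairing the image of u with the image of fⱼ, j ∉ S, returns the j-th coefficient of u up to
sign. -/
theorem IsFrameAdapted.dMap_eq_zero_iff (h : IsFrameAdapted I' b p S) (x : G)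
    (u : ℝ × (ℂ × ℝ)) : dMap IG I' p x u = 0 ↔ ∀ j ∉ S, coeff j x u = 0 := by
  constructor
  · intro hu j hj
    have h1 := h.form_frame x u hj
    rw [hu, LinearMap.map_zero₂] at h1
    rcases mul_eq_zero.1 h1.symm with h2 | h2
    · have := sign_sq j
      rw [h2] at this
      norm_num at this
    · exact h2
  · intro hu
    rw [h.dMap_eq x u]
    exact Finset.sum_eq_zero fun k hk => by rw [hu k (Finset.mem_compl.1 hk), zero_smul]

theorem IsFrameAdapted.mem_vertical (h : IsFrameAdapted I' b p S) (x : G) (u : ℝ × (ℂ × ℝ)) :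
    u ∈ vertical IG I' p x ↔ ∀ j ∉ S, coeff j x u = 0 :=
  h.dMap_eq_zero_iff x u

/-- The vertical space is spanned by the fᵢ with i ∈ S, and its orthogonal complement is cut out by
the coefficients with index in S. -/
theorem IsFrameAdapted.mem_horizontal (h : IsFrameAdapted I' b p S) (x : G) (u : ℝ × (ℂ × ℝ)) :
    u ∈ horizontal IG I' gG p x ↔ ∀ j ∈ S, coeff j x u = 0 := by
  have e : u ∈ horizontal IG I' gG p x ↔ ∀ v : ℝ × (ℂ × ℝ), dMap IG I' p x v = 0 →
    gForm x v u = 0 := Iff.rfl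
  rw [e]
  constructor
  · intro hu j hj
    rw [coeff_eq_gForm, gForm_comm, hu _ (h.zero x j hj), mul_zero]
  · intro hu v hv
    rw [h.dMap_eq_zero_iff] at hv
    rw [gForm_eq_sum]
    refine Finset.sum_eq_zero fun k _ => ?_
    by_cases hk : k ∈ S
    · rw [hu k hk, mul_zero, mul_zero]
    · rw [hv k hk, zero_mul, mul_zero]

/-- A vector with prescribed components in the frame. -/
theorem exists_coeff (x : G) (c : Fin 4 → ℝ) : ∃ u, ∀ k, coeff k x u = c k := by
  refine ⟨∑ k, c k • frame k x, fun k => ?_⟩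
  rw [coeff_sum]
  simp [coeff_smul, coeff_frame]

/-- The images of the frame fields outside S are independent, and there are as many of them as the
dimension of the base. -/
theorem IsFrameAdapted.surjective [FiniteDimensional ℝ E'] (h : IsFrameAdapted I' b p S)
    (hd : Module.finrank ℝ E' = Sᶜ.card) (x : G) : Function.Surjective (dMap IG I' p x) := by
  have hli : LinearIndependent ℝ (fun k : (Sᶜ : Finset (Fin 4)) =>
      dMap IG I' p x (frame k x)) := by
    rw [Fintype.linearIndependent_iff]
    intro c hc k
    -- A relation between the images is the image of a vector with these coefficients outside S;
    -- that vector is in the kernel, so its coefficients outside S vanish.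
    obtain ⟨u, hu⟩ := exists_coeff x (fun k => if hk : k ∈ Sᶜ then c ⟨k, hk⟩ else 0)
    have h0 : dMap IG I' p x u = 0 := by
      rw [h.dMap_eq, ← hc, ← Finset.sum_coe_sort Sᶜ]
      refine Finset.sum_congr rfl fun k _ => ?_
      rw [hu, dif_pos k.2]
    rw [h.dMap_eq_zero_iff] at h0
    have h1 := h0 k (Finset.mem_compl.1 k.2)
    rwa [hu, dif_pos k.2] at h1
  have hspan := hli.span_eq_top_of_card_eq_finrank' ((Fintype.card_coe _).trans hd.symm)
  have hr : LinearMap.range (dMap IG I' p x).toLinearMap = ⊤ := by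
    rw [eq_top_iff, ← hspan, Submodule.span_le]
    rintro _ ⟨k, rfl⟩
    exact ⟨frame k x, rfl⟩
  exact LinearMap.range_eq_top.1 hr

theorem IsFrameAdapted.isPseudoRiemannianSubmersion [FiniteDimensional ℝ E'] [IsManifold I' 1 N]
    (h : IsFrameAdapted I' b p S) (hd : Module.finrank ℝ E' = Sᶜ.card)
    (hb : IsPseudoRiemannianMetric I' b) (hp : ContMDiff IG I' ∞ p) :
    IsPseudoRiemannianSubmersion IG I' gG b p where
  metric_total := isPseudoRiemannianMetric_gG
  metric_base := hb
  smooth := hp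
  submersion x := h.surjective hd x
  vertical_nondegenerate x := by
    have key : ∀ u : ℝ × (ℂ × ℝ), dMap IG I' p x u = 0 →
        (∀ v : ℝ × (ℂ × ℝ), dMap IG I' p x v = 0 → gForm x u v = 0) → u = 0 := by
      intro u hu huv
      refine coeff_ext (x := x) fun k => ?_
      rw [coeff_zero]
      by_cases hk : k ∈ S
      · rw [coeff_eq_gForm, huv _ (h.zero x k hk), mul_zero]
      · exact (h.dMap_eq_zero_iff x u).1 hu k hk
    exact ⟨fun u hu => Subtype.ext (key u.1 u.2 fun v hv => hu ⟨v, hv⟩),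
      fun u hu => Subtype.ext (key u.1 u.2 fun v hv => (gForm_comm x u.1 v).trans (hu ⟨v, hv⟩))⟩
  isometry x u hu v _ := by
    have hu' := (h.mem_horizontal x u).1 hu
    refine (h.form_eq x u v).trans (Eq.trans ?_ (gForm_eq_sum x u v).symm)
    refine Finset.sum_subset (Finset.subset_univ _) fun k _ hk => ?_
    rw [hu' k (by simpa using hk), zero_mul, mul_zero]
  bijOn_horizontal x := by
    have hi : ∀ u v : ℝ × (ℂ × ℝ), u ∈ horizontal IG I' gG p x → v ∈ horizontal IG I' gG p x →
        dMap IG I' p x u = dMap IG I' p x v → u = v := by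
      intro u v hu hv huv
      rw [h.mem_horizontal] at hu hv
      have h0 : dMap IG I' p x (u - v) = 0 := by rw [map_sub, huv, sub_self]
      rw [h.dMap_eq_zero_iff] at h0
      refine coeff_ext (x := x) fun k => ?_
      by_cases hk : k ∈ S
      · rw [hu k hk, hv k hk]
      · have := h0 k hk
        rw [coeff_sub] at this
        linarith
    have hs : ∀ w : E', ∃ u : ℝ × (ℂ × ℝ), u ∈ horizontal IG I' gG p x ∧
        dMap IG I' p x u = w := by
      intro w
      obtain ⟨u, rfl⟩ := h.surjective hd x w
      -- Dropping the components in S makes a preimage horizontal and does not change its image.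
      obtain ⟨v, hv⟩ := exists_coeff x (fun k => if k ∈ S then 0 else coeff k x u)
      refine ⟨v, (h.mem_horizontal x v).2 fun k hk => by rw [hv, if_pos hk], ?_⟩
      rw [h.dMap_eq, h.dMap_eq x u]
      refine Finset.sum_congr rfl fun k hk => ?_
      rw [hv, if_neg (Finset.mem_compl.1 hk)]
    exact ⟨fun _ _ => trivial, fun u hu v hv huv => hi u v hu hv huv, fun w _ => hs w⟩

theorem IsFrameAdapted.mapsVertical (h : IsFrameAdapted I' b p S) {A : EndField IG G}
    (hA : ∀ (x : G) (u : ℝ × (ℂ × ℝ)), (∀ j ∉ S, coeff j x u = 0) →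
      ∀ j ∈ S, coeff j x (A x u) = 0) : MapsVerticalToHorizontal IG I' gG A p :=
  fun x u hu => (h.mem_horizontal x (A x u)).2 (hA x u ((h.mem_vertical x u).1 hu))

/-- J interchanges the lines of f₀ and f₁, and those of f₂ and f₃. A vertical vector can have a
nonhorizontal image only if S contains one of these pairs. -/
theorem IsFrameAdapted.mapsVertical_J (h : IsFrameAdapted I' b p S)
    (h01 : ¬(0 ∈ S ∧ 1 ∈ S)) (h23 : ¬(2 ∈ S ∧ 3 ∈ S)) :
    MapsVerticalToHorizontal IG I' gG J p := by
  refine h.mapsVertical fun x u hu => ?_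
  obtain ⟨h0, h1, h2, h3⟩ := coeff_jMap x u
  refine forall_fin_four (fun hs => h0.trans ?_) (fun hs => h1.trans ?_) (fun hs => h2.trans ?_)
    (fun hs => h3.trans ?_)
  · rw [hu 1 fun h => h01 ⟨hs, h⟩, neg_zero]
  · rw [hu 0 fun h => h01 ⟨h, hs⟩]
  · rw [hu 3 fun h => h23 ⟨hs, h⟩, neg_zero]
  · rw [hu 2 fun h => h23 ⟨h, hs⟩]

theorem IsFrameAdapted.mapsVertical_J' (h : IsFrameAdapted I' b p S)
    (h02 : ¬(0 ∈ S ∧ 2 ∈ S)) (h13 : ¬(1 ∈ S ∧ 3 ∈ S)) :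
    MapsVerticalToHorizontal IG I' gG J' p := by
  refine h.mapsVertical fun x u hu => ?_
  obtain ⟨h0, h1, h2, h3⟩ := coeff_jMap' x u
  refine forall_fin_four (fun hs => h0.trans ?_) (fun hs => h1.trans ?_) (fun hs => h2.trans ?_)
    (fun hs => h3.trans ?_)
  · rw [hu 2 fun h => h02 ⟨hs, h⟩]
  · rw [hu 3 fun h => h13 ⟨hs, h⟩, neg_zero]
  · rw [hu 0 fun h => h02 ⟨h, hs⟩]
  · rw [hu 1 fun h => h13 ⟨h, hs⟩, neg_zero]

/-- The product JJ̃ interchanges the lines of f₀ and f₃, and those of f₁ and f₂. -/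
theorem IsFrameAdapted.mapsVertical_J'' (h : IsFrameAdapted I' b p S)
    (h03 : ¬(0 ∈ S ∧ 3 ∈ S)) (h12 : ¬(1 ∈ S ∧ 2 ∈ S)) :
    MapsVerticalToHorizontal IG I' gG J'' p := by
  refine h.mapsVertical fun x u hu => ?_
  obtain ⟨h0, h1, h2, h3⟩ := coeff_jMap x (jMap' x u)
  obtain ⟨k0, k1, k2, k3⟩ := coeff_jMap' x u
  rw [k1] at h0
  rw [k0] at h1
  rw [k3] at h2
  rw [k2] at h3
  refine forall_fin_four (fun hs => h0.trans ?_) (fun hs => h1.trans ?_) (fun hs => h2.trans ?_)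
    (fun hs => h3.trans ?_)
  · rw [hu 3 fun h => h03 ⟨hs, h⟩, neg_zero, neg_zero]
  · rw [hu 2 fun h => h12 ⟨hs, h⟩]
  · rw [hu 1 fun h => h12 ⟨h, hs⟩, neg_zero, neg_zero]
  · rw [hu 0 fun h => h03 ⟨h, hs⟩]

theorem IsFrameAdapted.isTriplyAntiInvariant [FiniteDimensional ℝ E'] [IsManifold I' 1 N]
    {i : Fin 4} (h : IsFrameAdapted I' b p {i}) (hd : Module.finrank ℝ E' = 3)
    (hb : IsPseudoRiemannianMetric I' b) (hp : ContMDiff IG I' ∞ p) :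
    IsTriplyAntiInvariant I' b p := by
  have hs := h.isPseudoRiemannianSubmersion (by rw [hd, Finset.card_compl]; rfl) hb hp
  have hne : ∀ k l : Fin 4, k ≠ l → ¬(k ∈ ({i} : Finset (Fin 4)) ∧ l ∈ ({i} : Finset (Fin 4))) := by
    intro k l hkl ⟨h1, h2⟩
    rw [Finset.mem_singleton] at h1 h2
    exact hkl (h1.trans h2.symm)
  have h1 := h.mapsVertical_J (hne _ _ (by decide)) (hne _ _ (by decide))
  have h2 := h.mapsVertical_J' (hne _ _ (by decide)) (hne _ _ (by decide))
  have h3 := h.mapsVertical_J'' (hne _ _ (by decide)) (hne _ _ (by decide))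
  exact ⟨⟨isHermitian_J, hs, h1⟩, ⟨isParaHermitian_J', hs, h2⟩,
    ⟨isParaQuaternion_J, hs, h1, h2, h3⟩⟩

end Submersion

/-! ### Identification of a quotient by a map with a section -/

section Quotient

/-- A continuous map with a continuous section whose fibres are the cosets of `K` identifies the
quotient with its target. -/
theorem exists_quotient_homeomorph {Γ N : Type*} [Group Γ] [TopologicalSpace Γ] [TopologicalSpace N]
    {K : Subgroup Γ} {p : Γ → N} {s : N → Γ} (hp : Continuous p) (hs : Continuous s)
    (hps : ∀ n, p (s n) = n) (hK : ∀ x y, p x = p y ↔ x⁻¹ * y ∈ K) :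
    ∃ Φ : Γ ⧸ K ≃ₜ N, (fun x => Φ (QuotientGroup.mk x)) = p := by
  refine ⟨{ toFun := Quotient.lift p fun x y hxy =>
              (hK x y).2 (QuotientGroup.leftRel_apply.1 hxy)
            invFun := fun n => QuotientGroup.mk (s n)
            left_inv := ?_
            right_inv := hps
            continuous_toFun := hp.quotient_lift _
            continuous_invFun := QuotientGroup.continuous_mk.comp hs }, rfl⟩
  intro y
  obtain ⟨x, rfl⟩ := QuotientGroup.mk_surjective y
  refine QuotientGroup.eq.2 ((hK _ _).1 ?_)
  exact hps (p x)

end Quotient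

/-! ### Products with the line -/

section LineBase

variable {E : Type*} [NormedAddCommGroup E] [NormedSpace ℝ E]
  {H : Type*} [TopologicalSpace H] {I : ModelWithCorners ℝ E H}
  {M : Type*} [TopologicalSpace M] [ChartedSpace H M]

/-- The product of the projection of `G` to `ℝ` and a map on `SL(2, ℝ)`. -/
def lineMap (φ : SL2 → M) (x : G) : ℝ × M := (tCoord x, φ x.2)

theorem contMDiff_lineMap {φ : SL2 → M} (hφ : ContMDiff ISL I ∞ φ) :
    ContMDiff IG (𝓘(ℝ, ℝ).prod I) ∞ (lineMap φ) :=
  contMDiff_tCoord.prodMk (hφ.comp contMDiff_snd)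

theorem dMap_lineMap {φ : SL2 → M} (hφ : ContMDiff ISL I ∞ φ) (x : G) (u : ℝ × (ℂ × ℝ)) :
    dMap IG (𝓘(ℝ, ℝ).prod I) (lineMap φ) x u = (u.1, dMap IG I (fun y : G => φ y.2) x u) := by
  have h := dMap_prodMk (I := IG) (I' := 𝓘(ℝ, ℝ)) (I'' := I) (p := tCoord)
    (q := fun y : G => φ y.2) (contMDiff_tCoord.mdifferentiableAt (x := x) (by simp))
    ((hφ.comp contMDiff_snd).mdifferentiableAt (by simp)) u
  refine h.trans (Prod.ext ?_ rfl)
  exact dVec_tCoord x u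

/-- A map on `SL(2, ℝ)` adapted to the frame gives a map of `G` to a product with the line. -/
theorem IsFrameAdapted.lineMap {φ : SL2 → M} (hφ : ContMDiff ISL I ∞ φ)
    {b : M → LinearMap.BilinForm ℝ E} {S : Finset (Fin 4)} (h0 : 0 ∈ S)
    (h : IsFrameAdapted I b (fun x : G => φ x.2) S) :
    IsFrameAdapted (𝓘(ℝ, ℝ).prod I) (lineProd I b) (lineMap φ) (S.erase 0) where
  zero x i hi := by
    rw [dMap_lineMap hφ, h.zero x i (Finset.mem_of_mem_erase hi), frame_fst]
    have hi0 : i ≠ 0 := Finset.ne_of_mem_erase hi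
    have hz : frameTime i = 0 := by
      fin_cases i <;> simp [frameTime] at hi0 ⊢
    rw [hz]
    rfl
  ortho x i hi j hj := by
    have hb : ∀ u v : ℝ × (ℂ × ℝ), lineProd I b (AntiInvariant.lineMap φ x)
        (dMap IG (𝓘(ℝ, ℝ).prod I) (AntiInvariant.lineMap φ) x u)
        (dMap IG (𝓘(ℝ, ℝ).prod I) (AntiInvariant.lineMap φ) x v) =
        b (φ x.2) (dMap IG I (fun y : G => φ y.2) x u) (dMap IG I (fun y : G => φ y.2) x v) -
          u.1 * v.1 := by
      intro u v
      rw [dMap_lineMap hφ, dMap_lineMap hφ]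
      rfl
    refine (hb _ _).trans ?_
    rw [frame_fst, frame_fst]
    have ht : ∀ k : Fin 4, k ≠ 0 → frameTime k = 0 := by
      intro k hk
      fin_cases k <;> simp [frameTime] at hk ⊢
    -- The field f₀ now goes to the unit vector of the line and has no component in M, while the
    -- other fields have no component in the line; so f₀ leaves the vertical set with square -1 and
    -- all mixed products vanish.
    by_cases hi0 : i = 0
    · subst hi0
      rw [h.zero x 0 h0, LinearMap.map_zero₂]
      by_cases hj0 : j = 0
      · subst hj0
        simp [frameTime, sign]
      · rw [ht j hj0, if_neg (Ne.symm hj0)]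
        simp
    · rw [ht i hi0, zero_mul, sub_zero]
      have hi' : i ∉ S := fun h => hi (Finset.mem_erase.2 ⟨hi0, h⟩)
      by_cases hj0 : j = 0
      · subst hj0
        rw [h.zero x 0 h0, map_zero, if_neg hi0]
      · exact h.ortho x i hi' j fun h => hj (Finset.mem_erase.2 ⟨hj0, h⟩)

end LineBase

/-! ### The quotient by exp(ℝf₀) -/

section SpecialLinearBase

theorem dMap_snd_g (x : G) (u : ℝ × (ℂ × ℝ)) :
    dMap IG ISL (Prod.snd : G → SL2) x u = u.2 :=
  DFunLike.congr_fun (mfderiv_snd (I := 𝓘(ℝ, ℝ)) (I' := ISL) (x := x)) u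

theorem isFrameAdapted_snd : IsFrameAdapted ISL gSL (Prod.snd : G → SL2) {0} where
  zero x i hi := by
    rw [Finset.mem_singleton] at hi
    subst hi
    refine dMap_frame_eq_zero contMDiff_snd 0 (fun x t => ?_) x
    exact mul_one x.2
  ortho x i hi j _ := by
    rw [Finset.mem_singleton] at hi
    refine (gSL_apply _ _ _).trans ?_
    have h := gForm_frame x i j
    have ht : frameTime i = 0 := by
      fin_cases i <;> simp [frameTime] at hi ⊢
    rw [gForm_apply, frame_fst, ht, zero_mul, neg_zero, zero_add] at h
    rw [dMap_snd_g, dMap_snd_g]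
    exact h

end SpecialLinearBase

/-! ### The quotient of `SL(2, ℝ)` by the rotations -/

section HalfPlaneBase

/-- The orbit map `A ↦ A • √-1` from `SL(2, ℝ)` to the upper half-plane. -/
def orbitMap (A : SL2) : ℍ := A • UpperHalfPlane.I

theorem bottomRow_ne (A : SL2) : A 1 0 ^ 2 + A 1 1 ^ 2 ≠ 0 := by
  intro h
  have hd := sl_det A
  have h0 : A 1 0 = 0 := by nlinarith [sq_nonneg (A 1 0), sq_nonneg (A 1 1)]
  have h1 : A 1 1 = 0 := by nlinarith [sq_nonneg (A 1 0), sq_nonneg (A 1 1)]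
  simp [h0, h1] at hd

theorem coe_orbitMap (A : SL2) : (orbitMap A : ℂ) =
    ⟨(A 0 0 * A 1 0 + A 0 1 * A 1 1) / (A 1 0 ^ 2 + A 1 1 ^ 2), 1 / (A 1 0 ^ 2 + A 1 1 ^ 2)⟩ := by
  have hd := sl_det A
  have hn := bottomRow_ne A
  have hz : ((A 1 0 : ℝ) : ℂ) * Complex.I + ((A 1 1 : ℝ) : ℂ) ≠ 0 := by
    intro h
    have h0 := congrArg Complex.im h
    have h1 := congrArg Complex.re h
    simp at h0 h1
    exact hn (by rw [h0, h1]; ring)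
  have h : (orbitMap A : ℂ) = (((A 0 0 : ℝ) : ℂ) * Complex.I + ((A 0 1 : ℝ) : ℂ)) /
      (((A 1 0 : ℝ) : ℂ) * Complex.I + ((A 1 1 : ℝ) : ℂ)) :=
    UpperHalfPlane.coe_specialLinearGroup_apply A UpperHalfPlane.I
  rw [h, div_eq_iff hz]
  apply Complex.ext
  · simp
    field_simp
    linear_combination (-A 1 0) * hd
  · simp
    field_simp
    linear_combination (A 1 1) * hd

theorem contMDiff_orbitMap : ContMDiff ISL 𝓘(ℝ, ℂ) ∞ orbitMap := by
  refine contMDiff_upperHalfPlane_of_coe ?_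
  simp only [coe_orbitMap]
  have e := contMDiff_entry
  have hD := ((e 1 0).pow 2).add ((e 1 1).pow 2)
  exact contMDiff_complexMk ((((e 0 0).mul (e 1 0)).add ((e 0 1).mul (e 1 1))).div₀ hD bottomRow_ne)
    (contMDiff_const.div₀ hD bottomRow_ne)

/-- The derivative of the entry `(i, j)` along the frame field `k`. -/
def entryDeriv (k : Fin 4) (A : SL2) (i j : Fin 2) : ℝ :=
  A i 0 * frameMatrix k 0 j + A i 1 * frameMatrix k 1 j

/-- The derivative of the orbit map along a frame field. -/
theorem dMap_orbitMap_frame (k : Fin 4) (x : G) :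
    dMap IG 𝓘(ℝ, ℂ) (fun y : G => orbitMap y.2) x (frame k x) =
      (⟨((entryDeriv k x.2 0 0 * x.2 1 0 + x.2 0 0 * entryDeriv k x.2 1 0 +
            (entryDeriv k x.2 0 1 * x.2 1 1 + x.2 0 1 * entryDeriv k x.2 1 1)) *
          (x.2 1 0 ^ 2 + x.2 1 1 ^ 2) -
          (x.2 0 0 * x.2 1 0 + x.2 0 1 * x.2 1 1) *
          (2 * x.2 1 0 * entryDeriv k x.2 1 0 + 2 * x.2 1 1 * entryDeriv k x.2 1 1)) /
          (x.2 1 0 ^ 2 + x.2 1 1 ^ 2) ^ 2,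
        -(2 * x.2 1 0 * entryDeriv k x.2 1 0 + 2 * x.2 1 1 * entryDeriv k x.2 1 1) /
          (x.2 1 0 ^ 2 + x.2 1 1 ^ 2) ^ 2⟩ : ℂ) := by
  have hs : ContMDiff IG 𝓘(ℝ, ℂ) ∞ (fun y : G => orbitMap y.2) :=
    contMDiff_orbitMap.comp contMDiff_snd
  have h1 := dVec_comp (I := IG) (contMDiff_coe_upperHalfPlane.mdifferentiableAt (by simp))
    (hs.mdifferentiableAt (x := x) (by simp)) (frame k x)
  rw [dVec_coe_upperHalfPlane] at h1
  rw [← h1]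
  have h2 := hasDerivAt_frame ((contMDiff_coe_upperHalfPlane.comp hs).mdifferentiableAt (x := x)
    (by simp)) k
  refine h2.unique ?_
  have e : ∀ i j, HasDerivAt (fun t => (x * σ k t).2 i j) (entryDeriv k x.2 i j) 0 :=
    hasDerivAt_gEntry_frame k x
  have z : ∀ i j, (x * σ k 0).2 i j = x.2 i j := by
    intro i j
    rw [σ_zero, mul_one]
  have hN := ((e 0 0).mul (e 1 0)).add ((e 0 1).mul (e 1 1))
  have hD := ((e 1 0).pow 2).add ((e 1 1).pow 2)
  have hD0 := bottomRow_ne (x * σ k 0).2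
  have h3 := hN.div hD hD0
  have h4 := (hasDerivAt_const (0 : ℝ) (1 : ℝ)).div hD hD0
  refine ((hasDerivAt_complexMk h3 h4).congr_of_eventuallyEq
    (Filter.Eventually.of_forall fun t => coe_orbitMap _)).congr_deriv ?_
  simp only [Pi.add_apply, Pi.mul_apply, Pi.pow_apply, z]
  refine Complex.ext ?_ ?_
  · simp
  · simp

theorem isFrameAdapted_orbitMap :
    IsFrameAdapted 𝓘(ℝ, ℂ) hyp02 (fun x : G => orbitMap x.2) {0, 1} where
  zero x i hi := by
    rw [dMap_orbitMap_frame]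
    have hi' : i = 0 ∨ i = 1 := by simpa using hi
    rcases hi' with rfl | rfl
    · refine Complex.ext ?_ ?_ <;> simp [entryDeriv, frameMatrix]
    · refine Complex.ext ?_ ?_
      · simp only [entryDeriv, frameMatrix, Matrix.cons_val, Matrix.of_apply, Complex.zero_re]
        rw [div_eq_zero_iff]
        left
        ring
      · simp only [entryDeriv, frameMatrix, Matrix.cons_val, Matrix.of_apply, Complex.zero_im]
        rw [div_eq_zero_iff]
        left
        ring
  ortho x i hi j hj := by
    have hd := sl_det x.2
    have hD := bottomRow_ne x.2
    -- With bottom row (c, d) and D = c² + d², the images of f₂ and f₃ are 2(d - ic)²/D² and i times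
    -- this number. They are perpendicular of Euclidean length 2/D = 2y, which is length 1 for (dx²
    -- + dy²)/(4y²).
    have w2 : dMap IG 𝓘(ℝ, ℂ) (fun y : G => orbitMap y.2) x (frame 2 x) =
        (⟨2 * (x.2 1 1 ^ 2 - x.2 1 0 ^ 2) / (x.2 1 0 ^ 2 + x.2 1 1 ^ 2) ^ 2,
          -(4 * x.2 1 0 * x.2 1 1) / (x.2 1 0 ^ 2 + x.2 1 1 ^ 2) ^ 2⟩ : ℂ) := by
      rw [dMap_orbitMap_frame]
      simp only [entryDeriv, frameMatrix, Matrix.cons_val, Matrix.of_apply]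
      refine Complex.ext ?_ ?_
      · dsimp only
        congr 1
        linear_combination 2 * (x.2 1 1 ^ 2 - x.2 1 0 ^ 2) * hd
      · dsimp only
        congr 1
        ring
    have w3 : dMap IG 𝓘(ℝ, ℂ) (fun y : G => orbitMap y.2) x (frame 3 x) =
        (⟨4 * x.2 1 0 * x.2 1 1 / (x.2 1 0 ^ 2 + x.2 1 1 ^ 2) ^ 2,
          2 * (x.2 1 1 ^ 2 - x.2 1 0 ^ 2) / (x.2 1 0 ^ 2 + x.2 1 1 ^ 2) ^ 2⟩ : ℂ) := by
      rw [dMap_orbitMap_frame]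
      simp only [entryDeriv, frameMatrix, Matrix.cons_val, Matrix.of_apply]
      refine Complex.ext ?_ ?_
      · dsimp only
        congr 1
        linear_combination 4 * x.2 1 0 * x.2 1 1 * hd
      · dsimp only
        congr 1
        ring
    have hb : ∀ u v : ℂ, hyp02 (orbitMap x.2) u v =
        (x.2 1 0 ^ 2 + x.2 1 1 ^ 2) ^ 2 / 4 * (u.re * v.re + u.im * v.im) := by
      intro u v
      refine (halfPlaneForm_apply _ u v).trans ?_
      rw [coe_orbitMap]
      field_simp
    have hi' : i = 2 ∨ i = 3 := by revert hi; fin_cases i <;> simp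
    have hj' : j = 2 ∨ j = 3 := by revert hj; fin_cases j <;> simp
    refine (hb _ _).trans ?_
    rcases hi' with rfl | rfl <;> rcases hj' with rfl | rfl <;>
      simp only [w2, w3, sign, Matrix.cons_val, if_pos, Fin.reduceEq, if_false] <;> field_simp <;>
      ring

/-- The section of the orbit map by upper triangular matrices. -/
def triangular (z : ℍ) : SL2 :=
  ⟨!![Real.sqrt z.im, z.re / Real.sqrt z.im; 0, 1 / Real.sqrt z.im], by
    have h := (Real.sqrt_pos.2 z.im_pos).ne'
    rw [Matrix.det_fin_two_of]
    field_simp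
    simp⟩

theorem continuous_sl2_of_entries {X : Type*} [TopologicalSpace X] {φ : X → SL2}
    (h : ∀ i j, Continuous fun x => φ x i j) : Continuous φ :=
  continuous_induced_rng.2 (continuous_matrix h)

theorem continuous_triangular : Continuous triangular := by
  have h1 : Continuous fun z : ℍ => Real.sqrt z.im := UpperHalfPlane.continuous_im.sqrt
  have h0 : ∀ z : ℍ, Real.sqrt z.im ≠ 0 := fun z => (Real.sqrt_pos.2 z.im_pos).ne'
  refine continuous_sl2_of_entries fun i j => ?_
  fin_cases i <;> fin_cases j
  · exact h1
  · exact UpperHalfPlane.continuous_re.div h1 h0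
  · exact continuous_const
  · exact continuous_const.div h1 h0

theorem orbitMap_triangular (z : ℍ) : orbitMap (triangular z) = z := by
  have h := (Real.sqrt_pos.2 z.im_pos).ne'
  have h2 := Real.sq_sqrt z.im_pos.le
  apply UpperHalfPlane.ext
  rw [coe_orbitMap]
  refine Complex.ext ?_ ?_
  · simp [triangular]
    field_simp
  · simp [triangular, h2]

theorem orbitMap_mul_σ₁ (A : SL2) (t : ℝ) : orbitMap (A * σ₁ t) = orbitMap A := by
  have h : σ₁ t • UpperHalfPlane.I = UpperHalfPlane.I := by
    apply UpperHalfPlane.ext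
    refine (coe_orbitMap (σ₁ t)).trans ?_
    refine Complex.ext ?_ ?_
    · simp [σ₁]
      ring
    · simp [σ₁]
  rw [orbitMap, mul_smul, h]
  rfl

/-- This is the Iwasawa decomposition: A and the triangular matrix send i to the same point, so they
differ by an element of the stabilizer of i, which is a rotation. -/
theorem exists_eq_triangular_mul (A : SL2) : ∃ t, triangular (orbitMap A) * σ₁ t = A := by
  set B := (triangular (orbitMap A))⁻¹ * A with hB
  have hA : A = triangular (orbitMap A) * B := by rw [hB, mul_inv_cancel_left]
  have h : orbitMap B = UpperHalfPlane.I := by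
    have h1 : orbitMap B = (triangular (orbitMap A))⁻¹ • orbitMap A := mul_smul _ _ _
    rw [h1, inv_smul_eq_iff]
    exact (orbitMap_triangular _).symm
  have h2 := congrArg (fun z : ℍ => (z : ℂ)) h
  simp only [coe_orbitMap] at h2
  have h3 := congrArg Complex.im h2
  have h4 := congrArg Complex.re h2
  simp at h3 h4
  have hd := sl_det B
  have hn : B 1 0 ^ 2 + B 1 1 ^ 2 = 1 := h3
  rw [hn] at h4
  have h5 : B 0 0 * B 1 0 + B 0 1 * B 1 1 = 0 := by
    rcases h4 with h4 | h4
    · exact h4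
    · norm_num at h4
  -- The rows of B are orthogonal, the second one is a unit vector and the determinant is 1; hence
  -- the first row is the second one turned by a right angle.
  have e1 : B 0 0 = B 1 1 := by linear_combination B 1 0 * h5 + B 1 1 * hd - B 0 0 * hn
  have e2 : B 1 0 = - B 0 1 := by linear_combination B 1 1 * h5 - B 1 0 * hd - B 0 1 * hn
  obtain ⟨t, ht1, ht2⟩ : ∃ t, Real.cos t = B 0 0 ∧ Real.sin t = B 0 1 := by
    have hz : ‖(⟨B 0 0, B 0 1⟩ : ℂ)‖ = 1 := by
      rw [Complex.norm_def, Complex.normSq_mk, Real.sqrt_eq_one]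
      rw [e1, ← neg_neg (B 0 1), ← e2]
      linarith
    refine ⟨Complex.arg ⟨B 0 0, B 0 1⟩, ?_, ?_⟩
    · rw [Complex.cos_arg (by intro h; rw [h] at hz; simp at hz), hz, div_one]
    · rw [Complex.sin_arg, hz, div_one]
  refine ⟨t, ?_⟩
  have hs : σ₁ t = B := by
    ext i j
    fin_cases i <;> fin_cases j
    · exact ht1
    · exact ht2
    · exact (congrArg Neg.neg ht2).trans e2.symm
    · exact ht1.trans e1
  rw [hs, ← hA]

end HalfPlaneBase

/-! ### The quotient of `SL(2, ℝ)` by exp(ℝf₂) -/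

section CylinderBase

variable {E : Type*} [NormedAddCommGroup E] [NormedSpace ℝ E]
  {H : Type*} [TopologicalSpace H] {I : ModelWithCorners ℝ E H}
  {M : Type*} [TopologicalSpace M] [ChartedSpace H M]

/-- The sum of the columns of a matrix, as a complex number. -/
def columnSum (A : SL2) : ℂ := ⟨A 0 0 + A 0 1, A 1 0 + A 1 1⟩

/-- The difference of the columns of a matrix, as a complex number. -/
def columnDiff (A : SL2) : ℂ := ⟨A 0 0 - A 0 1, A 1 0 - A 1 1⟩

/-- A vector bisecting the angle between the sum and the difference of the columns. -/
def bisector (A : SL2) : ℂ :=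
  (‖columnDiff A‖ : ℂ) * columnSum A + (‖columnSum A‖ : ℂ) * columnDiff A

/-- The sum and the difference of the columns are the images under A of (1, 1) and (1, -1), a pair
of determinant -2. -/
theorem column_det (A : SL2) :
    (columnSum A).im * (columnDiff A).re - (columnSum A).re * (columnDiff A).im = 2 := by
  have h := sl_det A
  simp only [columnSum, columnDiff]
  linear_combination 2 * h

theorem columnSum_ne (A : SL2) : columnSum A ≠ 0 := by
  intro h
  have := column_det A
  simp [h] at this

theorem columnDiff_ne (A : SL2) : columnDiff A ≠ 0 := by
  intro h
  have := column_det A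
  simp [h] at this

/-- If the bisector vanished, the sum P and the difference Q of the columns would be proportional,
contrary to `column_det`. -/
theorem bisector_ne (A : SL2) : bisector A ≠ 0 := by
  intro h
  have hd := column_det A
  have hP := norm_pos_iff.2 (columnSum_ne A)
  have h1 := congrArg Complex.re h
  have h2 := congrArg Complex.im h
  simp [bisector] at h1 h2
  -- The determinant of P with ‖Q‖P + ‖P‖Q is ‖P‖ times that of P with Q.
  have h3 : ‖columnSum A‖ * 2 = 0 := by
    rw [← hd]
    linear_combination (columnSum A).im * h1 - (columnSum A).re * h2
  linarith

/-- The angular coordinate of the projection of `SL(2, ℝ)` to the cylinder. -/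
def cylinderAngle (A : SL2) : Circle :=
  ⟨bisector A / (‖bisector A‖ : ℂ), mem_sphere_zero_iff_norm.2 (by
    rw [norm_div, Complex.norm_real, norm_norm, div_self (norm_ne_zero_iff.2 (bisector_ne A))])⟩

theorem coe_cylinderAngle (A : SL2) :
    (cylinderAngle A : ℂ) = bisector A / (‖bisector A‖ : ℂ) := rfl

/-- The linear coordinate of the projection of `SL(2, ℝ)` to the cylinder. -/
def cylinderHeight (A : SL2) : ℝ :=
  Real.arsinh ((A 0 0 ^ 2 - A 0 1 ^ 2 - A 1 1 ^ 2 + A 1 0 ^ 2) / 2)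

/-- The projection of `SL(2, ℝ)` to the cylinder. -/
def cylinderMap (A : SL2) : Circle × ℝ := (cylinderAngle A, cylinderHeight A)

theorem contMDiff_norm {φ : M → ℂ} (h : ContMDiff I 𝓘(ℝ, ℂ) ∞ φ) (h0 : ∀ x, φ x ≠ 0) :
    ContMDiff I 𝓘(ℝ, ℝ) ∞ (fun x => ‖φ x‖) := fun x =>
  (contDiffAt_norm ℝ (h0 x)).contMDiffAt.comp x (h x)

theorem contMDiff_columnSum : ContMDiff ISL 𝓘(ℝ, ℂ) ∞ columnSum :=
  contMDiff_complexMk ((contMDiff_entry 0 0).add (contMDiff_entry 0 1))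
    ((contMDiff_entry 1 0).add (contMDiff_entry 1 1))

theorem contMDiff_columnDiff : ContMDiff ISL 𝓘(ℝ, ℂ) ∞ columnDiff :=
  contMDiff_complexMk ((contMDiff_entry 0 0).sub (contMDiff_entry 0 1))
    ((contMDiff_entry 1 0).sub (contMDiff_entry 1 1))

theorem contMDiff_bisector : ContMDiff ISL 𝓘(ℝ, ℂ) ∞ bisector :=
  (contMDiff_complex_mul (contMDiff_ofReal (contMDiff_norm contMDiff_columnDiff columnDiff_ne))
    contMDiff_columnSum).add
  (contMDiff_complex_mul (contMDiff_ofReal (contMDiff_norm contMDiff_columnSum columnSum_ne))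
    contMDiff_columnDiff)

theorem contMDiff_cylinderAngle : ContMDiff ISL (𝓡 1) ∞ cylinderAngle := by
  refine contMDiff_circle_of_coe ?_
  have hn := contMDiff_norm contMDiff_bisector bisector_ne
  have hi : ContMDiff ISL 𝓘(ℝ, ℝ) ∞ (fun A => 1 / ‖bisector A‖) :=
    contMDiff_const.div₀ hn fun A => norm_ne_zero_iff.2 (bisector_ne A)
  refine (contMDiff_complex_mul (contMDiff_ofReal hi) contMDiff_bisector).congr fun A => ?_
  rw [coe_cylinderAngle]
  push_cast
  ring

theorem contMDiff_cylinderHeight : ContMDiff ISL 𝓘(ℝ, ℝ) ∞ cylinderHeight := by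
  have e := contMDiff_entry
  have h : ContMDiff ISL 𝓘(ℝ, ℝ) ∞
      (fun A : SL2 => (A 0 0 ^ 2 - A 0 1 ^ 2 - A 1 1 ^ 2 + A 1 0 ^ 2) / 2) :=
    (((((e 0 0).pow 2).sub ((e 0 1).pow 2)).sub ((e 1 1).pow 2)).add ((e 1 0).pow 2)).div₀
      contMDiff_const fun _ => two_ne_zero
  exact Real.contDiff_arsinh.contMDiff.comp h

theorem contMDiff_cylinderMap : ContMDiff ISL IC ∞ cylinderMap :=
  contMDiff_cylinderAngle.prodMk contMDiff_cylinderHeight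

/-- Let v = ‖Q‖P + ‖P‖Q. From P P̄ = ‖P‖² and Q Q̄ = ‖Q‖² follows PQ v̄ = ‖P‖‖Q‖ v, so the square of
v/‖v‖, which is v/v̄, equals PQ/(‖P‖‖Q‖). This is the smooth square root that lifts the orbit map to
the two-fold covering. -/
theorem bisector_sq (A : SL2) : (cylinderAngle A : ℂ) ^ 2 * (‖columnSum A‖ * ‖columnDiff A‖ : ℂ) =
    columnSum A * columnDiff A := by
  have hv : (‖bisector A‖ : ℂ) ≠ 0 := by
    exact_mod_cast norm_ne_zero_iff.2 (bisector_ne A)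
  have h1 : (‖bisector A‖ : ℂ) ^ 2 = bisector A * (starRingEnd ℂ) (bisector A) := by
    rw [Complex.mul_conj, Complex.normSq_eq_norm_sq]
    push_cast
    rfl
  have hP : (‖columnSum A‖ : ℂ) ^ 2 = columnSum A * (starRingEnd ℂ) (columnSum A) := by
    rw [Complex.mul_conj, Complex.normSq_eq_norm_sq]
    push_cast
    rfl
  have hQ : (‖columnDiff A‖ : ℂ) ^ 2 = columnDiff A * (starRingEnd ℂ) (columnDiff A) := by
    rw [Complex.mul_conj, Complex.normSq_eq_norm_sq]
    push_cast
    rfl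
  have h2 : (starRingEnd ℂ) (bisector A) = (‖columnDiff A‖ : ℂ) * (starRingEnd ℂ) (columnSum A) +
      (‖columnSum A‖ : ℂ) * (starRingEnd ℂ) (columnDiff A) := by
    simp [bisector]
  have h3 : (columnSum A * columnDiff A) * (starRingEnd ℂ) (bisector A) =
      (‖columnSum A‖ * ‖columnDiff A‖ : ℂ) * bisector A := by
    rw [h2, bisector]
    linear_combination (-(‖columnDiff A‖ : ℂ) * columnDiff A) * hP -
      (‖columnSum A‖ : ℂ) * columnSum A * hQ
  rw [coe_cylinderAngle, div_pow, div_mul_eq_mul_div, div_eq_iff (pow_ne_zero 2 hv), h1]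
  linear_combination (-bisector A) * h3

/-- Both sides are nonnegative, and ‖P‖²‖Q‖²/4 exceeds the square of the hyperbolic sine of the
height by det(A)² = 1. -/
theorem cosh_cylinderHeight (A : SL2) :
    Real.cosh (cylinderHeight A) = ‖columnSum A‖ * ‖columnDiff A‖ / 2 := by
  have hd := sl_det A
  have h1 : Real.cosh (cylinderHeight A) ^ 2 = (‖columnSum A‖ * ‖columnDiff A‖ / 2) ^ 2 := by
    rw [Real.cosh_sq, cylinderHeight, Real.sinh_arsinh, div_pow, div_pow, mul_pow,
      ← Complex.normSq_eq_norm_sq, ← Complex.normSq_eq_norm_sq]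
    simp only [columnSum, columnDiff, Complex.normSq_mk]
    linear_combination (-(A 0 0 * A 1 1 - A 0 1 * A 1 0 + 1)) * hd
  exact (sq_eq_sq₀ (Real.cosh_pos _).le (by positivity)).1 h1

/-- The right side is ½ A f₂ A⁻¹ in the basis f₂, -f₃, f₁: the map to the cylinder lifts the adjoint
orbit map of f₂. In particular it is polynomial in the entries. -/
theorem cover_cylinderMap (A : SL2) : cover (cylinderMap A) =
    (⟨(A 0 0 ^ 2 - A 0 1 ^ 2 - A 1 0 ^ 2 + A 1 1 ^ 2) / 4,
      (A 0 0 * A 1 0 - A 0 1 * A 1 1) / 2⟩,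
      (A 0 0 ^ 2 - A 0 1 ^ 2 - A 1 1 ^ 2 + A 1 0 ^ 2) / 4) := by
  refine Prod.ext ?_ ?_
  · have h : (cover (cylinderMap A)).1 =
        ((Real.cosh (cylinderHeight A) / 2 : ℝ) : ℂ) * (cylinderAngle A : ℂ) ^ 2 := rfl
    have h2 : (cover (cylinderMap A)).1 = columnSum A * columnDiff A / 4 := by
      rw [h, cosh_cylinderHeight, ← bisector_sq]
      push_cast
      ring
    rw [h2]
    have h4 : columnSum A * columnDiff A / 4 =
        ((1 / 4 : ℝ) : ℂ) * (columnSum A * columnDiff A) := by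
      push_cast
      ring
    rw [h4]
    refine Complex.ext ?_ ?_
    · rw [Complex.re_ofReal_mul, Complex.mul_re]
      simp only [columnSum, columnDiff]
      ring
    · rw [Complex.im_ofReal_mul, Complex.mul_im]
      simp only [columnSum, columnDiff]
      ring
  · have h : (cover (cylinderMap A)).2 = Real.sinh (cylinderHeight A) / 2 := rfl
    rw [h, cylinderHeight, Real.sinh_arsinh]
    ring

theorem σ₂_mul_entries (A : SL2) (t : ℝ) (i : Fin 2) :
    (A * σ₂ t) i 0 = A i 0 * Real.cosh t + A i 1 * Real.sinh t ∧
      (A * σ₂ t) i 1 = A i 0 * Real.sinh t + A i 1 * Real.cosh t :=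
  ⟨sl2_mul_apply A (σ₂ t) i 0, sl2_mul_apply A (σ₂ t) i 1⟩

/-- The vector (1, 1) is an eigenvector of exp(tf₂) with eigenvalue eᵗ; likewise (1, -1) has
eigenvalue e⁻ᵗ. -/
theorem columnSum_mul_σ₂ (A : SL2) (t : ℝ) :
    columnSum (A * σ₂ t) = ((Real.exp t : ℝ) : ℂ) * columnSum A := by
  obtain ⟨h1, h2⟩ := σ₂_mul_entries A t 0
  obtain ⟨h3, h4⟩ := σ₂_mul_entries A t 1
  rw [columnSum, h1, h2, h3, h4, ← Real.cosh_add_sinh]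
  refine Complex.ext ?_ ?_
  · rw [Complex.re_ofReal_mul]
    simp only [columnSum]
    ring
  · rw [Complex.im_ofReal_mul]
    simp only [columnSum]
    ring

theorem columnDiff_mul_σ₂ (A : SL2) (t : ℝ) :
    columnDiff (A * σ₂ t) = ((Real.exp (-t) : ℝ) : ℂ) * columnDiff A := by
  obtain ⟨h1, h2⟩ := σ₂_mul_entries A t 0
  obtain ⟨h3, h4⟩ := σ₂_mul_entries A t 1
  rw [columnDiff, h1, h2, h3, h4, ← Real.cosh_sub_sinh]
  refine Complex.ext ?_ ?_
  · rw [Complex.re_ofReal_mul]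
    simp only [columnDiff]
    ring
  · rw [Complex.im_ofReal_mul]
    simp only [columnDiff]
    ring

theorem norm_exp_mul (t : ℝ) (z : ℂ) : ‖((Real.exp t : ℝ) : ℂ) * z‖ = Real.exp t * ‖z‖ := by
  rw [norm_mul, Complex.norm_real, Real.norm_of_nonneg (Real.exp_pos t).le]

/-- P and Q are multiplied by positive numbers with product 1, so ‖Q‖P and ‖P‖Q do not change. -/
theorem cylinderMap_mul_σ₂ (A : SL2) (t : ℝ) : cylinderMap (A * σ₂ t) = cylinderMap A := by
  have hb : bisector (A * σ₂ t) = bisector A := by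
    have he : ((Real.exp t : ℝ) : ℂ) * ((Real.exp (-t) : ℝ) : ℂ) = 1 := by
      rw [← Complex.ofReal_mul, ← Real.exp_add, add_neg_cancel, Real.exp_zero, Complex.ofReal_one]
    rw [bisector, columnSum_mul_σ₂, columnDiff_mul_σ₂, norm_exp_mul, norm_exp_mul, bisector,
      Complex.ofReal_mul, Complex.ofReal_mul]
    linear_combination ((‖columnDiff A‖ : ℂ) * columnSum A +
      (‖columnSum A‖ : ℂ) * columnDiff A) * he
  refine Prod.ext (Circle.ext ?_) ?_
  · exact (coe_cylinderAngle _).trans ((congrArg (fun v : ℂ => v / (‖v‖ : ℂ)) hb).trans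
      (coe_cylinderAngle A).symm)
  · have h := Real.cosh_sq t
    obtain ⟨h1, h2⟩ := σ₂_mul_entries A t 0
    obtain ⟨h3, h4⟩ := σ₂_mul_entries A t 1
    refine congrArg Real.arsinh ?_
    rw [h1, h2, h3, h4]
    linear_combination ((A 0 0 ^ 2 - A 0 1 ^ 2 - A 1 1 ^ 2 + A 1 0 ^ 2) / 2) * h

/-- The metric of the cylinder is pulled back by `cover`, so only the composite with `cover` has to
be differentiated. It is polynomial, and no derivative of a norm or of `arsinh` occurs. -/
theorem dVec_cover_cylinderMap_frame (k : Fin 4) (x : G) :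
    dVec IC cover (cylinderMap x.2)
      (dMap IG IC (fun y : G => cylinderMap y.2) x (frame k x)) =
    (⟨(x.2 0 0 * entryDeriv k x.2 0 0 - x.2 0 1 * entryDeriv k x.2 0 1 -
        x.2 1 0 * entryDeriv k x.2 1 0 + x.2 1 1 * entryDeriv k x.2 1 1) / 2,
      (entryDeriv k x.2 0 0 * x.2 1 0 + x.2 0 0 * entryDeriv k x.2 1 0 -
        (entryDeriv k x.2 0 1 * x.2 1 1 + x.2 0 1 * entryDeriv k x.2 1 1)) / 2⟩,
      (x.2 0 0 * entryDeriv k x.2 0 0 - x.2 0 1 * entryDeriv k x.2 0 1 -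
        x.2 1 1 * entryDeriv k x.2 1 1 + x.2 1 0 * entryDeriv k x.2 1 0) / 2) := by
  have hs : ContMDiff IG IC ∞ (fun y : G => cylinderMap y.2) :=
    contMDiff_cylinderMap.comp contMDiff_snd
  have h1 := dVec_comp (I := IG) (contMDiff_cover.mdifferentiableAt (by simp))
    (hs.mdifferentiableAt (x := x) (by simp)) (frame k x)
  rw [← h1]
  have h2 := hasDerivAt_frame ((contMDiff_cover.comp hs).mdifferentiableAt (x := x) (by simp)) k
  refine h2.unique ?_
  have e : ∀ i j, HasDerivAt (fun t => (x * σ k t).2 i j) (entryDeriv k x.2 i j) 0 :=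
    hasDerivAt_gEntry_frame k x
  have z : ∀ i j, (x * σ k 0).2 i j = x.2 i j := by
    intro i j
    rw [σ_zero, mul_one]
  have q := fun i j => (e i j).pow 2
  have h3 := ((((q 0 0).sub (q 0 1)).sub (q 1 0)).add (q 1 1)).div_const 4
  have h4 := (((e 0 0).mul (e 1 0)).sub ((e 0 1).mul (e 1 1))).div_const 2
  have h5 := ((((q 0 0).sub (q 0 1)).sub (q 1 1)).add (q 1 0)).div_const 4
  refine (((hasDerivAt_complexMk h3 h4).prodMk h5).congr_of_eventuallyEq
    (Filter.Eventually.of_forall fun t => cover_cylinderMap _)).congr_deriv ?_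
  simp only [z]
  refine Prod.ext (Complex.ext ?_ ?_) ?_
  · simp
    ring
  · simp
  · simp
    ring

theorem isFrameAdapted_cylinderMap :
    IsFrameAdapted IC hyp11 (fun x : G => cylinderMap x.2) {0, 2} where
  zero x i hi := by
    have hs : ContMDiff IG IC ∞ (fun y : G => cylinderMap y.2) :=
      contMDiff_cylinderMap.comp contMDiff_snd
    have hi' : i = 0 ∨ i = 2 := by simpa using hi
    rcases hi' with rfl | rfl
    · exact dMap_frame_eq_zero hs 0 (fun x t => congrArg cylinderMap (mul_one x.2)) x
    · exact dMap_frame_eq_zero hs 2 (fun x t => cylinderMap_mul_σ₂ x.2 t) x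
  ortho x i hi j hj := by
    have hd := sl_det x.2
    have hi' : i = 1 ∨ i = 3 := by revert hi; fin_cases i <;> simp
    have hj' : j = 1 ∨ j = 3 := by revert hj; fin_cases j <;> simp
    refine (hyp11_apply _ _ _).trans ?_
    rw [dVec_cover_cylinderMap_frame, dVec_cover_cylinderMap_frame]
    rcases hi' with rfl | rfl <;> rcases hj' with rfl | rfl <;>
      simp only [flatForm, entryDeriv, frameMatrix, sign, Matrix.cons_val, Matrix.of_apply, if_pos,
        Fin.reduceEq, if_false]
    -- The squares of the images of f₁ and f₃ are -det² and det².
    · linear_combination (-(x.2 0 0 * x.2 1 1 - x.2 0 1 * x.2 1 0 + 1)) * hd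
    · ring
    · ring
    · linear_combination (x.2 0 0 * x.2 1 1 - x.2 0 1 * x.2 1 0 + 1) * hd

/-- The section of the projection of `SL(2, ℝ)` to the cylinder. -/
def cylinderSection (n : Circle × ℝ) : SL2 :=
  ⟨!![(n.1 : ℂ).re * Real.exp (n.2 / 2), -((n.1 : ℂ).im * Real.exp (-(n.2 / 2)));
      (n.1 : ℂ).im * Real.exp (n.2 / 2), (n.1 : ℂ).re * Real.exp (-(n.2 / 2))], by
    have h : (n.1 : ℂ).re * (n.1 : ℂ).re + (n.1 : ℂ).im * (n.1 : ℂ).im = 1 := by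
      rw [← Complex.normSq_apply, Circle.normSq_coe]
    have he : Real.exp (n.2 / 2) * Real.exp (-(n.2 / 2)) = 1 := by
      rw [← Real.exp_add, add_neg_cancel, Real.exp_zero]
    rw [Matrix.det_fin_two_of]
    linear_combination ((n.1 : ℂ).re * (n.1 : ℂ).re + (n.1 : ℂ).im * (n.1 : ℂ).im) * he + h⟩

theorem continuous_cylinderSection : Continuous cylinderSection := by
  have h1 : Continuous fun n : Circle × ℝ => (n.1 : ℂ).re :=
    Complex.continuous_re.comp (contMDiff_coe_circle.continuous.comp continuous_fst)
  have h2 : Continuous fun n : Circle × ℝ => (n.1 : ℂ).im :=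
    Complex.continuous_im.comp (contMDiff_coe_circle.continuous.comp continuous_fst)
  have h3 : Continuous fun n : Circle × ℝ => Real.exp (n.2 / 2) := by fun_prop
  have h4 : Continuous fun n : Circle × ℝ => Real.exp (-(n.2 / 2)) := by fun_prop
  refine continuous_sl2_of_entries fun i j => ?_
  fin_cases i <;> fin_cases j
  · exact h1.mul h3
  · exact (h2.mul h4).neg
  · exact h2.mul h3
  · exact h1.mul h4

theorem cylinderAngle_eq {A : SL2} {u : Circle} {r : ℝ} (hr : 0 < r)
    (h : bisector A = (r : ℂ) * (u : ℂ)) : cylinderAngle A = u := by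
  apply Circle.ext
  rw [coe_cylinderAngle, h, norm_mul, Circle.norm_coe, Complex.norm_real,
    Real.norm_of_nonneg hr.le, mul_one]
  have : (r : ℂ) ≠ 0 := by exact_mod_cast hr.ne'
  field_simp

/-- The difference ‖P‖² - ‖Q‖² is four times the inner product of the columns. -/
theorem norm_column_eq_iff (A : SL2) :
    ‖columnSum A‖ = ‖columnDiff A‖ ↔ A 0 0 * A 0 1 + A 1 0 * A 1 1 = 0 := by
  rw [← sq_eq_sq₀ (norm_nonneg _) (norm_nonneg _), ← Complex.normSq_eq_norm_sq,
    ← Complex.normSq_eq_norm_sq]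
  simp only [columnSum, columnDiff, Complex.normSq_mk]
  constructor <;> intro h <;> linarith

/-- For equal norms the bisector is ‖P‖(P + Q), and P + Q is twice the first column. -/
theorem bisector_of_norm_eq {A : SL2} (h : ‖columnSum A‖ = ‖columnDiff A‖) :
    bisector A = ((2 * ‖columnSum A‖ : ℝ) : ℂ) * (⟨A 0 0, A 1 0⟩ : ℂ) := by
  rw [bisector, ← h]
  refine Complex.ext ?_ ?_
  · rw [Complex.add_re, Complex.re_ofReal_mul, Complex.re_ofReal_mul, Complex.re_ofReal_mul]
    simp only [columnSum, columnDiff]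
    ring
  · rw [Complex.add_im, Complex.im_ofReal_mul, Complex.im_ofReal_mul, Complex.im_ofReal_mul]
    simp only [columnSum, columnDiff]
    ring

theorem cylinderMap_cylinderSection (n : Circle × ℝ) : cylinderMap (cylinderSection n) = n := by
  have h : (n.1 : ℂ).re * (n.1 : ℂ).re + (n.1 : ℂ).im * (n.1 : ℂ).im = 1 := by
    rw [← Complex.normSq_apply, Circle.normSq_coe]
  have e00 : cylinderSection n 0 0 = (n.1 : ℂ).re * Real.exp (n.2 / 2) := rfl
  have e01 : cylinderSection n 0 1 = -((n.1 : ℂ).im * Real.exp (-(n.2 / 2))) := rfl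
  have e10 : cylinderSection n 1 0 = (n.1 : ℂ).im * Real.exp (n.2 / 2) := rfl
  have e11 : cylinderSection n 1 1 = (n.1 : ℂ).re * Real.exp (-(n.2 / 2)) := rfl
  have hn : ‖columnSum (cylinderSection n)‖ = ‖columnDiff (cylinderSection n)‖ := by
    rw [norm_column_eq_iff, e00, e01, e10, e11]
    ring
  refine Prod.ext ?_ ?_
  -- The columns of the section are orthogonal, so the bisector is 2‖P‖ times the first column,
  -- which is e^(s/2) u.
  · refine cylinderAngle_eq (r := 2 * ‖columnSum (cylinderSection n)‖ * Real.exp (n.2 / 2)) ?_ ?_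
    · have := norm_pos_iff.2 (columnSum_ne (cylinderSection n))
      positivity
    · rw [bisector_of_norm_eq hn, e00, e10]
      refine Complex.ext ?_ ?_
      · rw [Complex.re_ofReal_mul, Complex.re_ofReal_mul]
        ring
      · rw [Complex.im_ofReal_mul, Complex.im_ofReal_mul]
        ring
  · have hp : Real.exp (n.2 / 2) * Real.exp (n.2 / 2) = Real.exp n.2 := by
      rw [← Real.exp_add, add_halves]
    have hm : Real.exp (-(n.2 / 2)) * Real.exp (-(n.2 / 2)) = Real.exp (-n.2) := by
      rw [← Real.exp_add, ← neg_add, add_halves]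
    refine Eq.trans (congrArg Real.arsinh ?_) (Real.arsinh_sinh n.2)
    rw [e00, e01, e10, e11, Real.sinh_eq, ← hp, ← hm]
    linear_combination ((Real.exp (n.2 / 2) * Real.exp (n.2 / 2) -
      Real.exp (-(n.2 / 2)) * Real.exp (-(n.2 / 2))) / 2) * h

/-- A matrix of determinant 1 with orthogonal columns is determined by its first column: the second
one is the first turned by a right angle and divided by its squared length m. The angle is the
direction of the first column and the height is log m. -/
theorem cylinderSection_cylinderMap {A : SL2} (h : ‖columnSum A‖ = ‖columnDiff A‖) :
    cylinderSection (cylinderMap A) = A := by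
  have h0 := (norm_column_eq_iff A).1 h
  have hd := sl_det A
  have hm : 0 < A 0 0 ^ 2 + A 1 0 ^ 2 :=
    lt_of_le_of_ne (by positivity) (Ne.symm (sl_normSq_ne A))
  set m := A 0 0 ^ 2 + A 1 0 ^ 2 with hm_def
  have e1 : A 0 1 = -A 1 0 / m := by
    rw [eq_div_iff hm.ne', hm_def]
    linear_combination A 0 0 * h0 - A 1 0 * hd
  have e2 : A 1 1 = A 0 0 / m := by
    rw [eq_div_iff hm.ne', hm_def]
    linear_combination A 1 0 * h0 + A 0 0 * hd
  have hs : cylinderHeight A = Real.log m := by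
    refine Eq.trans (congrArg Real.arsinh ?_) (Real.arsinh_sinh (Real.log m))
    rw [Real.sinh_log hm, e1, e2]
    field_simp
    rw [hm_def]
    ring
  have hexp : Real.exp (Real.log m / 2) = Real.sqrt m := by
    rw [Real.exp_half, Real.exp_log hm]
  have hsq := Real.sq_sqrt hm.le
  have hpos := Real.sqrt_pos.2 hm
  have hP := norm_pos_iff.2 (columnSum_ne A)
  have hz : ‖(⟨A 0 0, A 1 0⟩ : ℂ)‖ = Real.sqrt m := by
    rw [Complex.norm_def, Complex.normSq_mk, hm_def, pow_two, pow_two]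
  have hu : (cylinderAngle A : ℂ) = ⟨A 0 0 / Real.sqrt m, A 1 0 / Real.sqrt m⟩ := by
    rw [coe_cylinderAngle, bisector_of_norm_eq h, norm_mul, hz, Complex.norm_real,
      Real.norm_of_nonneg (by positivity)]
    have hc : ((2 * ‖columnSum A‖ : ℝ) : ℂ) ≠ 0 := by
      exact_mod_cast (by positivity : (2 * ‖columnSum A‖ : ℝ) ≠ 0)
    rw [Complex.ofReal_mul _ (Real.sqrt m), mul_div_mul_left _ _ hc]
    refine Complex.ext ?_ ?_
    · rw [Complex.div_ofReal_re]
    · rw [Complex.div_ofReal_im]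
  have hre : ((cylinderMap A).1 : ℂ).re = A 0 0 / Real.sqrt m := congrArg Complex.re hu
  have him : ((cylinderMap A).1 : ℂ).im = A 1 0 / Real.sqrt m := congrArg Complex.im hu
  have h2 : (cylinderMap A).2 = Real.log m := hs
  ext i j
  fin_cases i <;> fin_cases j <;>
    simp only [cylinderSection, hre, him, h2, Real.exp_neg, hexp, Matrix.of_apply,
      Matrix.cons_val, Fin.zero_eta, Fin.mk_one]
  · field_simp
  · rw [e1]
    field_simp
    rw [hsq]
  · field_simp
  · rw [e2]
    field_simp
    rw [hsq]

/-- Every A is a rotation times a diagonal matrix times exp(tf₂): right multiplication by exp(-tf₂)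
can equalize ‖P‖ and ‖Q‖, and the result lies in the image of the section. -/
theorem exists_eq_cylinderSection_mul (A : SL2) :
    ∃ t, cylinderSection (cylinderMap A) * σ₂ t = A := by
  have hP := norm_pos_iff.2 (columnSum_ne A)
  have hQ := norm_pos_iff.2 (columnDiff_ne A)
  -- The norms become e⁻ᵗ‖P‖ and eᵗ‖Q‖, which are equal when e²ᵗ = ‖P‖/‖Q‖.
  set t := Real.log (‖columnSum A‖ / ‖columnDiff A‖) / 2 with ht
  have hs : σ₂ (-t) * σ₂ t = 1 := by
    have h := σ_add 2 (-t) t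
    rw [neg_add_cancel, σ_zero] at h
    exact (congrArg Prod.snd h).symm
  have he : Real.exp t * Real.exp t = ‖columnSum A‖ / ‖columnDiff A‖ := by
    rw [← Real.exp_add, ht, add_halves, Real.exp_log (by positivity)]
  have hn : ‖columnSum (A * σ₂ (-t))‖ = ‖columnDiff (A * σ₂ (-t))‖ := by
    rw [columnSum_mul_σ₂, columnDiff_mul_σ₂, norm_exp_mul, norm_exp_mul, neg_neg, Real.exp_neg]
    have := Real.exp_pos t
    field_simp
    rw [pow_two, he]
    field_simp
  refine ⟨t, ?_⟩
  rw [← cylinderMap_mul_σ₂ A (-t), cylinderSection_cylinderMap hn, mul_assoc, hs, mul_one]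

end CylinderBase

/-! ### Powers of elements close to 1 and the exponential -/

section Banach

open Filter Topology

theorem norm_pow_sub_pow_le {𝔸 : Type*} [NormedRing 𝔸] [NormOneClass 𝔸] (a b : 𝔸) {r : ℝ} (ha : ‖a‖ ≤ r) (hb : ‖b‖ ≤ r) (m : ℕ) :
    ‖a ^ (m + 1) - b ^ (m + 1)‖ ≤ (m + 1) * r ^ m * ‖a - b‖ := by
  have hr : 0 ≤ r := (norm_nonneg a).trans ha
  induction m with
  | zero => simp
  | succ m ih =>
    have h : a ^ (m + 2) - b ^ (m + 2) = a ^ (m + 1) * (a - b) + (a ^ (m + 1) - b ^ (m + 1)) * b := by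
      rw [pow_succ a (m + 1), pow_succ b (m + 1)]
      noncomm_ring
    have ha' : ‖a ^ (m + 1)‖ ≤ r ^ (m + 1) := (norm_pow_le a _).trans (by gcongr)
    calc ‖a ^ (m + 2) - b ^ (m + 2)‖
        ≤ ‖a ^ (m + 1)‖ * ‖a - b‖ + ‖a ^ (m + 1) - b ^ (m + 1)‖ * ‖b‖ := by
          rw [h]
          exact (norm_add_le _ _).trans (add_le_add (norm_mul_le _ _) (norm_mul_le _ _))
      _ ≤ r ^ (m + 1) * ‖a - b‖ + ((m + 1) * r ^ m * ‖a - b‖) * r := by gcongr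
      _ = ((m + 1 : ℕ) + 1) * r ^ (m + 1) * ‖a - b‖ := by push_cast; ring

variable {𝔸 : Type*} [NormedRing 𝔸] [NormedAlgebra ℝ 𝔸] [CompleteSpace 𝔸]
  {ι : Type*} {l : Filter ι}

theorem hasDerivAt_exp_smul_zero (X : 𝔸) :
    HasDerivAt (fun t : ℝ => NormedSpace.exp (t • X)) X 0 := by
  have h := hasDerivAt_exp_smul_const (𝕂 := ℝ) X (0 : ℝ)
  rwa [zero_smul, NormedSpace.exp_zero, one_mul] at h

theorem contDiff_exp_smul (X : 𝔸) : ContDiff ℝ ∞ (fun t : ℝ => NormedSpace.exp (t • X)) := by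
  have h : ContDiff ℝ ∞ (NormedSpace.exp : 𝔸 → 𝔸) :=
    contDiff_iff_contDiffAt.2 fun x => (NormedSpace.exp_analytic (𝕂 := ℝ) x).contDiffAt
  exact h.comp (contDiff_id.smul contDiff_const)

theorem exp_add_smul (X : 𝔸) (s t : ℝ) :
    NormedSpace.exp ((s + t) • X) = NormedSpace.exp (s • X) * NormedSpace.exp (t • X) := by
  let := NormedAlgebra.restrictScalars ℚ ℝ 𝔸
  rw [add_smul]
  exact NormedSpace.exp_add_of_commute (((Commute.refl X).smul_left s).smul_right t)

theorem exp_nsmul_smul (X : 𝔸) (t : ℝ) (m : ℕ) :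
    NormedSpace.exp (t • X) ^ m = NormedSpace.exp ((m * t) • X) := by
  induction m with
  | zero => simp
  | succ m ih =>
    rw [pow_succ, ih, ← exp_add_smul]
    congr 2
    push_cast
    ring

theorem tendsto_floor_div_mul {ε : ι → ℝ} (hε : Tendsto ε l (𝓝[>] 0)) {t : ℝ} (ht : 0 ≤ t) :
    Tendsto (fun i => (⌊t / ε i⌋₊ : ℝ) * ε i) l (𝓝 t) := by
  have h0 : Tendsto ε l (𝓝 0) := hε.mono_right nhdsWithin_le_nhds
  have hpos : ∀ᶠ i in l, 0 < ε i := hε.eventually self_mem_nhdsWithin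
  have h1 : Tendsto (fun i => t - ε i) l (𝓝 t) := by simpa using tendsto_const_nhds.sub h0
  refine tendsto_of_tendsto_of_tendsto_of_le_of_le' h1 tendsto_const_nhds ?_ ?_
  · filter_upwards [hpos] with i hi
    have h := Nat.lt_floor_add_one (t / ε i)
    rw [div_lt_iff₀ hi] at h
    linarith
  · filter_upwards [hpos] with i hi
    have h := Nat.floor_le (div_nonneg ht hi.le)
    rwa [le_div_iff₀ hi] at h

/-- If `y = 1 + ε (X + o(1))` with `ε → 0`, then the powers of `y` with exponent `t / ε` tend to
`exp (t X)`. -/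
theorem tendsto_pow_floor_exp [NormOneClass 𝔸] {y : ι → 𝔸} {ε : ι → ℝ} {X : 𝔸} (hε : Tendsto ε l (𝓝[>] 0))
    (hy : Tendsto (fun i => (ε i)⁻¹ • (y i - 1)) l (𝓝 X)) {t : ℝ} (ht : 0 ≤ t) :
    Tendsto (fun i => y i ^ ⌊t / ε i⌋₊) l (𝓝 (NormedSpace.exp (t • X))) := by
  have hpos : ∀ᶠ i in l, 0 < ε i := hε.eventually self_mem_nhdsWithin
  have hne : Tendsto ε l (𝓝[≠] 0) := hε.mono_right (nhdsWithin_mono _ fun _ h => ne_of_gt h)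
  have hm := tendsto_floor_div_mul hε ht
  -- The comparison is with exp(εX), whose powers are known exactly: the power with exponent ⌊t/ε⌋
  -- is exp(⌊t/ε⌋ε X), and ⌊t/ε⌋ε tends to t.
  set z : ι → 𝔸 := fun i => NormedSpace.exp (ε i • X) with hz_def
  have hz : Tendsto (fun i => (ε i)⁻¹ • (z i - 1)) l (𝓝 X) := by
    have h := (hasDerivAt_iff_tendsto_slope_zero.1 (hasDerivAt_exp_smul_zero X)).comp hne
    simpa [Function.comp_def, hz_def] using h
  have hzm : Tendsto (fun i => z i ^ ⌊t / ε i⌋₊) l (𝓝 (NormedSpace.exp (t • X))) := by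
    simp only [hz_def, exp_nsmul_smul]
    exact ((contDiff_exp_smul X).continuous.tendsto t).comp hm
  -- Elements 1 + ε(X + o(1)) have norm at most 1 + ε(‖X‖ + 1), hence at most exp(ε(‖X‖ + 1)); their
  -- powers up to t/ε stay bounded.
  have hb : ∀ {w : ι → 𝔸}, Tendsto (fun i => (ε i)⁻¹ • (w i - 1)) l (𝓝 X) →
      ∀ᶠ i in l, ‖w i‖ ≤ Real.exp (ε i * (‖X‖ + 1)) := by
    intro w hw
    have h1 : ∀ᶠ i in l, ‖(ε i)⁻¹ • (w i - 1)‖ < ‖X‖ + 1 :=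
      hw.norm.eventually (gt_mem_nhds (lt_add_one _))
    filter_upwards [h1, hpos] with i h2 hi
    rw [norm_smul, norm_inv, Real.norm_of_nonneg hi.le, inv_mul_lt_iff₀ hi] at h2
    calc ‖w i‖ = ‖(w i - 1) + 1‖ := by rw [sub_add_cancel]
      _ ≤ ‖w i - 1‖ + ‖(1 : 𝔸)‖ := norm_add_le _ _
      _ ≤ ε i * (‖X‖ + 1) + 1 := by rw [norm_one]; linarith
      _ ≤ Real.exp (ε i * (‖X‖ + 1)) := Real.add_one_le_exp _
  have hd : Tendsto (fun i => ‖(ε i)⁻¹ • (y i - z i)‖) l (𝓝 0) := by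
    have h := (hy.sub hz).norm
    rw [sub_self, norm_zero] at h
    refine h.congr fun i => ?_
    rw [← smul_sub, sub_sub_sub_cancel_right]
  have hdiff : Tendsto (fun i => y i ^ ⌊t / ε i⌋₊ - z i ^ ⌊t / ε i⌋₊) l (𝓝 0) := by
    -- The difference of the powers is at most the exponent, times a bounded factor, times ‖y - z‖.
    -- The exponent is about t/ε and ‖y - z‖ is o(ε).
    have hbound : Tendsto (fun i => (⌊t / ε i⌋₊ : ℝ) * ε i *
        Real.exp ((⌊t / ε i⌋₊ : ℝ) * ε i * (‖X‖ + 1)) * ‖(ε i)⁻¹ • (y i - z i)‖) l (𝓝 0) := by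
      have h := (hm.mul ((Real.continuous_exp.tendsto _).comp (hm.mul_const (‖X‖ + 1)))).mul hd
      rw [mul_zero] at h
      exact h
    refine squeeze_zero_norm' ?_ hbound
    filter_upwards [hb hy, hb hz, hpos] with i h1 h2 hi
    rcases Nat.eq_zero_or_pos ⌊t / ε i⌋₊ with h0 | h0
    · rw [h0]
      simp
    · obtain ⟨m, hm'⟩ := Nat.exists_eq_succ_of_ne_zero h0.ne'
      rw [hm']
      refine (norm_pow_sub_pow_le _ _ h1 h2 m).trans ?_
      rw [norm_smul, norm_inv, Real.norm_of_nonneg hi.le, ← Real.exp_nat_mul]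
      have hexp : Real.exp (m * (ε i * (‖X‖ + 1))) ≤
          Real.exp ((m.succ : ℕ) * ε i * (‖X‖ + 1)) := by
        apply Real.exp_le_exp.2
        push_cast
        have : 0 ≤ ε i * (‖X‖ + 1) := by positivity
        linarith
      calc ((m : ℝ) + 1) * Real.exp (m * (ε i * (‖X‖ + 1))) * ‖y i - z i‖
          ≤ ((m : ℝ) + 1) * Real.exp ((m.succ : ℕ) * ε i * (‖X‖ + 1)) * ‖y i - z i‖ := by gcongr
        _ = (m.succ : ℕ) * ε i * Real.exp ((m.succ : ℕ) * ε i * (‖X‖ + 1)) *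
            ((ε i)⁻¹ * ‖y i - z i‖) := by
          push_cast
          field_simp
  have h := hdiff.add hzm
  rw [zero_add] at h
  refine h.congr fun i => ?_
  rw [sub_add_cancel]

end Banach

/-! ### Uniqueness of one-parameter subgroups -/

section OneParameter

/-- A one-parameter subgroup of `G` with the initial velocity of `σ k` is `σ k`. -/
theorem oneParameter_eq_σ {γ : ℝ → G} (hγ : ContMDiff 𝓘(ℝ, ℝ) IG ∞ γ)
    (hadd : ∀ s t, γ (s + t) = γ s * γ t) (k : Fin 4)
    (hv : dMap 𝓘(ℝ, ℝ) IG γ 0 1 = (f k : ℝ × (ℂ × ℝ))) (t : ℝ) : γ t = σ k t := by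
  have h0 : γ 0 = 1 := by
    have h := hadd 0 0
    rw [add_zero] at h
    exact left_eq_mul.1 h
  have hinv : ∀ t, σ k (-t) * σ k t = 1 := fun t => by
    rw [← σ_add, neg_add_cancel, σ_zero]
  have hm := hγ.mdifferentiableAt (x := (0 : ℝ)) (by simp)
  have hT : HasDerivAt (fun t => tCoord (γ t)) (frameTime k) 0 := by
    have h := hasDerivAt_comp_curve (q := tCoord) (contMDiff_tCoord.mdifferentiableAt (by simp)) hm
    rwa [dVec_tCoord, hv, f_apply] at h
  have hE : ∀ i j, HasDerivAt (fun t => (γ t).2 i j) (frameMatrix k i j) 0 := by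
    intro i j
    have h := hasDerivAt_comp_curve (q := fun x : G => x.2 i j)
      ((contMDiff_gEntry i j).mdifferentiableAt (by simp)) hm
    rw [dVec_gEntry, hv, h0] at h
    exact h.congr_deriv (dEntry_f k i j)
  have hS : ∀ i j, HasDerivAt (fun t => (σ k (-t)).2 i j) (-frameMatrix k i j) 0 := by
    intro i j
    have h : HasDerivAt (fun t => (σ k t).2 i j) (frameMatrix k i j) (-(0 : ℝ)) := by
      rw [neg_zero]
      exact hasDerivAt_σ_entry k i j
    have h2 := h.scomp (0 : ℝ) (hasDerivAt_neg (0 : ℝ))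
    have h3 : HasDerivAt (fun t => (σ k (-t)).2 i j) _ 0 := h2
    exact h3.congr_deriv (by simp)
  -- The curve γ(t) σₖ(-t) has velocity 0 at t = 0 because the two velocities cancel.
  have hw : ∀ i j, HasDerivAt (fun t => (γ t * σ k (-t)).2 i j) 0 0 := by
    intro i j
    simp only [Prod.snd_mul, sl2_mul_apply]
    refine (((hE i 0).mul (hS 0 j)).add ((hE i 1).mul (hS 1 j))).congr_deriv ?_
    rw [neg_zero, h0, σ_zero]
    fin_cases i <;> fin_cases j <;> simp
  -- Both factors are homomorphisms, so the curve at s is γ(t), times the same curve at s - t, times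
  -- σₖ(-t). This moves the vanishing of the derivative from 0 to every t.
  have hu : ∀ i j t, HasDerivAt (fun t => (γ t * σ k (-t)).2 i j) 0 t := by
    intro i j t
    have e : (fun s => (γ s * σ k (-s)).2 i j) = fun s =>
        (γ t * (γ (s - t) * σ k (-(s - t))) * σ k (-t)).2 i j := by
      funext s
      have h1 : γ s = γ t * γ (s - t) := by rw [← hadd, add_sub_cancel]
      have h2 : σ k (-s) = σ k (-(s - t)) * σ k (-t) := by
        rw [← σ_add]
        congr 1
        ring
      rw [h1, h2]
      simp only [mul_assoc]
    have hw' : ∀ i j, HasDerivAt (fun s => (γ (s - t) * σ k (-(s - t))).2 i j) 0 t := fun i j =>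
      HasDerivAt.comp_sub_const t t (f := fun s => (γ s * σ k (-s)).2 i j)
        (by rw [sub_self]; exact hw i j)
    rw [e]
    simp only [Prod.snd_mul, sl2_mul_apply] at hw' ⊢
    refine (((((hw' 0 0).const_mul ((γ t).2 i 0)).add ((hw' 1 0).const_mul ((γ t).2 i 1))).mul_const
      ((σ k (-t)).2 0 j)).add ((((hw' 0 1).const_mul ((γ t).2 i 0)).add
      ((hw' 1 1).const_mul ((γ t).2 i 1))).mul_const ((σ k (-t)).2 1 j))).congr_deriv ?_
    simp
  have hTu : ∀ t, HasDerivAt (fun t => tCoord (γ t) - frameTime k * t) 0 t := by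
    intro t
    have e : (fun s => tCoord (γ s) - frameTime k * s) = fun s =>
        tCoord (γ t) + tCoord (γ (s - t)) - frameTime k * s := by
      funext s
      rw [← tCoord_mul, ← hadd, add_sub_cancel]
    have h1 : HasDerivAt (fun s => tCoord (γ (s - t))) (frameTime k) t :=
      HasDerivAt.comp_sub_const t t (f := fun s => tCoord (γ s)) (by rw [sub_self]; exact hT)
    rw [e]
    refine ((h1.const_add (tCoord (γ t))).sub
      ((hasDerivAt_id t).const_mul (frameTime k))).congr_deriv ?_
    simp
  have hc : ∀ i j, (γ t * σ k (-t)).2 i j = (1 : SL2) i j := by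
    intro i j
    have h := is_const_of_deriv_eq_zero (fun t => (hu i j t).differentiableAt)
      (fun t => (hu i j t).deriv) t 0
    rwa [h0, neg_zero, σ_zero, one_mul] at h
  have hct : tCoord (γ t) = frameTime k * t := by
    have h := is_const_of_deriv_eq_zero (fun t => (hTu t).differentiableAt)
      (fun t => (hTu t).deriv) t 0
    have h1 : tCoord (1 : G) = 0 := rfl
    rw [h0, h1, mul_zero, sub_zero] at h
    linarith
  refine Prod.ext ?_ ?_
  · have h : tCoord (γ t) = tCoord (σ k t) := by rw [hct, tCoord_σ]
    exact Multiplicative.toAdd.injective h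
  · have h : (γ t * σ k (-t)).2 = 1 := by
      ext i j
      exact hc i j
    have h2 : (γ t).2 = ((γ t * σ k (-t)) * σ k t).2 := by
      rw [mul_assoc, hinv, mul_one]
    rw [h2, Prod.snd_mul, h, one_mul]

theorem σ_mem_of_mem_lieAlgebraOf {K : Subgroup G} {k : Fin 4} (h : f k ∈ lieAlgebraOf IG K)
    (t : ℝ) : σ k t ∈ K := by
  obtain ⟨γ, hγ, hadd, hmem, hv⟩ := h
  rw [← oneParameter_eq_σ hγ hadd k hv t]
  exact hmem t

end OneParameter

/-! ### Limits of directions in closed subgroups -/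

section Directions

open Filter Topology
open scoped Matrix.Norms.Operator

/-- The coordinates of `G` given by the factor `ℝ` and the matrix. -/
def gMatrix (x : G) : ℝ × Matrix (Fin 2) (Fin 2) ℝ := (tCoord x, x.2.1)

theorem gMatrix_injective : Function.Injective gMatrix := by
  intro x y h
  refine Prod.ext ?_ ?_
  · have h1 : tCoord x = tCoord y := congrArg (fun p : ℝ × Matrix (Fin 2) (Fin 2) ℝ => p.1) h
    exact Multiplicative.toAdd.injective h1
  · have h2 : x.2.1 = y.2.1 := congrArg (fun p : ℝ × Matrix (Fin 2) (Fin 2) ℝ => p.2) h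
    exact Subtype.ext h2

theorem continuous_gMatrix : Continuous gMatrix := by
  have h1 : Continuous tCoord := contMDiff_tCoord.continuous
  have h2 : Continuous fun x : G => x.2.1 := continuous_subtype_val.comp continuous_snd
  exact h1.prodMk h2

theorem tCoord_pow (x : G) (m : ℕ) : tCoord (x ^ m) = m * tCoord x := by
  induction m with
  | zero =>
    have h : tCoord (1 : G) = 0 := rfl
    rw [pow_zero, h]
    simp
  | succ m ih =>
    rw [pow_succ, tCoord_mul, ih]
    push_cast
    ring

variable {ι : Type*} {l : Filter ι} [NeBot l]

/-- A limit of directions of elements of a closed subgroup that tend to `1` is the velocity of a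
one-parameter subgroup. -/
theorem exists_mem_lieAlgebraOf_of_tendsto {K : Subgroup G} (hK : IsClosed (K : Set G)) {y : ι → G}
    (hyK : ∀ᶠ i in l, y i ∈ K) {ε : ι → ℝ} (hε : Tendsto ε l (𝓝[>] 0))
    {X : ℝ × Matrix (Fin 2) (Fin 2) ℝ}
    (hX : Tendsto (fun i => (ε i)⁻¹ • (gMatrix (y i) - gMatrix 1)) l (𝓝 X)) :
    ∃ v : ℝ × (ℂ × ℝ), v ∈ lieAlgebraOf IG K ∧ v.1 = X.1 ∧
      ∀ i j, dEntry i j 1 v.2 = X.2 i j := by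
  have hpos : ∀ᶠ i in l, 0 < ε i := hε.eventually self_mem_nhdsWithin
  have hX1 : Tendsto (fun i => (ε i)⁻¹ * tCoord (y i)) l (𝓝 X.1) := by
    have h := (continuous_fst.tendsto X).comp hX
    refine h.congr fun i => ?_
    have h1 : tCoord (1 : G) = 0 := rfl
    simp [gMatrix, h1]
  have hX2 : Tendsto (fun i => (ε i)⁻¹ • ((y i).2.1 - 1)) l (𝓝 X.2) :=
    (continuous_snd.tendsto X).comp hX
  have hM : ∀ t : ℝ, 0 ≤ t → Tendsto (fun i => (y i).2.1 ^ ⌊t / ε i⌋₊) l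
      (𝓝 (NormedSpace.exp (t • X.2))) := fun t ht => tendsto_pow_floor_exp hε hX2 ht
  -- The exponential is a limit of matrices of determinant 1; for negative t its inverse is used.
  have hdet0 : ∀ t : ℝ, 0 ≤ t → (NormedSpace.exp (t • X.2)).det = 1 := by
    intro t ht
    have hc : Continuous fun A : Matrix (Fin 2) (Fin 2) ℝ => A.det := continuous_id.matrix_det
    have h := (hc.tendsto _).comp (hM t ht)
    refine tendsto_nhds_unique h (tendsto_const_nhds.congr fun i => ?_)
    simp [Matrix.det_pow]
  have hdet : ∀ t : ℝ, (NormedSpace.exp (t • X.2)).det = 1 := by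
    intro t
    rcases le_total 0 t with ht | ht
    · exact hdet0 t ht
    · have h := exp_add_smul X.2 t (-t)
      rw [add_neg_cancel, zero_smul, NormedSpace.exp_zero] at h
      have h2 := congrArg Matrix.det h
      rw [Matrix.det_mul, Matrix.det_one] at h2
      have h3 := hdet0 (-t) (by linarith)
      exact (mul_one _).symm.trans ((congrArg (_ * ·) h3.symm).trans h2.symm)
  set γ : ℝ → G := fun t => (Multiplicative.ofAdd (t * X.1), ⟨NormedSpace.exp (t • X.2), hdet t⟩)
    with hγ_def
  have hadd : ∀ s t, γ (s + t) = γ s * γ t := by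
    intro s t
    refine Prod.ext ?_ (Subtype.ext (exp_add_smul X.2 s t))
    exact congrArg Multiplicative.ofAdd (add_mul s t X.1)
  have hzero : γ 0 = 1 := by
    refine Prod.ext (congrArg Multiplicative.ofAdd (zero_mul X.1)) (Subtype.ext ?_)
    have h : NormedSpace.exp ((0 : ℝ) • X.2) = 1 := by rw [zero_smul, NormedSpace.exp_zero]
    exact h
  -- The point γ(t) is a limit of powers of elements of K, and K is closed.
  have hmem0 : ∀ t, 0 ≤ t → γ t ∈ K := by
    intro t ht
    have h1 : Tendsto (fun i => (y i) ^ ⌊t / ε i⌋₊) l (𝓝 (γ t)) := by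
      refine Tendsto.prodMk_nhds ?_ ?_
      · have h2 : Tendsto (fun i => tCoord ((y i) ^ ⌊t / ε i⌋₊)) l (𝓝 (t * X.1)) := by
          refine ((tendsto_floor_div_mul hε ht).mul hX1).congr' ?_
          filter_upwards [hpos] with i hi
          rw [tCoord_pow]
          field_simp
        exact h2
      · refine tendsto_subtype_rng.2 ((hM t ht).congr fun i => ?_)
        exact (Matrix.SpecialLinearGroup.coe_pow _ _).symm
    exact hK.mem_of_tendsto h1 (hyK.mono fun i hi => K.pow_mem hi _)
  have hmem : ∀ t, γ t ∈ K := by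
    intro t
    rcases le_total 0 t with ht | ht
    · exact hmem0 t ht
    · have h := hadd t (-t)
      rw [add_neg_cancel, hzero] at h
      rw [eq_inv_of_mul_eq_one_left h.symm]
      exact K.inv_mem (hmem0 _ (by linarith))
  have hentry : ∀ i j, Continuous fun A : Matrix (Fin 2) (Fin 2) ℝ => A i j := fun i j =>
    continuous_id.matrix_elem i j
  let e : Fin 2 → Fin 2 → Matrix (Fin 2) (Fin 2) ℝ →L[ℝ] ℝ := fun i j =>
    ⟨Matrix.entryLinearMap ℝ ℝ i j, hentry i j⟩
  have hsm : ContMDiff 𝓘(ℝ, ℝ) IG ∞ γ := by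
    refine contMDiff_g_of_coords ?_ fun i j => ?_
    · exact (contDiff_id.mul contDiff_const).contMDiff
    · exact ((e i j).contDiff.comp (contDiff_exp_smul X.2)).contMDiff
  have hm := hsm.mdifferentiableAt (x := (0 : ℝ)) (by simp)
  refine ⟨dMap 𝓘(ℝ, ℝ) IG γ 0 1, ⟨γ, hsm, hadd, hmem, rfl⟩, ?_, fun i j => ?_⟩
  · have h := hasDerivAt_comp_curve (q := tCoord) (contMDiff_tCoord.mdifferentiableAt (by simp)) hm
    rw [dVec_tCoord] at h
    refine h.unique ?_
    have h2 : HasDerivAt (fun t : ℝ => t * X.1) X.1 0 := by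
      simpa using (hasDerivAt_id (0 : ℝ)).mul_const X.1
    exact h2
  · have h := hasDerivAt_comp_curve (q := fun x : G => x.2 i j)
      ((contMDiff_gEntry i j).mdifferentiableAt (by simp)) hm
    rw [dVec_gEntry, hzero] at h
    exact h.unique ((e i j).hasFDerivAt.comp_hasDerivAt 0 (hasDerivAt_exp_smul_zero X.2))

/-- A closed connected subgroup `K` is contained in a subgroup `K₀ ≤ K` as soon as the quotient
by `K₀` has a section `r` none of whose directions at `1` belong to the Lie algebra of `K`. -/
theorem le_of_directions {K K₀ : Subgroup G} (hK : IsClosed (K : Set G))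
    (hconn : IsConnected (K : Set G)) (hle : K₀ ≤ K) {r : G → G} (hr : ContinuousAt r 1)
    (hr1 : r 1 = 1) (hrK : ∀ x, ∃ k ∈ K₀, r x * k = x)
    (hdir : ∀ (l : Filter G) [NeBot l] (ε : G → ℝ) (X : ℝ × Matrix (Fin 2) (Fin 2) ℝ),
      Tendsto (fun x => gMatrix (r x)) l (𝓝 (gMatrix 1)) →
      Tendsto (fun x => (ε x)⁻¹ • (gMatrix (r x) - gMatrix 1)) l (𝓝 X) →
      (∃ v : ℝ × (ℂ × ℝ), v ∈ lieAlgebraOf IG K ∧ v.1 = X.1 ∧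
        ∀ i j, dEntry i j 1 v.2 = X.2 i j) → X = 0) : K ≤ K₀ := by
  have hnear : ∀ᶠ x in 𝓝[(K : Set G)] (1 : G), x ∈ K₀ := by
    by_contra hcon
    have hfr : ∃ᶠ x in 𝓝[(K : Set G)] (1 : G), x ∉ K₀ := not_eventually.1 hcon
    have hne : NeBot (𝓝[(K : Set G)] (1 : G) ⊓ 𝓟 {x | x ∉ K₀}) :=
      frequently_mem_iff_neBot.1 hfr
    -- Along an ultrafilter the unit directions converge, by compactness of the sphere; no
    -- subsequence has to be chosen.
    let U : Ultrafilter G := Ultrafilter.of (𝓝[(K : Set G)] (1 : G) ⊓ 𝓟 {x | x ∉ K₀})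
    have hU : (U : Filter G) ≤ 𝓝[(K : Set G)] (1 : G) ⊓ 𝓟 {x | x ∉ K₀} := Ultrafilter.of_le _
    have hU1 : (U : Filter G) ≤ 𝓝 1 := (hU.trans inf_le_left).trans nhdsWithin_le_nhds
    have hUK : ∀ᶠ x in (U : Filter G), x ∈ K :=
      (hU.trans inf_le_left) self_mem_nhdsWithin
    have hU0 : ∀ᶠ x in (U : Filter G), x ∉ K₀ :=
      (hU.trans inf_le_right) (mem_principal_self _)
    have hlim : Tendsto (fun x => gMatrix (r x)) U (𝓝 (gMatrix 1)) := by
      have h1 : Tendsto r U (𝓝 1) := by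
        have h := hr.tendsto.mono_left hU1
        rwa [hr1] at h
      exact (continuous_gMatrix.tendsto 1).comp h1
    set ε : G → ℝ := fun x => ‖gMatrix (r x) - gMatrix 1‖ with hε_def
    -- If r(x) = 1, then x is its own K₀-component and belongs to K₀, which is excluded along U.
    have hpos : ∀ᶠ x in (U : Filter G), 0 < ε x := by
      filter_upwards [hU0] with x hx
      rw [hε_def, norm_pos_iff, sub_ne_zero]
      intro h
      obtain ⟨k, hk, hkx⟩ := hrK x
      rw [gMatrix_injective h, one_mul] at hkx
      exact hx (hkx ▸ hk)
    have hε : Tendsto ε U (𝓝[>] 0) := by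
      refine tendsto_nhdsWithin_iff.2 ⟨?_, hpos⟩
      have h := (hlim.sub_const (gMatrix 1)).norm
      rwa [sub_self, norm_zero] at h
    set d : G → ℝ × Matrix (Fin 2) (Fin 2) ℝ := fun x => (ε x)⁻¹ • (gMatrix (r x) - gMatrix 1)
      with hd_def
    have hds : ∀ᶠ x in (U : Filter G), d x ∈ Metric.sphere (0 : ℝ × Matrix (Fin 2) (Fin 2) ℝ) 1 := by
      filter_upwards [hpos] with x hx
      rw [mem_sphere_zero_iff_norm, hd_def]
      simp only
      rw [norm_smul, norm_inv, Real.norm_of_nonneg hx.le]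
      exact inv_mul_cancel₀ hx.ne'
    have : ProperSpace (ℝ × Matrix (Fin 2) (Fin 2) ℝ) :=
      FiniteDimensional.proper_real (ℝ × Matrix (Fin 2) (Fin 2) ℝ)
    obtain ⟨X, hXs, hX⟩ := (isCompact_sphere (0 : ℝ × Matrix (Fin 2) (Fin 2) ℝ) 1).ultrafilter_le_nhds
      (U.map d) (le_principal_iff.2 hds)
    have hXt : Tendsto d U (𝓝 X) := hX
    -- r(x) differs from x ∈ K by an element of K₀ ≤ K.
    have hrmem : ∀ᶠ x in (U : Filter G), r x ∈ K := by
      filter_upwards [hUK] with x hx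
      obtain ⟨k, hk, hkx⟩ := hrK x
      rw [eq_mul_inv_of_mul_eq hkx]
      exact K.mul_mem hx (K.inv_mem (hle hk))
    have hX0 := hdir U ε X hlim hXt
      (exists_mem_lieAlgebraOf_of_tendsto hK hrmem hε hXt)
    rw [hX0, mem_sphere_zero_iff_norm, norm_zero] at hXs
    exact zero_ne_one hXs
  -- A subgroup that is a neighbourhood of 1 is open, hence closed, and a connected group has no
  -- other nonempty clopen subset than itself.
  have hopen : IsOpen ((K₀.subgroupOf K : Subgroup K) : Set K) := by
    refine Subgroup.isOpen_of_mem_nhds _ (g := 1) ?_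
    rw [nhds_subtype_eq_comap]
    rw [eventually_nhdsWithin_iff] at hnear
    refine ⟨_, hnear, fun x hx => ?_⟩
    exact hx x.2
  have hclosed := Subgroup.isClosed_of_isOpen _ hopen
  have : ConnectedSpace K := isConnected_iff_connectedSpace.1 hconn
  have huniv := IsClopen.eq_univ (⟨hclosed, hopen⟩ : IsClopen ((K₀.subgroupOf K : Subgroup K) : Set K))
    ⟨1, one_mem _⟩
  intro x hx
  have h : (⟨x, hx⟩ : K) ∈ ((K₀.subgroupOf K : Subgroup K) : Set K) := by
    rw [huniv]
    trivial
  exact h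

end Directions

/-! ### Subgroups generated by the frame and their quotients -/

section FrameSubgroup

open Filter Topology
open scoped Matrix.Norms.Operator

/-- The group generated by two commuting one-parameter groups of the frame. -/
def frameSubgroup (k l : Fin 4) (hkl : ∀ s t, σ k s * σ l t = σ l t * σ k s) : Subgroup G where
  carrier := {x | ∃ s t, σ k s * σ l t = x}
  one_mem' := ⟨0, 0, by rw [σ_zero, σ_zero, mul_one]⟩
  mul_mem' := by
    rintro _ _ ⟨s, t, rfl⟩ ⟨s', t', rfl⟩
    refine ⟨s + s', t + t', ?_⟩
    rw [σ_add, σ_add, mul_assoc, mul_assoc, ← mul_assoc (σ k s'), hkl s' t, mul_assoc]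
  inv_mem' := by
    rintro _ ⟨s, t, rfl⟩
    refine ⟨-s, -t, ?_⟩
    rw [eq_comm, inv_eq_iff_mul_eq_one, hkl (-s), mul_assoc, ← mul_assoc (σ l t), ← σ_add,
      add_neg_cancel, σ_zero, one_mul, ← σ_add, add_neg_cancel, σ_zero]

theorem isConnected_frameSubgroup (k l : Fin 4) (hkl : ∀ s t, σ k s * σ l t = σ l t * σ k s) :
    IsConnected (frameSubgroup k l hkl : Set G) := by
  have h : (frameSubgroup k l hkl : Set G) =
      Set.range fun q : ℝ × ℝ => σ k q.1 * σ l q.2 := by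
    ext x
    exact ⟨fun ⟨s, t, h⟩ => ⟨(s, t), h⟩, fun ⟨q, h⟩ => ⟨q.1, q.2, h⟩⟩
  rw [h]
  exact isConnected_range (((contMDiff_σ k).continuous.comp continuous_fst).mul
    ((contMDiff_σ l).continuous.comp continuous_snd))

theorem frame_one (k : Fin 4) : frame k 1 = f k := by
  have h := dMap_mul_σ k 1
  simp only [one_mul] at h
  exact h.symm.trans (dMap_σ k)

/-- The vector `f k`, as an element of the model space. -/
def frameVector (k : Fin 4) : ℝ × (ℂ × ℝ) := f k

theorem frameVector_combination_fst (a c : ℝ) (k l : Fin 4) :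
    (a • frameVector k + c • frameVector l).1 = a * frameTime k + c * frameTime l := by
  have h : ∀ k, (frameVector k).1 = frameTime k := fun k => congrArg Prod.fst (f_apply k)
  rw [Prod.fst_add, Prod.smul_fst, Prod.smul_fst, h, h]
  rfl

theorem dEntry_frameVector_combination (a c : ℝ) (k l : Fin 4) (i j : Fin 2) :
    dEntry i j 1 (a • frameVector k + c • frameVector l).2 =
      a * frameMatrix k i j + c * frameMatrix l i j := by
  have h : ∀ k, dEntry i j 1 (frameVector k).2 = frameMatrix k i j := fun k => dEntry_f k i j
  rw [Prod.snd_add, Prod.smul_snd, Prod.smul_snd, map_add, map_smul, map_smul, h, h]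
  rfl

/-- The span of two vectors of the frame is contained in the Lie algebra of the subgroup. -/
theorem mem_lieAlgebraOf_frameSubgroup {k l : Fin 4} (hkl : ∀ s t, σ k s * σ l t = σ l t * σ k s)
    (a c : ℝ) : a • f k + c • f l ∈ lieAlgebraOf IG (frameSubgroup k l hkl) := by
  have hk : ContMDiff 𝓘(ℝ, ℝ) IG ∞ (fun t : ℝ => σ k (a * t)) :=
    (contMDiff_σ k).comp (contDiff_const.mul contDiff_id).contMDiff
  have hl : ContMDiff 𝓘(ℝ, ℝ) IG ∞ (fun t : ℝ => σ l (c * t)) :=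
    (contMDiff_σ l).comp (contDiff_const.mul contDiff_id).contMDiff
  have hγ : ContMDiff 𝓘(ℝ, ℝ) IG ∞ (fun t => σ k (a * t) * σ l (c * t)) := hk.mul hl
  have hm := hγ.mdifferentiableAt (x := (0 : ℝ)) (by simp)
  refine ⟨fun t => σ k (a * t) * σ l (c * t), hγ, fun s t => ?_, fun t => ⟨_, _, rfl⟩, ?_⟩
  · simp only
    rw [mul_add, mul_add, σ_add, σ_add, mul_assoc, mul_assoc, ← mul_assoc (σ k (a * t)),
      hkl (a * t) (c * s), mul_assoc]
  have hv : ∀ i j, HasDerivAt (fun t => (σ k (a * t)).2 i j) (a * frameMatrix k i j) 0 := by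
    intro i j
    have h : HasDerivAt (fun t => (σ k t).2 i j) (frameMatrix k i j) (a * (0 : ℝ)) := by
      rw [mul_zero]
      exact hasDerivAt_σ_entry k i j
    have h2 := h.scomp (0 : ℝ) ((hasDerivAt_id (0 : ℝ)).const_mul a)
    have h3 : HasDerivAt (fun t => (σ k (a * t)).2 i j) _ 0 := h2
    exact h3.congr_deriv (by simp)
  have hw : ∀ i j, HasDerivAt (fun t => (σ l (c * t)).2 i j) (c * frameMatrix l i j) 0 := by
    intro i j
    have h : HasDerivAt (fun t => (σ l t).2 i j) (frameMatrix l i j) (c * (0 : ℝ)) := by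
      rw [mul_zero]
      exact hasDerivAt_σ_entry l i j
    have h2 := h.scomp (0 : ℝ) ((hasDerivAt_id (0 : ℝ)).const_mul c)
    have h3 : HasDerivAt (fun t => (σ l (c * t)).2 i j) _ 0 := h2
    exact h3.congr_deriv (by simp)
  have h0 : σ k (a * 0) * σ l (c * 0) = 1 := by rw [mul_zero, mul_zero, σ_zero, σ_zero, mul_one]
  have key : dMap 𝓘(ℝ, ℝ) IG (fun t => σ k (a * t) * σ l (c * t)) 0 1 =
      a • frameVector k + c • frameVector l := by
    refine g_vector_ext (x := 1) ?_ fun i j => ?_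
    · have h := hasDerivAt_comp_curve (q := tCoord) (contMDiff_tCoord.mdifferentiableAt (by simp)) hm
      rw [dVec_tCoord] at h
      refine h.unique ?_
      have e : (fun t => tCoord (σ k (a * t) * σ l (c * t))) =
          fun t => (a * frameTime k + c * frameTime l) * t := by
        funext t
        rw [tCoord_mul, tCoord_σ, tCoord_σ]
        ring
      rw [e, frameVector_combination_fst]
      refine ((hasDerivAt_id (0 : ℝ)).const_mul _).congr_deriv ?_
      simp
    · have h := hasDerivAt_comp_curve (q := fun x : G => x.2 i j)
        ((contMDiff_gEntry i j).mdifferentiableAt (by simp)) hm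
      rw [dVec_gEntry, h0] at h
      refine h.unique ?_
      refine HasDerivAt.congr_deriv ?_ (dEntry_frameVector_combination a c k l i j).symm
      simp only [Prod.snd_mul, sl2_mul_apply]
      refine (((hv i 0).mul (hw 0 j)).add ((hv i 1).mul (hw 1 j))).congr_deriv ?_
      simp only [mul_zero, σ_zero]
      fin_cases i <;> fin_cases j <;> simp
      ring
  exact key

/-- The directions at `1` of the map `r` do not meet the span of `f k` and `f l`. -/
def IsTransverse (r : G → G) (k l : Fin 4) : Prop :=
  ∀ (F : Filter G) [NeBot F] (ε : G → ℝ) (a c : ℝ),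
    (∀ i j, Tendsto (fun x => (r x).2 i j) F (𝓝 ((1 : SL2) i j))) →
    Tendsto (fun x => (ε x)⁻¹ * tCoord (r x)) F (𝓝 (a * frameTime k + c * frameTime l)) →
    (∀ i j, Tendsto (fun x => (ε x)⁻¹ * ((r x).2 i j - (1 : SL2) i j)) F
      (𝓝 (a * frameMatrix k i j + c * frameMatrix l i j))) →
    a * frameTime k + c * frameTime l = 0 ∧
      ∀ i j, a * frameMatrix k i j + c * frameMatrix l i j = 0

/-- A closed connected subgroup whose Lie algebra is spanned by `f k` and `f l` is generated by the
corresponding one-parameter groups, if these have a transversal. -/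
theorem eq_frameSubgroup {k l : Fin 4} (hkl : ∀ s t, σ k s * σ l t = σ l t * σ k s) {r : G → G}
    (hr : ContinuousAt r 1) (hr1 : r 1 = 1) (hrK : ∀ x, ∃ y ∈ frameSubgroup k l hkl, r x * y = x)
    (htr : IsTransverse r k l) {K : Subgroup G}
    (hK : IsClosedConnectedWithLieAlgebra IG K (Submodule.span ℝ {f k, f l})) :
    K = frameSubgroup k l hkl := by
  obtain ⟨hclosed, hconn, hlie⟩ := hK
  have hmem : ∀ i, f i ∈ Submodule.span ℝ {f k, f l} → ∀ t, σ i t ∈ K := fun i hi =>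
    σ_mem_of_mem_lieAlgebraOf (hlie ▸ hi)
  have hle : frameSubgroup k l hkl ≤ K := by
    rintro _ ⟨s, t, rfl⟩
    exact K.mul_mem (hmem k (Submodule.subset_span (Set.mem_insert _ _)) s)
      (hmem l (Submodule.subset_span (Set.mem_insert_of_mem _ rfl)) t)
  refine le_antisymm (le_of_directions hclosed hconn hle hr hr1 hrK ?_) hle
  rintro F hF ε X hlim hX ⟨v, hv, hv1, hv2⟩
  rw [hlie] at hv
  obtain ⟨a, c, hac⟩ := Submodule.mem_span_pair.1 hv
  have hac' : v = a • frameVector k + c • frameVector l := hac.symm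
  have e1 : X.1 = a * frameTime k + c * frameTime l := by
    rw [← hv1, hac', frameVector_combination_fst]
  have e2 : ∀ i j, X.2 i j = a * frameMatrix k i j + c * frameMatrix l i j := by
    intro i j
    rw [← hv2, hac']
    exact dEntry_frameVector_combination a c k l i j
  have hentry : ∀ i j, Continuous fun Y : ℝ × Matrix (Fin 2) (Fin 2) ℝ => Y.2 i j := fun i j =>
    continuous_snd.matrix_elem i j
  obtain ⟨h1, h2⟩ := htr F ε a c (fun i j => ((hentry i j).tendsto _).comp hlim)
    (by
      rw [← e1]
      refine ((continuous_fst.tendsto X).comp hX).congr fun x => ?_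
      have h : tCoord (1 : G) = 0 := rfl
      simp [gMatrix, h])
    (fun i j => by
      rw [← e2]
      exact ((hentry i j).tendsto X).comp hX)
  refine Prod.ext (e1.trans h1) ?_
  ext i j
  exact (e2 i j).trans (h2 i j)

variable {E' : Type*} [NormedAddCommGroup E'] [NormedSpace ℝ E']
  {H' : Type*} [TopologicalSpace H'] {I' : ModelWithCorners ℝ E' H'}
  {N : Type*} [TopologicalSpace N] [ChartedSpace H' N]

/-- The map `p` with section `s` is a model of the quotient of `G` by the group generated by
the one-parameter groups `k` and `l`. -/
structure IsQuotientModel (I' : ModelWithCorners ℝ E' H') (b : N → LinearMap.BilinForm ℝ E')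
    (p : G → N) (s : N → G) (k l : Fin 4) : Prop where
  adapted : IsFrameAdapted I' b p {k, l}
  smooth : ContMDiff IG I' ∞ p
  continuous_section : Continuous s
  right_inv : ∀ n, p (s n) = n
  commute : ∀ t u, σ k t * σ l u = σ l u * σ k t
  invariant_left : ∀ x t, p (x * σ k t) = p x
  invariant_right : ∀ x t, p (x * σ l t) = p x
  exists_mul : ∀ x, ∃ t u, s (p x) * (σ k t * σ l u) = x
  section_one : s (p 1) = 1
  transverse : IsTransverse (fun x => s (p x)) k l

variable {b : N → LinearMap.BilinForm ℝ E'} {p : G → N} {s : N → G} {k l : Fin 4}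

/-- Each x is its representative s(p x) times an element of the subgroup, so points with the same
image share a representative. -/
theorem IsQuotientModel.eq_iff (h : IsQuotientModel I' b p s k l) (x y : G) :
    p x = p y ↔ x⁻¹ * y ∈ frameSubgroup k l h.commute := by
  constructor
  · intro hxy
    obtain ⟨t, u, h1⟩ := h.exists_mul x
    obtain ⟨t', u', h2⟩ := h.exists_mul y
    rw [← hxy] at h2
    have e : x⁻¹ * y = (σ k t * σ l u)⁻¹ * (σ k t' * σ l u') := by
      conv_lhs => rw [← h1, ← h2]
      rw [mul_inv_rev, mul_assoc, inv_mul_cancel_left]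
    rw [e]
    exact mul_mem (inv_mem ⟨t, u, rfl⟩) ⟨t', u', rfl⟩
  · rintro ⟨t, u, hxy⟩
    rw [eq_mul_of_inv_mul_eq hxy.symm, ← mul_assoc, h.invariant_right, h.invariant_left]

/-- The subgroup is the fibre of p through 1. -/
theorem IsQuotientModel.isClosed [T1Space N] (h : IsQuotientModel I' b p s k l) :
    IsClosed (frameSubgroup k l h.commute : Set G) := by
  have e : (frameSubgroup k l h.commute : Set G) = p ⁻¹' {p 1} := by
    ext x
    refine Iff.trans ?_ ((h.eq_iff 1 x).symm.trans eq_comm)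
    rw [inv_one, one_mul]
    rfl
  rw [e]
  exact isClosed_singleton.preimage h.smooth.continuous

/-- A one-parameter group in the subgroup is mapped to a point by p, so its velocity is vertical at
1 and lies in the span of fₖ and f_l. -/
theorem IsQuotientModel.isClosedConnectedWithLieAlgebra [T1Space N]
    (h : IsQuotientModel I' b p s k l) :
    IsClosedConnectedWithLieAlgebra IG (frameSubgroup k l h.commute)
      (Submodule.span ℝ {f k, f l}) := by
  refine ⟨h.isClosed, isConnected_frameSubgroup k l h.commute, Set.Subset.antisymm ?_ ?_⟩
  · rintro v ⟨γ, hγ, hadd, hmem, hv⟩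
    have h0 : γ 0 = 1 := by
      have h := hadd 0 0
      rw [add_zero] at h
      exact left_eq_mul.1 h
    have hc : (fun t => p (γ t)) = fun _ => p 1 := by
      funext t
      have h1 := (h.eq_iff 1 (γ t)).2 (by rw [inv_one, one_mul]; exact hmem t)
      exact h1.symm
    have h1 := dMap_comp (I := 𝓘(ℝ, ℝ)) (I' := IG) (I'' := I') (q := p) (p := γ) (x := (0 : ℝ))
      (h.smooth.mdifferentiableAt (by simp)) (hγ.mdifferentiableAt (by simp)) 1
    have h3 : dMap 𝓘(ℝ, ℝ) I' (fun _ : ℝ => p 1) 0 = 0 := mfderiv_const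
    rw [hc, h3, h0] at h1
    have hv' : dMap 𝓘(ℝ, ℝ) IG γ 0 1 = (v : ℝ × (ℂ × ℝ)) := hv
    rw [hv'] at h1
    have h4 := (h.adapted.dMap_eq_zero_iff 1 v).1 h1.symm
    have h5 : v = ∑ j, coeff j 1 v • f j := by
      refine (sum_coeff 1 v).symm.trans (Finset.sum_congr rfl fun j _ => ?_)
      rw [frame_one]
      rfl
    rw [h5]
    refine Submodule.sum_mem _ fun j _ => ?_
    by_cases hj : j ∈ ({k, l} : Finset (Fin 4))
    · refine Submodule.smul_mem _ _ (Submodule.subset_span ?_)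
      rw [Finset.mem_insert, Finset.mem_singleton] at hj
      rcases hj with rfl | rfl
      · exact Set.mem_insert _ _
      · exact Set.mem_insert_of_mem _ rfl
    · rw [h4 j hj, zero_smul]
      exact Submodule.zero_mem _
  · intro v hv
    obtain ⟨a, c, rfl⟩ := Submodule.mem_span_pair.1 hv
    exact mem_lieAlgebraOf_frameSubgroup h.commute a c

theorem IsQuotientModel.exists_homeomorph (h : IsQuotientModel I' b p s k l) {K : Subgroup G}
    (hK : IsClosedConnectedWithLieAlgebra IG K (Submodule.span ℝ {f k, f l})) :
    ∃ Φ : G ⧸ K ≃ₜ N, (fun x => Φ (QuotientGroup.mk x)) = p := by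
  have e := eq_frameSubgroup h.commute (r := fun x => s (p x))
    (h.continuous_section.comp h.smooth.continuous).continuousAt h.section_one (fun x => by
      obtain ⟨t, u, hx⟩ := h.exists_mul x
      exact ⟨_, ⟨t, u, rfl⟩, hx⟩) h.transverse hK
  subst e
  exact exists_quotient_homeomorph h.smooth.continuous h.continuous_section h.right_inv h.eq_iff

end FrameSubgroup

/-! ### Transversality and the four quotients -/

section Models

open Filter Topology

theorem σ_commute_self (k : Fin 4) (t u : ℝ) : σ k t * σ k u = σ k u * σ k t := by
  rw [← σ_add, ← σ_add, add_comm]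

theorem σ_zero_commute_two (t u : ℝ) : σ 0 t * σ 2 u = σ 2 u * σ 0 t :=
  Prod.ext (mul_comm (Multiplicative.ofAdd t) 1) ((one_mul (σ₂ u)).trans (mul_one (σ₂ u)).symm)

theorem eq_zero_of_tendsto_zero {F : Filter G} [NeBot F] {q : G → ℝ} {c : ℝ}
    (h : Tendsto q F (𝓝 c)) (hq : ∀ x, q x = 0) : c = 0 :=
  tendsto_nhds_unique h (tendsto_const_nhds.congr fun x => (hq x).symm)

/-- Only the coordinate of ℝ sees f₀, and it vanishes on the image of the section. -/
theorem isTransverse_of_tCoord_eq_zero {r : G → G} (hr : ∀ x, tCoord (r x) = 0) :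
    IsTransverse r 0 0 := by
  intro F _ ε a c _ ht _
  have h0 := eq_zero_of_tendsto_zero ht fun x => by rw [hr, mul_zero]
  exact ⟨h0, fun i j => by simp [frameMatrix]⟩

/-- The lower left entry of f₁ is -1, while that entry vanishes on triangular matrices. -/
theorem isTransverse_of_triangular {r : G → G} (hr : ∀ x, (r x).2 1 0 = 0) :
    IsTransverse r 1 1 := by
  intro F _ ε a c _ _ hm
  have h0 := eq_zero_of_tendsto_zero (hm 1 0) fun x => by
    rw [hr]
    simp
  have h1 : a + c = 0 := by
    simp [frameMatrix] at h0
    linarith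
  refine ⟨by simp [frameTime], fun i j => ?_⟩
  rw [← add_mul, h1, zero_mul]

/-- The limit direction of matrices with orthogonal rows is orthogonal to `f₂`. -/
theorem offDiagonal_sum_eq_zero {r : G → G}
    (hr : ∀ x, (r x).2 0 0 * (r x).2 0 1 + (r x).2 1 0 * (r x).2 1 1 = 0) {F : Filter G} [NeBot F]
    {ε : G → ℝ} {X : Matrix (Fin 2) (Fin 2) ℝ}
    (hlim : ∀ i j, Tendsto (fun x => (r x).2 i j) F (𝓝 ((1 : SL2) i j)))
    (hm : ∀ i j, Tendsto (fun x => (ε x)⁻¹ * ((r x).2 i j - (1 : SL2) i j)) F (𝓝 (X i j))) :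
    X 0 1 + X 1 0 = 0 := by
  -- Dividing ab + cd = 0 by ε and letting a, d tend to 1 leaves the sum of the off-diagonal entries
  -- of the limit direction.
  have h := ((hlim 0 0).mul (hm 0 1)).add ((hlim 1 1).mul (hm 1 0))
  have h0 := eq_zero_of_tendsto_zero h fun x => by
    have h1 : (1 : SL2) 0 1 = 0 := rfl
    have h2 : (1 : SL2) 1 0 = 0 := rfl
    rw [h1, h2]
    linear_combination (ε x)⁻¹ * hr x
  have h1 : (1 : SL2) 0 0 = 1 := rfl
  have h2 : (1 : SL2) 1 1 = 1 := rfl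
  rwa [h1, h2, one_mul, one_mul] at h0

/-- The off-diagonal entries of f₂ have sum 2, whereas this sum is 0 for directions of the section.
-/
theorem isTransverse_of_orthogonal {r : G → G}
    (hr : ∀ x, (r x).2 0 0 * (r x).2 0 1 + (r x).2 1 0 * (r x).2 1 1 = 0) :
    IsTransverse r 2 2 := by
  intro F _ ε a c hlim _ hm
  have h0 := offDiagonal_sum_eq_zero (X := a • frameMatrix 2 + c • frameMatrix 2) hr hlim hm
  have h1 : a + c = 0 := by
    simp [frameMatrix] at h0
    linarith
  refine ⟨by simp [frameTime], fun i j => ?_⟩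
  rw [← add_mul, h1, zero_mul]

theorem isTransverse_of_tCoord_eq_zero_of_orthogonal {r : G → G} (ht : ∀ x, tCoord (r x) = 0)
    (hr : ∀ x, (r x).2 0 0 * (r x).2 0 1 + (r x).2 1 0 * (r x).2 1 1 = 0) :
    IsTransverse r 0 2 := by
  intro F _ ε a c hlim hτ hm
  have h0 := offDiagonal_sum_eq_zero (X := a • frameMatrix 0 + c • frameMatrix 2) hr hlim hm
  have h1 := eq_zero_of_tendsto_zero hτ fun x => by rw [ht, mul_zero]
  have h2 : c = 0 := by
    simp [frameMatrix] at h0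
    linarith
  exact ⟨h1, fun i j => by simp [frameMatrix, h2]⟩

theorem cylinderSection_orthogonal (n : Circle × ℝ) :
    cylinderSection n 0 0 * cylinderSection n 0 1 +
      cylinderSection n 1 0 * cylinderSection n 1 1 = 0 := by
  simp [cylinderSection]
  ring

theorem cylinderSection_one : cylinderSection (cylinderMap 1) = 1 :=
  cylinderSection_cylinderMap ((norm_column_eq_iff 1).2 (by simp))

theorem triangular_one : triangular (orbitMap 1) = 1 := by
  have h : orbitMap 1 = UpperHalfPlane.I := one_smul _ _
  rw [h]
  ext i j
  fin_cases i <;> fin_cases j <;> simp [triangular]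

/-- The section of `lineMap φ` given by a section of `φ`. -/
def lineSection {N : Type*} (s : N → SL2) (n : ℝ × N) : G := (Multiplicative.ofAdd n.1, s n.2)

theorem lineMap_mul_σ {N : Type*} {φ : SL2 → N} {k : Fin 4} (hk : frameTime k = 0)
    (h : ∀ A t, φ (A * (σ k t).2) = φ A) (x : G) (t : ℝ) :
    lineMap φ (x * σ k t) = lineMap φ x := by
  refine Prod.ext ?_ (h x.2 t)
  refine (tCoord_mul x (σ k t)).trans ?_
  rw [tCoord_σ, hk, zero_mul, add_zero]
  rfl

theorem exists_lineSection_mul {N : Type*} {φ : SL2 → N} {s : N → SL2} {k : Fin 4}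
    (hk : ∀ t, (σ k t).1 = 1) (h : ∀ A, ∃ t, s (φ A) * (σ k t).2 = A) (x : G) :
    ∃ t u, lineSection s (lineMap φ x) * (σ k t * σ k u) = x := by
  obtain ⟨t, ht⟩ := h x.2
  refine ⟨t, 0, ?_⟩
  rw [σ_zero, mul_one]
  refine Prod.ext ?_ ht
  rw [Prod.fst_mul, hk, mul_one]
  rfl

/-- A repeated index encodes a one-dimensional subgroup, since `{f 0, f 0}` is `{f 0}`. The next two
models use the same convention, and only the last one has two different indices. -/
theorem isQuotientModel_snd : IsQuotientModel ISL gSL (Prod.snd : G → SL2) (Prod.mk 1) 0 0 where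
  adapted := by simpa using isFrameAdapted_snd
  smooth := contMDiff_snd
  continuous_section := continuous_const.prodMk continuous_id
  right_inv _ := rfl
  commute := σ_commute_self 0
  invariant_left x _ := mul_one x.2
  invariant_right x _ := mul_one x.2
  exists_mul x := by
    refine ⟨tCoord x, 0, ?_⟩
    rw [σ_zero, mul_one]
    exact Prod.ext (one_mul x.1) (mul_one x.2)
  section_one := rfl
  transverse := isTransverse_of_tCoord_eq_zero fun _ => rfl

theorem isQuotientModel_orbitMap : IsQuotientModel (𝓘(ℝ, ℝ).prod 𝓘(ℝ, ℂ)) (lineProd 𝓘(ℝ, ℂ) hyp02)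
    (lineMap orbitMap) (lineSection triangular) 1 1 where
  adapted := isFrameAdapted_orbitMap.lineMap contMDiff_orbitMap (by decide)
  smooth := contMDiff_lineMap contMDiff_orbitMap
  continuous_section :=
    (contMDiff_ofAdd.continuous.comp continuous_fst).prodMk
      (continuous_triangular.comp continuous_snd)
  right_inv n := Prod.ext rfl (orbitMap_triangular n.2)
  commute := σ_commute_self 1
  invariant_left := lineMap_mul_σ rfl orbitMap_mul_σ₁
  invariant_right := lineMap_mul_σ rfl orbitMap_mul_σ₁
  exists_mul := exists_lineSection_mul (fun _ => rfl) exists_eq_triangular_mul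
  section_one := Prod.ext rfl triangular_one
  transverse := isTransverse_of_triangular fun _ => rfl

theorem isQuotientModel_lineMap_cylinderMap : IsQuotientModel (𝓘(ℝ, ℝ).prod IC) (lineProd IC hyp11)
    (lineMap cylinderMap) (lineSection cylinderSection) 2 2 where
  adapted := isFrameAdapted_cylinderMap.lineMap contMDiff_cylinderMap (by decide)
  smooth := contMDiff_lineMap contMDiff_cylinderMap
  continuous_section :=
    (contMDiff_ofAdd.continuous.comp continuous_fst).prodMk
      (continuous_cylinderSection.comp continuous_snd)
  right_inv n := Prod.ext rfl (cylinderMap_cylinderSection n.2)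
  commute := σ_commute_self 2
  invariant_left := lineMap_mul_σ rfl cylinderMap_mul_σ₂
  invariant_right := lineMap_mul_σ rfl cylinderMap_mul_σ₂
  exists_mul := exists_lineSection_mul (fun _ => rfl) exists_eq_cylinderSection_mul
  section_one := Prod.ext rfl cylinderSection_one
  transverse := isTransverse_of_orthogonal fun x => cylinderSection_orthogonal (cylinderMap x.2)

theorem isQuotientModel_cylinderMap : IsQuotientModel IC hyp11 (fun x : G => cylinderMap x.2)
    (fun n => (1, cylinderSection n)) 0 2 where
  adapted := isFrameAdapted_cylinderMap
  smooth := contMDiff_cylinderMap.comp contMDiff_snd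
  continuous_section := continuous_const.prodMk continuous_cylinderSection
  right_inv := cylinderMap_cylinderSection
  commute := σ_zero_commute_two
  invariant_left x _ := congrArg cylinderMap (mul_one x.2)
  invariant_right x t := cylinderMap_mul_σ₂ x.2 t
  exists_mul x := by
    obtain ⟨t, ht⟩ := exists_eq_cylinderSection_mul x.2
    refine ⟨tCoord x, t, Prod.ext ?_ ?_⟩
    · exact (one_mul _).trans (mul_one x.1)
    · exact (congrArg (cylinderSection (cylinderMap x.2) * ·) (one_mul (σ₂ t))).trans ht
  section_one := Prod.ext rfl cylinderSection_one
  transverse := isTransverse_of_tCoord_eq_zero_of_orthogonal (fun _ => rfl)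
    fun x => cylinderSection_orthogonal (cylinderMap x.2)

variable {E' : Type*} [NormedAddCommGroup E'] [NormedSpace ℝ E']
  {H' : Type*} [TopologicalSpace H'] {I' : ModelWithCorners ℝ E' H'}
  {N : Type*} [TopologicalSpace N] [ChartedSpace H' N]
  {b : N → LinearMap.BilinForm ℝ E'} {p : G → N} {s : N → G} {k : Fin 4}

theorem IsQuotientModel.exists_isClosedConnected [T1Space N] (h : IsQuotientModel I' b p s k k) :
    ∃ K, IsClosedConnectedWithLieAlgebra IG K (Submodule.span ℝ {f k}) := by
  have h1 := h.isClosedConnectedWithLieAlgebra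
  rw [Set.pair_eq_singleton] at h1
  exact ⟨_, h1⟩

theorem IsQuotientModel.exists_isTriplyAntiInvariant [FiniteDimensional ℝ E']
    [IsManifold I' 1 N] (h : IsQuotientModel I' b p s k k)
    (hd : Module.finrank ℝ E' = 3) (hb : IsPseudoRiemannianMetric I' b) (K : Subgroup G)
    (hK : IsClosedConnectedWithLieAlgebra IG K (Submodule.span ℝ {f k})) :
    ∃ Φ : G ⧸ K ≃ₜ N, IsTriplyAntiInvariant I' b (fun x => Φ (QuotientGroup.mk x)) := by
  rw [← Set.pair_eq_singleton] at hK
  obtain ⟨Φ, hΦ⟩ := h.exists_homeomorph hK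
  refine ⟨Φ, ?_⟩
  rw [hΦ]
  have ha := h.adapted
  rw [Finset.pair_eq_singleton] at ha
  exact ha.isTriplyAntiInvariant hd hb h.smooth

/-- J maps the vertical fields f₀, f₂ to the horizontal fields f₁, f₃. J̃ interchanges f₀ and f₂, so
no para-Hermitian statement for J̃ can hold here. -/
theorem exists_isAntiInvariantHermitian (K : Subgroup G)
    (hK : IsClosedConnectedWithLieAlgebra IG K (Submodule.span ℝ {f 0, f 2})) :
    ∃ Φ : G ⧸ K ≃ₜ Circle × ℝ,
      IsAntiInvariantHermitian IG IC gG J hyp11 (fun x => Φ (QuotientGroup.mk x)) := by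
  obtain ⟨Φ, hΦ⟩ := isQuotientModel_cylinderMap.exists_homeomorph hK
  refine ⟨Φ, ?_⟩
  rw [hΦ]
  have ha := isFrameAdapted_cylinderMap
  refine ⟨isHermitian_J, ha.isPseudoRiemannianSubmersion ?_ isPseudoRiemannianMetric_hyp11
    isQuotientModel_cylinderMap.smooth, ha.mapsVertical_J (by decide) (by decide)⟩
  rw [Module.finrank_prod, finrank_euclideanSpace_fin, Module.finrank_self]
  rfl

end Models

end

end AntiInvariant

/-! ### The theorem -/

open AntiInvariant in
theorem mainTheorem4 :
    -- `SL(2, ℝ)` and `G` are Lie groups; `f₀, …, f₃` generate the one-parameter groups `σ`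
    LieGroup ISL ∞ SL2 ∧ LieGroup IG ∞ G ∧
    (∀ i, (∀ s t, σ i (s + t) = σ i s * σ i t) ∧
      (mfderiv 𝓘(ℝ, ℝ) IG (σ i) 0 : ℝ →L[ℝ] ℝ × (ℂ × ℝ)) 1 = f i) ∧
    -- the metric and the structures on `G`
    (∀ x i j, gG x (leftField IG (f i) x) (leftField IG (f j) x) = if i = j then sign i else 0) ∧
    IsPseudoRiemannianMetric IG gG ∧ IsNeutral IG gG ∧ IsBiInvariant IG gG ∧
    IsPseudoRiemannianMetric ISL gSL ∧ IsBiInvariant ISL gSL ∧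
    (∀ x, J x (leftField IG (f 0) x) = leftField IG (f 1) x ∧
      J x (leftField IG (f 1) x) = -leftField IG (f 0) x ∧
      J x (leftField IG (f 2) x) = leftField IG (f 3) x ∧
      J x (leftField IG (f 3) x) = -leftField IG (f 2) x) ∧
    (∀ x, J' x (leftField IG (f 0) x) = leftField IG (f 2) x ∧
      J' x (leftField IG (f 2) x) = leftField IG (f 0) x ∧
      J' x (leftField IG (f 1) x) = -leftField IG (f 3) x ∧
      J' x (leftField IG (f 3) x) = -leftField IG (f 1) x) ∧
    -- the hyperbolic planes have constant curvature `-4`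
    HasConstantSectionalCurvature 𝓘(ℝ, ℂ) hyp02 (-4) ∧
    HasConstantSectionalCurvature IC hyp11 (-4) ∧
    -- the quotient by the subgroup with Lie algebra spanned by `f₀`
    (∃ K, IsClosedConnectedWithLieAlgebra IG K (Submodule.span ℝ {f 0})) ∧
    (∀ K, IsClosedConnectedWithLieAlgebra IG K (Submodule.span ℝ {f 0}) →
      ∃ Φ : G ⧸ K ≃ₜ SL2,
        IsTriplyAntiInvariant ISL gSL (fun x => Φ (QuotientGroup.mk x))) ∧
    -- the quotient by the subgroup with Lie algebra spanned by `f₁`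
    (∃ K, IsClosedConnectedWithLieAlgebra IG K (Submodule.span ℝ {f 1})) ∧
    (∀ K, IsClosedConnectedWithLieAlgebra IG K (Submodule.span ℝ {f 1}) →
      ∃ Φ : G ⧸ K ≃ₜ ℝ × UpperHalfPlane,
        IsTriplyAntiInvariant (𝓘(ℝ, ℝ).prod 𝓘(ℝ, ℂ)) (lineProd 𝓘(ℝ, ℂ) hyp02)
          (fun x => Φ (QuotientGroup.mk x))) ∧
    -- the quotient by the subgroup with Lie algebra spanned by `f₂`
    (∃ K, IsClosedConnectedWithLieAlgebra IG K (Submodule.span ℝ {f 2})) ∧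
    (∀ K, IsClosedConnectedWithLieAlgebra IG K (Submodule.span ℝ {f 2}) →
      ∃ Φ : G ⧸ K ≃ₜ ℝ × (Circle × ℝ),
        IsTriplyAntiInvariant (𝓘(ℝ, ℝ).prod IC) (lineProd IC hyp11)
          (fun x => Φ (QuotientGroup.mk x))) ∧
    -- the quotient by the subgroup with Lie algebra spanned by `f₀, f₂`
    (∃ K, IsClosedConnectedWithLieAlgebra IG K (Submodule.span ℝ {f 0, f 2})) ∧
    (∀ K, IsClosedConnectedWithLieAlgebra IG K (Submodule.span ℝ {f 0, f 2}) →
      ∃ Φ : G ⧸ K ≃ₜ Circle × ℝ,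
        IsAntiInvariantHermitian IG IC gG J hyp11 (fun x => Φ (QuotientGroup.mk x))) := by
  have hd : Module.finrank ℝ (EuclideanSpace ℝ (Fin 1) × ℝ) = 2 := by
    rw [Module.finrank_prod, finrank_euclideanSpace_fin, Module.finrank_self]
  refine ⟨inferInstance, inferInstance, fun i => ⟨σ_add i, dMap_σ i⟩, gForm_frame,
    isPseudoRiemannianMetric_gG, isNeutral_gG, isBiInvariant_gG, isPseudoRiemannianMetric_gSL,
    isBiInvariant_gSL, jMap_frame, fun x => ?_, hasConstantSectionalCurvature_hyp02,
    hasConstantSectionalCurvature_hyp11, isQuotientModel_snd.exists_isClosedConnected,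
    isQuotientModel_snd.exists_isTriplyAntiInvariant ?_ isPseudoRiemannianMetric_gSL,
    isQuotientModel_orbitMap.exists_isClosedConnected,
    isQuotientModel_orbitMap.exists_isTriplyAntiInvariant ?_ isPseudoRiemannianMetric_lineProd_hyp02,
    isQuotientModel_lineMap_cylinderMap.exists_isClosedConnected,
    isQuotientModel_lineMap_cylinderMap.exists_isTriplyAntiInvariant ?_
      isPseudoRiemannianMetric_lineProd_hyp11,
    ⟨_, isQuotientModel_cylinderMap.isClosedConnectedWithLieAlgebra⟩,
    exists_isAntiInvariantHermitian⟩
  · obtain ⟨h0, h1, h2, h3⟩ := jMap'_frame x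
    exact ⟨h0, h2, h1, h3⟩
  · rw [Module.finrank_prod, Complex.finrank_real_complex, Module.finrank_self]
  · rw [Module.finrank_prod, Complex.finrank_real_complex, Module.finrank_self]
  · rw [Module.finrank_prod, hd, Module.finrank_self]
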